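/- **Setting.** Let $G=(V,E)$ be a finite tree with $n=|V|$ vertices and maximum degree $\Delta$, and let $1\le k\le n$. A *configuration* of $k$ agents is a tuple $(v_1,\dots,v_k)$ of pairwise distinct vertices that induce a connected subgraph of $G$. Two configurations are *adjacent* if, for each $i$, the $i$-th entries are equal or joined by an edge; the transition from $\mathcal C$ to an adjacent $\mathcal C'$ is a *1-transition* if exactly one vertex of $\mathcal C'$ is not in $\mathcal C$. The restricted $k$-agent Hamiltonian walk problem ($k$-RHWP) asks for a sequence of configurations $\mathcal C_0,\dots,\mathcal C_l$ of minimum length $l$ such that consecutive configurations are joined by a 1-transition and every vertex of $G$ lies in some $\mathcal C_t$. Its optimal value is denoted $h^r_k(G)$. For a path $P$ and an edge $e$ let $d^k_P(e)=0$ if $e\in P$; if $e=uv\notin P$ with $u$ closer to $P$ than $v$, let $d^k_P(e)=0$ if the component of $v$ in $G-e$, rooted at $v$, has height at most $k-2$, and $d^k_P(e)=1$ otherwise. **Algorithm $k$-RHWP-For-Tree.** The input is given by adjacency lists (in any order). 1. Find a longest path $P^*$, with ends $v_1^*,v_2^*$, by two depth-first searches, and the distances of all vertices to $P^*$. 2.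 Let a single agent start at $v_1^*$ and repeatedly move to an unexplored neighbour (preferably one not on $P^*$; its *parent* is the vertex it was reached from), or to the parent of the current vertex if all neighbours are explored. Place the $k$ agents on the first $k$ vertices explored; the $k$-th is the *head*, the first is the *tail*. 3. While the head is not $v_2^*$, make a transition. Let $G'$ be the subgraph induced by the occupied vertices. - *Head and target.* If the head has no unexplored neighbour but some occupied vertex has one, then such a vertex nearest to the head becomes the new head and the old head becomes the tail. The target is then an unexplored neighbour of the head, preferably not on $P^*$ (the head becomes its parent). If no occupied vertex has an unexplored neighbour, an occupied vertex nearest to $P^*$ becomes the head (and the old head, if different, the tail), and the target is the parent of the head. - *Tail.* If the tail is not a leaf of $G'$, it is replaced by a leaf of $G'$ other than the head and, if possible, other than the occupied vertex nearest to $P^*$; among the eligible leaves, the one that was explored last is taken. (For $k=1$ head and tail coincide.) - *Move.* The agent on the head moves to the target, each other agent on the path from the head to the tail moves one step towards the head, and all other agents stay. The target is explored and becomes the head; the vertex entered by the agent of the old tail becomes the tail. **Theorem.** For every finite tree $G$ and every $1\le k\le n$, and for every longest path $P^*$ of $G$, $$h^r_k(G)=(n-k)+\sum_{e\in E}d^k_{P^*}(e).$$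 The algorithm $k$-RHWP-For-Tree terminates on $G$, and the sequence of configurations it returns is an optimal solution of $k$-RHWP. On a unit-cost random access machine its running time is $O(nk\Delta)$ for $n\ge 2$, with an absolute constant; in particular it is polynomial. -/

import Mathlib

/-! ## Configurations and the restricted Hamiltonian walk problem -/

namespace RHWP

/-- A configuration of `k` agents: agent `i` stands on `c i`, the agents occupy pairwise distinct
vertices, and the occupied vertices induce a connected subgraph. -/
def IsConfiguration {V : Type} (G : SimpleGraph V) {k : ℕ} (c : Fin k → V) : Prop :=
  Function.Injective c ∧ (G.induce (Set.range c)).Connected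

/-- Two configurations are adjacent if every agent stays or moves along an edge. -/
def AdjacentConfigs {V : Type} (G : SimpleGraph V) {k : ℕ} (c c' : Fin k → V) : Prop :=
  ∀ i, c i = c' i ∨ G.Adj (c i) (c' i)

/-- An `r`-transition: the configurations are adjacent, and exactly `r` vertices of the second one
are not occupied in the first one. -/
def IsTransition {V : Type} (G : SimpleGraph V) (r : ℕ) {k : ℕ} (c c' : Fin k → V) : Prop :=
  AdjacentConfigs G c c' ∧ (Set.range c' \ Set.range c).ncard = r

/-- A feasible solution of the restricted `k`-agent Hamiltonian walk problem: a non-empty sequence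
of configurations, consecutive ones being joined by a 1-transition edge, such that every vertex
occurs in one of the configurations. -/
structure IsRestrictedSpanningWalk {V : Type} (G : SimpleGraph V) {k : ℕ}
    (W : List (Fin k → V)) : Prop where
  nonempty : W ≠ []
  config : ∀ c ∈ W, IsConfiguration G c
  chain : W.IsChain (IsTransition G 1)
  spanning : ∀ v, ∃ c ∈ W, v ∈ Set.range c

/-- The lengths (numbers of transitions) of the feasible solutions. -/
def restrictedWalkLengths {V : Type} (G : SimpleGraph V) (k : ℕ) : Set ℕ :=
  {l | ∃ W : List (Fin k → V), IsRestrictedSpanningWalk G W ∧ W.length = l + 1}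

/-! ## The quantity `d` of an edge with respect to a path -/

/-- `P` is a longest path of `G`. -/
def IsLongestPath {V : Type} (G : SimpleGraph V) {a b : V} (P : G.Walk a b) : Prop :=
  P.IsPath ∧ ∀ (x y : V) (Q : G.Walk x y), Q.IsPath → Q.length ≤ P.length

/-- The distance from `v` to (the vertex set of) the path `P`. -/
noncomputable def distToPath {V : Type} (G : SimpleGraph V) {a b : V} (P : G.Walk a b) (v : V) : ℕ :=
  sInf {m | ∃ w ∈ P.support, G.dist v w = m}

/-- The height of the component of `v` in `G` minus the edge `e`, rooted at `v`. (`SimpleGraph.dist`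
is `0` between different components, so only vertices of the component of `v` matter.) -/
noncomputable def branchHeight {V : Type} [Fintype V] (G : SimpleGraph V) (e : Sym2 V) (v : V) : ℕ :=
  Finset.univ.sup fun z => (G.deleteEdges {e}).dist v z

/-- `d` is `0` on the edges of `P`. For another edge `e = uv`, with `u` closer to `P` than `v`, it is
`0` if the branch at `v` has height at most `k - 2`, and `1` otherwise. -/
noncomputable def detour {V : Type} [Fintype V] (G : SimpleGraph V) (k : ℕ) {a b : V}
    (P : G.Walk a b) (e : Sym2 V) : ℕ :=
  open Classical in
  if e ∈ P.edges then 0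
  else if ∃ u v, e = s(u, v) ∧ distToPath G P u < distToPath G P v ∧ k < branchHeight G e v + 2
    then 1 else 0

/-! ## Step-counted computations

The cost model is the unit-cost random access machine. A computation returns its result and the
number of steps it took. Every round of every loop (one list entry, one neighbour, one agent, one
stack entry) is charged at least one step, and between two charges only a bounded number of
elementary operations is made: pattern matches on lists, comparisons of vertices or numbers,
increments, and reads and writes of single array cells. An array indexed by `ι` is a function on `ι`,
written by `Function.update`; each array is used linearly. -/

/-- A result together with the number of steps spent. -/
def Timed (α : Type) : Type := α × ℕ

/-- The result of a computation. -/
def Timed.val {α : Type} (x : Timed α) : α := x.1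

/-- The number of steps of a computation. -/
def Timed.cost {α : Type} (x : Timed α) : ℕ := x.2

instance : Monad Timed where
  pure a := (a, 0)
  bind x f := ((f x.1).1, x.2 + (f x.1).2)

/-- Spend `m` steps. -/
def charge (m : ℕ) : Timed Unit := ((), m)

/-- Spend one step. -/
def tick : Timed Unit := charge 1

/-- `WhileRun guard body s s' t`: the loop `while guard do body`, started in the state `s`, stops in
the state `s'` after `t` steps. -/
inductive WhileRun {σ : Type} (guard : σ → Bool) (body : σ → Timed σ) : σ → σ → ℕ → Prop
  | exit {s : σ} : guard s = false → WhileRun guard body s s 1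
  | iter {s s' : σ} {t : ℕ} : guard s = true → WhileRun guard body (body s).val s' t →
      WhileRun guard body s s' (1 + (body s).cost + t)

/-- The first entry with property `p`. -/
def findT {α : Type} (p : α → Bool) : List α → Timed (Option α)
  | [] => do tick; pure none
  | x :: xs => do
    tick
    if p x then pure (some x) else findT p xs

/-- The number of entries with property `p`. -/
def countT {α : Type} (p : α → Bool) : List α → Timed ℕ
  | [] => do tick; pure 0
  | x :: xs => do
    tick
    let m ← countT p xs
    pure (if p x then m + 1 else m)

/-- The entries that pass the test `p`, in the same order. -/
def filterT {α : Type} (p : α → Timed Bool) : List α → Timed (List α)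
  | [] => do tick; pure []
  | x :: xs => do
    tick
    let b ← p x
    let ys ← filterT p xs
    pure (if b then x :: ys else ys)

/-- An entry of `y :: xs` at which `f` is least. -/
def argMinT {α : Type} (f : α → ℕ) (y : α) : List α → Timed α
  | [] => do tick; pure y
  | x :: xs => do
    tick
    if f x < f y then argMinT f x xs else argMinT f y xs

/-- An entry of `y :: xs` at which `f` is greatest. -/
def argMaxT {α : Type} (f : α → ℕ) (y : α) : List α → Timed α
  | [] => do tick; pure y
  | x :: xs => do
    tick
    if f y < f x then argMaxT f x xs else argMaxT f y xs

/-- Write the values `g x` into the cells `key x` of an array. -/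
def storeT {α V β : Type} [DecidableEq V] (key : α → V) (g : α → β) :
    List α → (V → β) → Timed (V → β)
  | [], a => do tick; pure a
  | x :: xs, a => do
    tick
    storeT key g xs (Function.update a (key x) (g x))

/-! ## The input, and searching a tree -/

/-- A finite graph given by its list of vertices and its adjacency lists. -/
structure AdjLists (V : Type) where
  verts : List V
  nbrs : V → List V

/-- The adjacency lists describe the graph `G`; the order of the lists is arbitrary. -/
structure AdjLists.Represents {V : Type} (A : AdjLists V) (G : SimpleGraph V) : Prop where
  verts_nodup : A.verts.Nodup
  mem_verts : ∀ v, v ∈ A.verts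
  nbrs_nodup : ∀ v, (A.nbrs v).Nodup
  mem_nbrs : ∀ v w, w ∈ A.nbrs v ↔ G.Adj v w

/-- A fresh array whose cells, one for each vertex, all hold `x`. -/
def newArray {V β : Type} (A : AdjLists V) (x : β) : Timed (V → β) := do
  charge (A.verts.length + 1)
  pure fun _ => x

/-- A vertex met by a depth-first search, with its predecessor and its depth. -/
structure Visit (V : Type) where
  vertex : V
  pred : Option V
  depth : ℕ

/-- Push the active neighbours of `x`, except its predecessor, onto the stack. -/
def pushNbrs {V : Type} [DecidableEq V] (active : V → Bool) (x : Visit V) :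
    List V → List (Visit V) → Timed (List (Visit V))
  | [], st => do tick; pure st
  | w :: ws, st => do
    tick
    if active w && decide (x.pred ≠ some w) then
      pushNbrs active x ws (⟨w, some x.vertex, x.depth + 1⟩ :: st)
    else pushNbrs active x ws st

/-- Depth-first search of a forest inside the active vertices: at most `m` rounds, starting from the
given stack. The visits are returned in reverse order, in front of `acc`. -/
def search {V : Type} [DecidableEq V] (A : AdjLists V) (active : V → Bool) :
    ℕ → List (Visit V) → List (Visit V) → Timed (List (Visit V))
  | 0, _, acc => do tick; pure acc
  | _ + 1, [], acc => do tick; pure acc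
  | m + 1, x :: st, acc => do
    tick
    let st' ← pushNbrs active x (A.nbrs x.vertex) st
    search A active m st' (x :: acc)

/-- Follow the predecessors from a vertex back to the root of a search, given the visits in reverse
order. The result is the path from the vertex to the root. -/
def traceBack {V : Type} [DecidableEq V] : Option V → List (Visit V) → Timed (List V)
  | _, [] => do tick; pure []
  | none, _ :: _ => do tick; pure []
  | some v, x :: xs => do
    tick
    if x.vertex = v then
      let p ← traceBack x.pred xs
      pure (v :: p)
    else traceBack (some v) xs

/-! ## The algorithm: preparation -/

/-- The data computed before any agent is deployed: the end vertices of the selected longest path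
`P*`, the indicator of `P*`, and the distances to `P*`. -/
structure Prep (V : Type) where
  start : V
  goal : V
  onPath : V → Bool
  distP : V → ℕ

/-- Two depth-first searches find a longest path `P*`; a third one finds the distances to `P*`. -/
def prepare {V : Type} [DecidableEq V] (A : AdjLists V) (root : V) : Timed (Prep V) := do
  let n := A.verts.length
  let r₀ : Visit V := ⟨root, none, 0⟩
  let l₁ ← search A (fun _ => true) n [r₀] []
  let a ← argMaxT Visit.depth r₀ l₁
  let r₁ : Visit V := ⟨a.vertex, none, 0⟩
  let l₂ ← search A (fun _ => true) n [r₁] []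
  let b ← argMaxT Visit.depth r₁ l₂
  let p ← traceBack (some b.vertex) l₂
  let blank ← newArray A false
  let onPath ← storeT id (fun _ => true) p blank
  charge p.length
  let l₃ ← search A (fun v => !onPath v) n (p.map fun v => ⟨v, none, 0⟩) []
  let zero ← newArray A 0
  let distP ← storeT Visit.vertex Visit.depth l₃ zero
  pure ⟨b.vertex, a.vertex, onPath, distP⟩

/-- The next vertex to explore from a vertex with the given neighbours: an unexplored neighbour,
preferably one that is not on `P*`. -/
def nextUnexplored {V : Type} (S : Prep V) (explored : V → Bool) (nbrs : List V) :
    Timed (Option V) := do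
  let x ← findT (fun w => !explored w && !S.onPath w) nbrs
  match x with
  | some w => pure (some w)
  | none => findT (fun w => !explored w) nbrs

/-! ## The algorithm: deployment of the agents by the one-agent strategy -/

/-- The state of the one-agent traversal: the current vertex, the explored vertices, their parents,
the time at which each vertex was explored first, the number of vertices explored so far, and the
agents placed so far (agent `i` on `pos i`; `occ v` is the agent on `v`, if any). -/
structure Deploy (V : Type) where
  cur : V
  explored : V → Bool
  parent : V → Option V
  stamp : V → ℕ
  count : ℕ
  pos : ℕ → V
  occ : V → Option ℕ

/-- The first vertex explored is the start of `P*`; agent `0` is placed there. -/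
def deployInit {V : Type} [DecidableEq V] (A : AdjLists V) (k : ℕ) (S : Prep V) :
    Timed (Deploy V) := do
  let explored ← newArray A false
  let parent ← newArray A none
  let stamp ← newArray A 0
  let occ ← newArray A none
  charge (k + 1)
  pure
    { cur := S.start
      explored := Function.update explored S.start true
      parent := parent
      stamp := stamp
      count := 1
      pos := fun _ => S.start
      occ := Function.update occ S.start (some 0) }

/-- One move of the one-agent strategy: explore a new neighbour, preferably off `P*`, or go back to
the parent. The `i`-th explored vertex receives the `i`-th agent. -/
def deployStep {V : Type} [DecidableEq V] (A : AdjLists V) (S : Prep V) (d : Deploy V) :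
    Timed (Deploy V) := do
  tick
  let x ← nextUnexplored S d.explored (A.nbrs d.cur)
  match x with
  | some w =>
    pure {
        cur := w
        explored := Function.update d.explored w true
        parent := Function.update d.parent w (some d.cur)
        stamp := Function.update d.stamp w d.count
        count := d.count + 1
        pos := Function.update d.pos d.count w
        occ := Function.update d.occ w (some d.count) }
  | none => pure { d with cur := (d.parent d.cur).getD d.cur }

/-! ## The algorithm: transitions -/

/-- The state of the transition phase. `walk` is the list of the configurations so far, the latest
one first. -/
structure State (V : Type) (k : ℕ) where
  pos : ℕ → V
  occ : V → Option ℕ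
  explored : V → Bool
  parent : V → Option V
  stamp : V → ℕ
  clock : ℕ
  head : V
  tail : V
  walk : List (Fin k → V)

/-- Output the current configuration. -/
def snapshot {V : Type} (k : ℕ) (pos : ℕ → V) : Timed (Fin k → V) := do
  charge (k + 1)
  pure fun i => pos i

/-- The state after the deployment: the head is the `k`-th explored vertex, the tail is the first. -/
def startState {V : Type} (k : ℕ) (S : Prep V) (d : Deploy V) : Timed (State V k) := do
  let c ← snapshot k d.pos
  pure
    { pos := d.pos, occ := d.occ, explored := d.explored, parent := d.parent, stamp := d.stamp
      clock := d.count, head := d.pos (k - 1), tail := S.start, walk := [c] }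

/-- Is `v` a leaf of the subgraph induced by the occupied vertices? -/
def isLeafT {V : Type} (A : AdjLists V) (occ : V → Option ℕ) (v : V) : Timed Bool := do
  let m ← countT (fun w => (occ w).isSome) (A.nbrs v)
  pure (decide (m = 1))

/-- The choice of head, tail and target. If the head has an unexplored neighbour, head and tail are
kept. Otherwise, if some occupied vertex has an unexplored neighbour, the one nearest to the head
becomes the head, and the old head becomes the tail. In both cases the target is an unexplored
neighbour of the head, preferably off `P*`. If no occupied vertex has an unexplored neighbour, the
occupied vertex nearest to `P*` becomes the head (and the old head the tail, if it is different),
and the target is the parent of the head. Returns head, tail and target. -/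
def chooseHead {V : Type} [DecidableEq V] {k : ℕ} (A : AdjLists V) (S : Prep V) (s : State V k) :
    Timed (V × V × V) := do
  tick
  let x ← nextUnexplored S s.explored (A.nbrs s.head)
  match x with
  | some w => pure (s.head, s.tail, w)
  | none => do
    let l ← search A (fun v => (s.occ v).isSome) k [⟨s.head, none, 0⟩] []
    let cands ← filterT (fun y => do
      let z ← findT (fun w => !s.explored w) (A.nbrs y.vertex)
      pure z.isSome) l
    match cands with
    | y :: ys => do
      let h ← argMinT Visit.depth y ys
      let z ← nextUnexplored S s.explored (A.nbrs h.vertex)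
      pure (h.vertex, s.head, z.getD h.vertex)
    | [] => do
      let h ← argMinT (fun y : Visit V => S.distP y.vertex) ⟨s.head, none, 0⟩ l
      let t := if h.vertex = s.head then s.tail else s.head
      pure (h.vertex, t, (s.parent h.vertex).getD h.vertex)

/-- The choice of the tail. A tail that is a leaf of the occupied subgraph `G'` is kept. Otherwise
the tail becomes a leaf of `G'`, other than the head and, if possible, other than the occupied vertex
nearest to `P*`; among these leaves it is the one that was explored last. -/
def chooseTail {V : Type} [DecidableEq V] {k : ℕ} (A : AdjLists V) (S : Prep V) (s : State V k)
    (head tail : V) : Timed V := do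
  let ok ← isLeafT A s.occ tail
  if ok then pure tail
  else do
    charge k
    let occupied := (List.range k).map s.pos
    let u ← argMinT S.distP head occupied
    let leaves ← filterT (isLeafT A s.occ) occupied
    let l₁ ← filterT (fun v => pure (decide (v ≠ head))) leaves
    let l₂ ← filterT (fun v => pure (decide (v ≠ u))) l₁
    match l₂, l₁ with
    | y :: ys, _ => argMaxT s.stamp y ys
    | [], y :: ys => argMaxT s.stamp y ys
    | [], [] => pure tail

/-- Move the agents on the path `v₁, …, vₚ`, given as a list, to `dest, v₁, …, vₚ₋₁`, and free `vₚ`.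
Returns the new positions, the new occupation, and the vertex that the agent on `vₚ` moved to. -/
def followHead {V : Type} [DecidableEq V] :
    V → List V → (ℕ → V) → (V → Option ℕ) → Timed ((ℕ → V) × (V → Option ℕ) × V)
  | dest, [], pos, occ => do tick; pure (pos, occ, dest)
  | dest, v :: vs, pos, occ => do
    tick
    let i := (occ v).getD 0
    let pos' := Function.update pos i dest
    let occ' := Function.update (Function.update occ dest (some i)) v none
    match vs with
    | [] => pure (pos', occ', dest)
    | _ :: _ => followHead v vs pos' occ'

/-- One transition. -/
def transitionStep {V : Type} [DecidableEq V] {k : ℕ} (A : AdjLists V) (S : Prep V)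
    (s : State V k) : Timed (State V k) := do
  tick
  let hd ← chooseHead A S s
  let head := hd.1
  let target := hd.2.2
  let tail ← chooseTail A S s head hd.2.1
  let l ← search A (fun v => (s.occ v).isSome) k [⟨tail, none, 0⟩] []
  let p ← traceBack (some head) l
  let m ← followHead target p s.pos s.occ
  let c ← snapshot k m.1
  let new := !s.explored target
  pure
    { pos := m.1
      occ := m.2.1
      explored := Function.update s.explored target true
      parent := if new then Function.update s.parent target (some head) else s.parent
      stamp := if new then Function.update s.stamp target s.clock else s.stamp
      clock := s.clock + 1
      head := target
      tail := m.2.2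
      walk := c :: s.walk }

/-- `KRHWPForTree A k W t`: the algorithm, run with `k` agents on the graph given by the adjacency
lists `A`, halts after `t` steps and returns the sequence `W` of configurations. The agents are
deployed on the first `k` vertices explored by the one-agent strategy; then transitions are made
until the head is the end of `P*`. -/
def KRHWPForTree {V : Type} [DecidableEq V] (A : AdjLists V) (k : ℕ) (W : List (Fin k → V))
    (t : ℕ) : Prop :=
  ∃ root, A.verts.head? = some root ∧
    let prep := prepare A root
    let S := prep.val
    let init := deployInit A k S
    ∃ (d : Deploy V) (t₁ : ℕ),
      WhileRun (fun d => decide (d.count < k)) (deployStep A S) init.val d t₁ ∧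
      let first := startState k S d
      ∃ (s : State V k) (t₂ : ℕ),
        WhileRun (fun s => decide (s.head ≠ S.goal)) (transitionStep A S) first.val s t₂ ∧
        W = s.walk.reverse ∧
        t = prep.cost + init.cost + t₁ + first.cost + t₂ + s.walk.length

end RHWP

/-! Root the tree at one end `r` of a longest path P*, with other end `g` and length L, and let each
vertex `v ≠ r` stand for the edge above it. An edge off P* has detour 1 exactly when its lower end
is deep, i.e. when the subtree below it reaches at least k - 1 levels further down (`sum_detour`).
With D the set of deep vertices off P*, the optimum has to be (n - k) + |D|.

Lower bound (`IsSweep.lower_bound`). Say that a transition crosses an edge if the agents, so far all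
on one side, get their first vertex on the other side. A transition enters one new vertex, so it
crosses at most one edge, and the length of a walk is at least the total number of crossings. Every
edge outside the first configuration is crossed at least once, which gives n - k. Now consider the
edges both of whose sides have height at least k - 1; the agents must be entirely on either side of
such an edge at some time. If such an edge is crossed no more often than already counted, it is
crossed exactly once, and the walk finally settles on one side of it. Edges of this kind lie along a
single path that can be prolonged by k - 1 at both ends, so there are at most L + 2 - 2k of them
(`card_le_of_passed_once`). But P* alone has that many edges with two deep sides, and the edges of D
have two deep sides as well, because a branch off a longest path is no higher than the part of the
path above it. Hence at least |D| crossings come on top.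

Upper bound. The algorithm is a depth-first search: vertices that still have an unexplored neighbour
lie above the head (`IsSearchState`). As P* is followed only when nothing else is left, everything
is explored once `g` is (`IsSearchState.all_explored`). A transition either explores a vertex or
lifts the head, then the top of the occupied set, out of an exhausted branch off P*. The latter is
paid for by the vertex that is left, at most once for each vertex, provided that this vertex is
deep. So `potential` drops in every transition, from at most (n - k) + |D|, and the lower bound
forces equality.

The core is therefore the invariant `OnlyInDeep`: the agents never lie entirely in a shallow branch
off P*. At the moment when they have all passed down into such a branch they have to form a
descending path, whose k vertices prove the branch deep. This holds if no side branches hang on the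
trail from the tail to the head (`IsBareTrail`), which the rule for a new tail achieves because the
last explored leaf lies in the newest branch. Before the tail first turns off P* side branches may
exist, but only near the start (`IsFirstTrail`), and the maximality of P* excludes them from the
branch that is entered.

The argument works for any longest path (`exists_isPrep`), which gives the formula for every P*. For
the running time, each of the at most 2n transitions is a bounded number of searches among k
vertices. -/

namespace RHWP

/-! ## Rooted trees -/

section Rooted

variable {V : Type} {G : SimpleGraph V} {r : V}

/-- The neighbour of `v` that is closer to the root `r`; the root is its own parent. -/
noncomputable def parent (G : SimpleGraph V) (r v : V) : V :=
  open Classical in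
  if h : ∃ u, G.Adj v u ∧ G.dist r u + 1 = G.dist r v then h.choose else v

/-- `a` is an ancestor of `b` (or equal to `b`) in the tree rooted at `r`. -/
def IsAnc (G : SimpleGraph V) (r a b : V) : Prop := ∃ m, (parent G r)^[m] b = a

theorem parent_root : parent G r r = r := by
  unfold parent
  rw [dif_neg]
  rintro ⟨u, -, h⟩
  simp at h

theorem exists_closer (hG : G.IsTree) {v : V} (hv : v ≠ r) :
    ∃ u, G.Adj v u ∧ G.dist r u + 1 = G.dist r v := by
  obtain ⟨p, hp⟩ := hG.connected.exists_walk_length_eq_dist v r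
  cases p with
  | nil => exact absurd rfl hv
  | @cons _ u _ h q =>
    refine ⟨u, h, ?_⟩
    have h1 : G.dist u r ≤ q.length := SimpleGraph.dist_le q
    have h2 := hG.dist_eq_dist_add_one_of_adj r h
    simp only [SimpleGraph.Walk.length_cons] at hp
    rw [SimpleGraph.dist_comm] at h1 hp
    omega

theorem adj_parent (hG : G.IsTree) {v : V} (hv : v ≠ r) : G.Adj v (parent G r v) := by
  have h := exists_closer hG hv
  unfold parent
  rw [dif_pos h]
  exact h.choose_spec.1

theorem dist_parent (hG : G.IsTree) {v : V} (hv : v ≠ r) :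
    G.dist r (parent G r v) + 1 = G.dist r v := by
  have h := exists_closer hG hv
  unfold parent
  rw [dif_pos h]
  exact h.choose_spec.2

/-- Two closer neighbours would yield two geodesics from `r` to `v`, but the path between two
vertices of a tree is unique. -/
theorem closer_unique (hG : G.IsTree) {v u u' : V} (h : G.Adj v u) (h' : G.Adj v u')
    (hd : G.dist r u + 1 = G.dist r v) (hd' : G.dist r u' + 1 = G.dist r v) : u = u' := by
  obtain ⟨p, hp⟩ := hG.connected.exists_walk_length_eq_dist r u
  obtain ⟨p', hp'⟩ := hG.connected.exists_walk_length_eq_dist r u'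
  have hq : (p.concat h.symm).IsPath :=
    SimpleGraph.Walk.isPath_of_length_eq_dist _ (by simp [hp, hd])
  have hq' : (p'.concat h'.symm).IsPath :=
    SimpleGraph.Walk.isPath_of_length_eq_dist _ (by simp [hp', hd'])
  have h2 := (hG.existsUnique_path r v).unique hq hq'
  have h3 : (p.concat h.symm).penultimate = (p'.concat h'.symm).penultimate := by rw [h2]
  simpa using h3

theorem parent_eq_of_adj (hG : G.IsTree) {v u : V} (h : G.Adj v u)
    (hd : G.dist r u < G.dist r v) : v ≠ r ∧ parent G r v = u := by
  have hv : v ≠ r := by rintro rfl; simp at hd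
  have h2 := hG.dist_eq_dist_add_one_of_adj r h
  exact ⟨hv, closer_unique hG (adj_parent hG hv) h (dist_parent hG hv) (by omega)⟩

theorem adj_cases (hG : G.IsTree) {x y : V} (h : G.Adj x y) :
    (x ≠ r ∧ parent G r x = y) ∨ (y ≠ r ∧ parent G r y = x) := by
  have h2 := hG.dist_ne_of_adj r h
  rcases lt_or_gt_of_ne h2 with h3 | h3
  · exact Or.inr (parent_eq_of_adj hG h.symm h3)
  · exact Or.inl (parent_eq_of_adj hG h h3)

namespace IsAnc

theorem refl (a : V) : IsAnc G r a a := ⟨0, rfl⟩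

theorem trans {a b c : V} (h : IsAnc G r a b) (h' : IsAnc G r b c) : IsAnc G r a c := by
  obtain ⟨m, rfl⟩ := h
  obtain ⟨l, rfl⟩ := h'
  exact ⟨m + l, by rw [Function.iterate_add_apply]⟩

theorem parent_left (v : V) : IsAnc G r (parent G r v) v := ⟨1, rfl⟩

theorem cases {a b : V} (h : IsAnc G r a b) : a = b ∨ (b ≠ r ∧ IsAnc G r a (parent G r b)) := by
  by_cases hab : a = b
  · exact Or.inl hab
  · obtain ⟨m, rfl⟩ := h
    cases m with
    | zero => simp at hab
    | succ m =>
      refine Or.inr ⟨?_, m, rfl⟩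
      rintro rfl
      have : ∀ m, (parent G b)^[m] b = b := fun m => Function.iterate_fixed parent_root m
      exact hab (this _)

theorem parent_right {a b : V} (h : IsAnc G r a b) (hab : a ≠ b) : IsAnc G r a (parent G r b) :=
  (h.cases.resolve_left hab).2

theorem ne_root {a b : V} (h : IsAnc G r a b) (hab : a ≠ b) : b ≠ r :=
  (h.cases.resolve_left hab).1

theorem dist_add (hG : G.IsTree) {a b : V} (h : IsAnc G r a b) : G.dist r a ≤ G.dist r b := by
  obtain ⟨m, rfl⟩ := h
  induction m with
  | zero => rfl
  | succ m ih =>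
    rw [Function.iterate_succ_apply']
    by_cases hr : (parent G r)^[m] b = r
    · rw [hr, parent_root]; simp
    · have := dist_parent hG hr
      omega

theorem dist_lt (hG : G.IsTree) {a b : V} (h : IsAnc G r a b) (hab : a ≠ b) :
    G.dist r a < G.dist r b := by
  have h1 := (h.parent_right hab).dist_add hG
  have h2 := dist_parent hG (h.ne_root hab)
  omega

theorem eq_of_dist_le (hG : G.IsTree) {a b : V} (h : IsAnc G r a b)
    (hd : G.dist r b ≤ G.dist r a) : a = b := by
  by_contra hab
  have := h.dist_lt hG hab
  omega

theorem antisymm (hG : G.IsTree) {a b : V} (h : IsAnc G r a b) (h' : IsAnc G r b a) : a = b :=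
  h.eq_of_dist_le hG (h'.dist_add hG)

theorem root (hG : G.IsTree) (v : V) : IsAnc G r r v := by
  induction hn : G.dist r v using Nat.strong_induction_on generalizing v with
  | _ n ih =>
    by_cases hv : v = r
    · rw [hv]; exact refl r
    · have := dist_parent hG hv
      exact (ih _ (by omega) (parent G r v) rfl).trans (parent_left v)

theorem total {a b c : V} (h : IsAnc G r a c) (h' : IsAnc G r b c) :
    IsAnc G r a b ∨ IsAnc G r b a := by
  obtain ⟨m, rfl⟩ := h
  obtain ⟨l, rfl⟩ := h'
  rcases le_total m l with hml | hml
  · right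
    exact ⟨l - m, by rw [← Function.iterate_add_apply, Nat.sub_add_cancel hml]⟩
  · left
    exact ⟨m - l, by rw [← Function.iterate_add_apply, Nat.sub_add_cancel hml]⟩

theorem of_dist_le (hG : G.IsTree) {a b c : V} (h : IsAnc G r a c) (h' : IsAnc G r b c)
    (hd : G.dist r a ≤ G.dist r b) : IsAnc G r a b := by
  rcases h.total h' with h1 | h1
  · exact h1
  · rw [h1.eq_of_dist_le hG hd]; exact refl _

theorem eq_of_dist_eq (hG : G.IsTree) {a b c : V} (h : IsAnc G r a c) (h' : IsAnc G r b c)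
    (hd : G.dist r a = G.dist r b) : a = b :=
  (h.of_dist_le hG h' hd.le).eq_of_dist_le hG hd.ge

/-- The child of a proper ancestor in the direction of the descendant. -/
theorem exists_child {a b : V} (h : IsAnc G r a b) (hab : a ≠ b) :
    ∃ c, c ≠ r ∧ parent G r c = a ∧ IsAnc G r c b := by
  obtain ⟨m, rfl⟩ := h
  induction m with
  | zero => exact absurd rfl hab
  | succ m ih =>
    by_cases hr : (parent G r)^[m] b = r
    · have he : (parent G r)^[m + 1] b = (parent G r)^[m] b := by
        rw [Function.iterate_succ_apply', hr, parent_root]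
      rw [he] at hab ⊢
      exact ih hab
    · exact ⟨_, hr, (Function.iterate_succ_apply' _ _ _).symm, m, rfl⟩

theorem exists_of_dist (hG : G.IsTree) {b : V} {i : ℕ} (hi : i ≤ G.dist r b) :
    ∃ a, IsAnc G r a b ∧ G.dist r a = i := by
  induction hn : G.dist r b - i generalizing i with
  | zero => exact ⟨b, refl b, by omega⟩
  | succ n ih =>
    obtain ⟨a, ha, hd⟩ := ih (i := i + 1) (by omega) (by omega)
    have har : a ≠ r := by rintro rfl; simp at hd
    have := dist_parent hG har
    exact ⟨parent G r a, (parent_left a).trans ha, by omega⟩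

end IsAnc

/-- An edge that leaves a subtree joins its top to the parent of the top. -/
theorem eq_of_adj_leaving (hG : G.IsTree) {v x y : V} (h : G.Adj x y) (hx : IsAnc G r v x)
    (hy : ¬ IsAnc G r v y) : x = v ∧ v ≠ r ∧ y = parent G r v := by
  rcases adj_cases (r := r) hG h with ⟨h1, rfl⟩ | ⟨h1, rfl⟩
  · by_cases hvx : v = x
    · subst hvx; exact ⟨rfl, h1, rfl⟩
    · exact absurd (hx.parent_right hvx) hy
  · exact absurd (hx.trans (IsAnc.parent_left y)) hy

theorem not_isAnc_parent (hG : G.IsTree) {v : V} (hv : v ≠ r) : ¬ IsAnc G r v (parent G r v) := by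
  intro h
  have := h.dist_add hG
  have := dist_parent hG hv
  omega

/-- The distance is measured through the last common ancestor. -/
theorem exists_common_anc (hG : G.IsTree) (x y : V) :
    ∃ c, IsAnc G r c x ∧ IsAnc G r c y ∧ G.dist r x + G.dist r y ≤ G.dist x y + 2 * G.dist r c := by
  obtain ⟨w, hw⟩ := hG.connected.exists_walk_length_eq_dist x y
  rw [← hw]
  clear hw
  induction w with
  | nil => exact ⟨_, IsAnc.refl _, IsAnc.refl _, by omega⟩
  | @cons x x' y h w ih =>
    obtain ⟨c, hc, hcy, hd⟩ := ih
    rw [SimpleGraph.Walk.length_cons]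
    rcases adj_cases (r := r) hG h with ⟨h1, rfl⟩ | ⟨h1, rfl⟩
    · have := dist_parent hG h1
      exact ⟨c, hc.trans (IsAnc.parent_left x), hcy, by omega⟩
    · have := dist_parent hG h1
      -- If the common ancestor is `x'` itself, it has to be replaced by the parent `x`; the
      -- additional edge of the walk pays for this.
      by_cases hcx : c = x'
      · subst hcx
        exact ⟨_, IsAnc.refl _, (IsAnc.parent_left c).trans hcy, by omega⟩
      · exact ⟨c, hc.parent_right hcx, hcy, by omega⟩

theorem dist_of_isAnc (hG : G.IsTree) {a b : V} (h : IsAnc G r a b) :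
    G.dist a b + G.dist r a = G.dist r b := by
  have h1 : G.dist r b ≤ G.dist r a + G.dist a b := hG.connected.dist_triangle
  refine le_antisymm ?_ (by omega)
  obtain ⟨m, rfl⟩ := h
  clear h1
  induction m with
  | zero => simp
  | succ m ih =>
    by_cases hr : (parent G r)^[m] b = r
    · have he : (parent G r)^[m + 1] b = (parent G r)^[m] b := by
        rw [Function.iterate_succ_apply', hr, parent_root]
      rw [he]
      exact ih
    · rw [Function.iterate_succ_apply']
      have h2 := dist_parent hG hr
      have h3 := SimpleGraph.dist_eq_one_iff_adj.2 (adj_parent hG hr).symm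
      have h4 : G.dist (parent G r ((parent G r)^[m] b)) b ≤
        G.dist (parent G r ((parent G r)^[m] b)) ((parent G r)^[m] b) +
          G.dist ((parent G r)^[m] b) b := hG.connected.dist_triangle
      omega

theorem dist_add_le_of_common_anc (hG : G.IsTree) {c x y : V} (hx : IsAnc G r c x)
    (hy : IsAnc G r c y) : G.dist x y + 2 * G.dist r c ≤ G.dist r x + G.dist r y := by
  have h1 := dist_of_isAnc hG hx
  have h2 := dist_of_isAnc hG hy
  have h3 : G.dist x y ≤ G.dist x c + G.dist c y := hG.connected.dist_triangle
  rw [SimpleGraph.dist_comm (u := x) (v := c)] at h3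
  omega

/-- The distance between a vertex outside and a vertex inside a subtree. -/
theorem dist_into_subtree (hG : G.IsTree) {v y z : V} (hv : v ≠ r) (hy : ¬ IsAnc G r v y)
    (hz : IsAnc G r v z) : G.dist y z + G.dist r v = G.dist y (parent G r v) + 1 + G.dist r z := by
  obtain ⟨c, hcy, hcz, hd⟩ := exists_common_anc (r := r) hG y z
  have hcv : IsAnc G r c v := (hcz.total hz).resolve_right fun h => hy (h.trans hcy)
  have hne : c ≠ v := by rintro rfl; exact hy hcy
  have h1 := dist_add_le_of_common_anc hG hcy (hcv.parent_right hne)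
  have h2 := dist_parent hG hv
  have h3 : G.dist y z ≤ G.dist y (parent G r v) + G.dist (parent G r v) z :=
    hG.connected.dist_triangle
  have h4 := dist_of_isAnc hG ((IsAnc.parent_left v).trans hz)
  omega

/-- The four-point inequality of trees. -/
theorem four_point (hG : G.IsTree) (q a x y : V) :
    G.dist q a + G.dist x y ≤ max (G.dist q x + G.dist a y) (G.dist q y + G.dist a x) := by
  obtain ⟨c, hca, hcx, hc⟩ := exists_common_anc (r := q) hG a x
  obtain ⟨d, hda, hdy, hd⟩ := exists_common_anc (r := q) hG a y
  -- Both `c` and `d` are ancestors of `a`, hence comparable. The higher of the two is a common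
  -- ancestor of `x` and `y` and bounds their distance.
  rcases hca.total hda with h | h
  · have := dist_add_le_of_common_anc hG hcx (h.trans hdy)
    exact le_max_of_le_right (by omega)
  · have := dist_add_le_of_common_anc hG (h.trans hcx) hdy
    exact le_max_of_le_left (by omega)

/-! ### Connected sets of vertices -/

/-- A walk inside `S` that leaves the subtree of `v` has to use the only edge that leads out of it.
-/
theorem mem_of_connected (hG : G.IsTree) {S : Set V} (hS : (G.induce S).Connected) {v x y : V}
    (hx : x ∈ S) (hy : y ∈ S) (hvx : IsAnc G r v x) (hvy : ¬ IsAnc G r v y) :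
    v ∈ S ∧ parent G r v ∈ S ∧ v ≠ r := by
  obtain ⟨w⟩ := hS.preconnected ⟨x, hx⟩ ⟨y, hy⟩
  generalize hx' : (⟨x, hx⟩ : S) = x' at w
  generalize hy' : (⟨y, hy⟩ : S) = y' at w
  induction w generalizing x with
  | nil => subst hx'; simp at hy'; exact absurd (hy' ▸ hvx) hvy
  | @cons a b c h w ih =>
    subst hx' hy'
    have hab : G.Adj x b := h
    by_cases hb : IsAnc G r v b
    · exact ih b.2 hb rfl rfl
    · obtain ⟨rfl, hr, hb'⟩ := eq_of_adj_leaving hG hab hvx hb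
      exact ⟨hx, hb' ▸ b.2, hr⟩

/-- `t` is the top of a set of vertices that is closed under taking parents, except at `t`. -/
def IsTop (G : SimpleGraph V) (r : V) (S : Set V) (t : V) : Prop :=
  t ∈ S ∧ ∀ x ∈ S, x ≠ t → x ≠ r ∧ parent G r x ∈ S

namespace IsTop

variable {S : Set V} {t : V}

theorem isAnc (hG : G.IsTree) (h : IsTop G r S t) {x : V} (hx : x ∈ S) : IsAnc G r t x := by
  induction hn : G.dist r x using Nat.strong_induction_on generalizing x with
  | _ n ih =>
    by_cases hxt : x = t
    · rw [hxt]; exact IsAnc.refl t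
    · obtain ⟨hr, hp⟩ := h.2 x hx hxt
      have := dist_parent hG hr
      exact (ih _ (by omega) hp rfl).trans (IsAnc.parent_left x)

theorem mem_of_isAnc (hG : G.IsTree) (h : IsTop G r S t) {a x : V} (hx : x ∈ S)
    (hta : IsAnc G r t a) (hax : IsAnc G r a x) : a ∈ S := by
  induction hn : G.dist r x using Nat.strong_induction_on generalizing x with
  | _ n ih =>
    by_cases hxa : a = x
    · rw [hxa]; exact hx
    · have hxt : x ≠ t := by
        rintro rfl
        exact hxa (hax.antisymm hG hta)
      obtain ⟨hr, hp⟩ := h.2 x hx hxt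
      have := dist_parent hG hr
      exact ih _ (by omega) hp (hax.parent_right hxa) rfl

theorem connected (hG : G.IsTree) (h : IsTop G r S t) : (G.induce S).Connected := by
  have key : ∀ x (hx : x ∈ S), (G.induce S).Reachable ⟨x, hx⟩ ⟨t, h.1⟩ := by
    intro x hx
    induction hn : G.dist r x using Nat.strong_induction_on generalizing x with
    | _ n ih =>
      by_cases hxt : x = t
      · subst hxt; exact SimpleGraph.Reachable.refl _
      · obtain ⟨hr, hp⟩ := h.2 x hx hxt
        have h1 := dist_parent hG hr
        have h2 : (G.induce S).Adj ⟨x, hx⟩ ⟨_, hp⟩ := adj_parent hG hr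
        exact h2.reachable.trans (ih _ (by omega) _ hp rfl)
  have : Nonempty S := ⟨⟨t, h.1⟩⟩
  exact ⟨fun x y => (key x x.2).trans (key y y.2).symm⟩

/-- Every member of the set lies below a member without children in the set. -/
theorem exists_below [Finite V] (hG : G.IsTree) {x : V} (hx : x ∈ S) :
    ∃ y ∈ S, IsAnc G r x y ∧ ∀ z ∈ S, z ≠ r → parent G r z ≠ y := by
  obtain ⟨y, ⟨hy, hxy⟩, hmax⟩ := Set.exists_max_image {y | y ∈ S ∧ IsAnc G r x y} (G.dist r)
    (Set.toFinite _) ⟨x, hx, IsAnc.refl x⟩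
  refine ⟨y, hy, hxy, fun z hz hr hzy => ?_⟩
  have h1 := hmax z ⟨hz, hxy.trans (hzy ▸ IsAnc.parent_left z)⟩
  have h2 := dist_parent hG hr
  rw [hzy] at h2
  omega

end IsTop

end Rooted

/-! ### Lower bound: counting the crossings of edges -/

section LowerBound

variable {V : Type} {G : SimpleGraph V} {r : V}

/-- The subtree below `v` has height at least `k - 1`. -/
def IsDeep (G : SimpleGraph V) (r : V) (k : ℕ) (v : V) : Prop :=
  ∃ z, IsAnc G r v z ∧ G.dist r v + k ≤ G.dist r z + 1

/-- In a tree of diameter `G.dist r g`, a branch off the path from `r` to `g` is at most as high as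
the part of the path above it. -/
theorem dist_le_of_off_path (hG : G.IsTree) {g : V} (hL : ∀ x y, G.dist x y ≤ G.dist r g) {v z : V}
    (hv : ¬ IsAnc G r v g) (hz : IsAnc G r v z) :
    ∃ c, IsAnc G r c g ∧ IsAnc G r c v ∧ c ≠ v ∧ G.dist r z ≤ 2 * G.dist r c := by
  obtain ⟨c, hcz, hcg, hd⟩ := exists_common_anc (r := r) hG z g
  have := hL z g
  have hcv : IsAnc G r c v := (hcz.total hz).resolve_right fun h => hv (h.trans hcg)
  exact ⟨c, hcg, hcv, by rintro rfl; exact hv hcg, by omega⟩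

theorem dist_lt_ncard_of_connected [Finite V] {S : Set V} (hS : (G.induce S).Connected) {x y : V}
    (hx : x ∈ S) (hy : y ∈ S) : G.dist x y + 1 ≤ S.ncard := by
  classical
  have := Fintype.ofFinite S
  obtain ⟨p, hp⟩ := hS.preconnected.exists_isPath ⟨x, hx⟩ ⟨y, hy⟩
  have h1 := hp.length_lt
  have h2 := SimpleGraph.dist_le (p.map (SimpleGraph.Embedding.induce S).toHom)
  rw [SimpleGraph.Walk.length_map] at h2
  rw [← Nat.card_coe_set_eq, Nat.card_eq_fintype_card]
  exact (Nat.succ_le_succ h2).trans h1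

/-- A finite chain of deep vertices extends to a long descending path. -/
theorem exists_long_of_chain (hG : G.IsTree) {k : ℕ} {C : Finset V} (hne : C.Nonempty)
    (hC : ∀ v ∈ C, ∀ w ∈ C, IsAnc G r v w ∨ IsAnc G r w v) (hd : ∀ v ∈ C, IsDeep G r k v) :
    ∃ v ∈ C, ∃ z, IsAnc G r v z ∧ G.dist r v + C.card + k ≤ G.dist r z + 2 := by
  classical
  obtain ⟨v, hv, hmin⟩ := C.exists_min_image (G.dist r) hne
  obtain ⟨w, hw, hmax⟩ := C.exists_max_image (G.dist r) hne
  obtain ⟨z, hwz, hz⟩ := hd w hw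
  have hle : ∀ x ∈ C, ∀ y ∈ C, G.dist r x ≤ G.dist r y → IsAnc G r x y := by
    intro x hx y hy hxy
    rcases hC x hx y hy with h | h
    · exact h
    · rw [h.eq_of_dist_le hG hxy]; exact IsAnc.refl _
  refine ⟨v, hv, z, (hle v hv w hw (hmin w hw)).trans hwz, ?_⟩
  have hcard : C.card ≤ (Finset.Icc (G.dist r v) (G.dist r w)).card := by
    refine Finset.card_le_card_of_injOn (G.dist r) (fun x hx => ?_) fun x hx y hy hxy => ?_
    · exact Finset.mem_coe.2 (Finset.mem_Icc.2 ⟨hmin x hx, hmax x hx⟩)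
    · exact (hle x hx y hy hxy.le).antisymm hG (hle y hy x hx hxy.ge)
  rw [Nat.card_Icc] at hcard
  have := hmin w hw
  omega

/-- The sets `S t` enter `A` in the step from `t` to `t + 1`. -/
def Enters (S : ℕ → Set V) (A : Set V) (t : ℕ) : Prop :=
  (∀ x ∈ S t, x ∉ A) ∧ ∃ x ∈ S (t + 1), x ∈ A

theorem exists_enters {S : ℕ → Set V} {A : Set V} {i j : ℕ} (hij : i ≤ j)
    (hi : ∀ x ∈ S i, x ∉ A) (hj : ∃ x ∈ S j, x ∈ A) : ∃ t, i ≤ t ∧ t < j ∧ Enters S A t := by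
  induction j, hij using Nat.le_induction with
  | base => obtain ⟨x, hx, hxA⟩ := hj; exact absurd hxA (hi x hx)
  | succ j hij ih =>
    by_cases h : ∃ x ∈ S j, x ∈ A
    · obtain ⟨t, h1, h2, h3⟩ := ih h
      exact ⟨t, h1, h2.trans (Nat.lt_succ_self j), h3⟩
    · push Not at h
      exact ⟨j, hij, Nat.lt_succ_self j, h, hj⟩

/-- The sequence starts outside `A`, is inside `A` at some time, and does not leave `A` completely
after such a time. -/
def EndsIn (S : ℕ → Set V) (T : ℕ) (A : Set V) : Prop :=
  (∀ x ∈ S 0, x ∉ A) ∧ (∃ t ≤ T, ∀ x ∈ S t, x ∈ A) ∧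
    ∀ t t', t ≤ t' → t' ≤ T → (∀ x ∈ S t, x ∈ A) → ∃ x ∈ S t', x ∈ A

/-- Take the later of the two times at which the sequence is inside `A` and inside `B`: it is then
inside one of the sets and still meets the other. -/
theorem EndsIn.exists_mem {S : ℕ → Set V} {T : ℕ} {A B : Set V} (hA : EndsIn S T A)
    (hB : EndsIn S T B) : ∃ x, x ∈ A ∧ x ∈ B := by
  obtain ⟨-, ⟨s, hs, hsA⟩, hA3⟩ := hA
  obtain ⟨-, ⟨t, ht, htB⟩, hB3⟩ := hB
  rcases le_total s t with h | h
  · obtain ⟨x, hx, hxA⟩ := hA3 s t h ht hsA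
    exact ⟨x, hxA, htB x hx⟩
  · obtain ⟨x, hx, hxB⟩ := hB3 t s h hs htB
    exact ⟨x, hsA x hx, hxB⟩

/-- The sequence passes the edge above `v` in the step from `t` to `t + 1`. -/
def Crosses (G : SimpleGraph V) (r : V) (S : ℕ → Set V) (v : V) (t : ℕ) : Prop :=
  Enters S {x | IsAnc G r v x} t ∨ Enters S {x | ¬ IsAnc G r v x} t

/-- Only `x` can be the vertex on the new side, and its neighbour `y` is on the old side, so `xy` is
the edge above `v`. -/
theorem Crosses.eq_or (hG : G.IsTree) {S : ℕ → Set V} {v x y : V} {t : ℕ} (hxy : G.Adj y x)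
    (hy : y ∈ S t) (hx : S (t + 1) ⊆ insert x (S t)) (h : Crosses G r S v t) :
    (v = x ∧ y = parent G r v ∧ v ≠ r) ∨ (v = y ∧ x = parent G r v ∧ v ≠ r) := by
  rcases h with ⟨h1, z, hz, hzA⟩ | ⟨h1, z, hz, hzA⟩
  · have hzx : z = x := (hx hz).resolve_right fun h => h1 z h hzA
    subst hzx
    obtain ⟨rfl, h2, h3⟩ := eq_of_adj_leaving hG hxy.symm hzA (h1 y hy)
    exact Or.inl ⟨rfl, h3, h2⟩
  · have hzx : z = x := (hx hz).resolve_right fun h => h1 z h hzA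
    subst hzx
    obtain ⟨rfl, h2, h3⟩ := eq_of_adj_leaving hG hxy (not_not.1 (h1 y hy)) hzA
    exact Or.inr ⟨rfl, h3, h2⟩

/-- Both crossed edges are `xy`. In the mixed cases each of `x` and `y` would be the parent of the
other. -/
theorem Crosses.unique (hG : G.IsTree) {S : ℕ → Set V} {v w x y : V} {t : ℕ} (hxy : G.Adj y x)
    (hy : y ∈ S t) (hx : S (t + 1) ⊆ insert x (S t)) (hv : Crosses G r S v t)
    (hw : Crosses G r S w t) : v = w := by
  rcases hv.eq_or hG hxy hy hx with ⟨h1, h2, h3⟩ | ⟨h1, h2, h3⟩ <;>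
  rcases hw.eq_or hG hxy hy hx with ⟨h4, h5, h6⟩ | ⟨h4, h5, h6⟩
  · rw [h1, h4]
  · have a := dist_parent hG h3
    have b := dist_parent hG h6
    rw [← h2, ← h4] at a
    rw [← h5, ← h1] at b
    omega
  · have a := dist_parent hG h3
    have b := dist_parent hG h6
    rw [← h2, ← h4] at a
    rw [← h5, ← h1] at b
    omega
  · rw [h1, h4]

/-- A sequence of connected vertex sets of size `k` that grows by at most one vertex in each
step. -/
structure IsSweep (G : SimpleGraph V) (k T : ℕ) (S : ℕ → Set V) : Prop where
  connected : ∀ t ≤ T, (G.induce (S t)).Connected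
  ncard : ∀ t ≤ T, (S t).ncard = k
  step : ∀ t < T, ∃ x y, G.Adj y x ∧ y ∈ S t ∧ S (t + 1) ⊆ insert x (S t)
  spanning : ∀ v, ∃ t ≤ T, v ∈ S t

/-- Both sides of the edge above `v` have height at least `k - 1`. -/
def IsBothDeep (G : SimpleGraph V) (r : V) (k : ℕ) (v : V) : Prop :=
  v ≠ r ∧ IsDeep G r k v ∧ ∃ y, ¬ IsAnc G r v y ∧ k ≤ G.dist y (parent G r v) + 1

namespace IsSweep

variable {k T : ℕ} {S : ℕ → Set V}

theorem nonempty (hS : IsSweep G k T S) {t : ℕ} (ht : t ≤ T) : ∃ x, x ∈ S t :=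
  have := (hS.connected t ht).nonempty
  ⟨_, (Classical.arbitrary (S t)).2⟩

/-- A connected set of `k` vertices has diameter at most `k - 1`. While it contains a vertex that is
`k - 1` steps beyond the edge, it cannot reach across the edge. -/
theorem exists_inside [Finite V] (hG : G.IsTree) (hS : IsSweep G k T S) {v : V}
    (hv : IsBothDeep G r k v) :
    (∃ t ≤ T, ∀ x ∈ S t, IsAnc G r v x) ∧ ∃ t ≤ T, ∀ x ∈ S t, ¬ IsAnc G r v x := by
  obtain ⟨hr, ⟨z, hvz, hz⟩, y, hvy, hy⟩ := hv
  constructor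
  · obtain ⟨t, ht, hzt⟩ := hS.spanning z
    refine ⟨t, ht, fun x hx => ?_⟩
    by_contra hvx
    have h1 := dist_lt_ncard_of_connected (hS.connected t ht) hx hzt
    have h2 := dist_into_subtree hG hr hvx hvz
    rw [hS.ncard t ht] at h1
    omega
  · obtain ⟨t, ht, hyt⟩ := hS.spanning y
    refine ⟨t, ht, fun x hx hvx => ?_⟩
    have h1 := dist_lt_ncard_of_connected (hS.connected t ht) hyt hx
    have h2 := dist_into_subtree hG hr hvy hvx
    have h3 := hvx.dist_add hG
    rw [hS.ncard t ht] at h1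
    omega

open Classical in
/-- The steps in which the edge above `v` is passed. -/
noncomputable def crossings (G : SimpleGraph V) (r : V) (T : ℕ) (S : ℕ → Set V) (v : V) :
    Finset ℕ := (Finset.range T).filter (Crosses G r S v)

open Classical in
-- Double counting of the pairs of an edge and a step that crosses it: a step crosses at most one
-- edge.
theorem sum_crossings_le (hG : G.IsTree) (hS : IsSweep G k T S) (B : Finset V) :
    ∑ v ∈ B, (crossings G r T S v).card ≤ T := by
  have h := Finset.sum_card_bipartiteAbove_eq_sum_card_bipartiteBelow (s := B)
    (t := Finset.range T) (Crosses G r S)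
  unfold Finset.bipartiteAbove at h
  unfold crossings
  rw [h]
  calc _ ≤ ∑ t ∈ Finset.range T, 1 := by
        refine Finset.sum_le_sum fun t ht => Finset.card_le_one.2 fun v hv w hw => ?_
        obtain ⟨x, y, hxy, hy, hx⟩ := hS.step t (Finset.mem_range.1 ht)
        simp only [Finset.bipartiteBelow, Finset.mem_filter] at hv hw
        exact hv.2.unique hG hxy hy hx hw.2
    _ = T := by simp

theorem exists_crossing (hS : IsSweep G k T S) {v : V} {i j : ℕ} (hi : i ≤ T) (hj : j ≤ T)
    (hiv : ∀ x ∈ S i, IsAnc G r v x) (hjv : ∀ x ∈ S j, ¬ IsAnc G r v x) :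
    0 < (crossings G r T S v).card := by
  classical
  rw [Finset.card_pos]
  obtain ⟨a, ha⟩ := hS.nonempty hi
  obtain ⟨b, hb⟩ := hS.nonempty hj
  rcases le_total i j with hij | hij
  · obtain ⟨t, -, h2, h3⟩ := exists_enters (A := {x | ¬ IsAnc G r v x}) hij
      (fun x hx => not_not.2 (hiv x hx)) ⟨b, hb, hjv b hb⟩
    refine ⟨t, ?_⟩
    simp only [crossings, Finset.mem_filter, Finset.mem_range]
    exact ⟨by omega, Or.inr h3⟩
  · obtain ⟨t, -, h2, h3⟩ := exists_enters (A := {x | IsAnc G r v x}) hij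
      hjv ⟨a, ha, hiv a ha⟩
    refine ⟨t, ?_⟩
    simp only [crossings, Finset.mem_filter, Finset.mem_range]
    exact ⟨by omega, Or.inl h3⟩

/-- Getting into `A` from outside takes one crossing, and leaving it completely later would take a
second. `A` and `B` are the two sides of the edge above `v`, in either order. -/
theorem endsIn_of_crossings (hS : IsSweep G k T S) {v : V} {A B : Set V}
    (hc : (crossings G r T S v).card ≤ 1) (hAB : ∀ x, x ∈ B ↔ x ∉ A)
    (hA : ∀ t, Enters S A t → Crosses G r S v t) (hB : ∀ t, Enters S B t → Crosses G r S v t)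
    (h0 : ∀ x ∈ S 0, x ∉ A) (hi : ∃ t ≤ T, ∀ x ∈ S t, x ∈ A) : EndsIn S T A := by
  classical
  refine ⟨h0, hi, fun i j hij hj hiA => ?_⟩
  by_contra hjA
  push Not at hjA
  obtain ⟨a, ha⟩ := hS.nonempty (hij.trans hj)
  obtain ⟨b, hb⟩ := hS.nonempty hj
  obtain ⟨s, -, h2, h3⟩ := exists_enters (Nat.zero_le i) h0 ⟨a, ha, hiA a ha⟩
  obtain ⟨t, h4, h5, h6⟩ := exists_enters (A := B) hij
    (fun x hx h => (hAB x).1 h (hiA x hx)) ⟨b, hb, (hAB b).2 (hjA b hb)⟩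
  have hst := Finset.card_le_one.1 hc s
    (by simp only [crossings, Finset.mem_filter, Finset.mem_range]; exact ⟨by omega, hA s h3⟩) t
    (by simp only [crossings, Finset.mem_filter, Finset.mem_range]; exact ⟨by omega, hB t h6⟩)
  omega

/-- The first set lies on one side of an edge that it does not contain. -/
theorem start_side (hG : G.IsTree) (hS : IsSweep G k T S) {v : V}
    (hv : ¬ (v ∈ S 0 ∧ parent G r v ∈ S 0)) :
    (∀ x ∈ S 0, ¬ IsAnc G r v x) ∨ ∀ x ∈ S 0, IsAnc G r v x := by
  by_contra! h
  obtain ⟨⟨x, hx, hvx⟩, y, hy, hvy⟩ := h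
  have := mem_of_connected hG (hS.connected 0 (Nat.zero_le _)) hx hy hvx hvy
  exact hv ⟨this.1, this.2.1⟩

/-- The first set lies on one side of the edge, and the end of the edge on the other side has to be
visited. -/
theorem crossings_pos (hG : G.IsTree) (hS : IsSweep G k T S) {v : V} (hr : v ≠ r)
    (hv : ¬ (v ∈ S 0 ∧ parent G r v ∈ S 0)) : 0 < (crossings G r T S v).card := by
  classical
  rw [Finset.card_pos]
  rcases hS.start_side hG hv with h | h
  · obtain ⟨j, hj, hjv⟩ := hS.spanning v
    obtain ⟨t, -, h2, h3⟩ := exists_enters (A := {x | IsAnc G r v x}) (Nat.zero_le j) h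
      ⟨v, hjv, IsAnc.refl v⟩
    refine ⟨t, ?_⟩
    simp only [crossings, Finset.mem_filter, Finset.mem_range]
    exact ⟨by omega, Or.inl h3⟩
  · obtain ⟨j, hj, hjv⟩ := hS.spanning (parent G r v)
    obtain ⟨t, -, h2, h3⟩ := exists_enters (A := {x | ¬ IsAnc G r v x}) (Nat.zero_le j)
      (fun x hx => not_not.2 (h x hx)) ⟨_, hjv, not_isAnc_parent hG hr⟩
    refine ⟨t, ?_⟩
    simp only [crossings, Finset.mem_filter, Finset.mem_range]
    exact ⟨by omega, Or.inr h3⟩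

open Classical in
/-- The number of edges that have to be passed for the first time. -/
theorem card_le_sum_start [Fintype V] (hG : G.IsTree) (hS : IsSweep G k T S) :
    Fintype.card V ≤
      (∑ v ∈ Finset.univ.erase r, if v ∈ S 0 ∧ parent G r v ∈ S 0 then 0 else 1) + k := by
  have h0 := hS.ncard 0 (Nat.zero_le _)
  obtain ⟨t, ht, hmin⟩ := Set.exists_min_image (S 0) (G.dist r) (Set.toFinite _)
    (hS.nonempty (Nat.zero_le _))
  -- The topmost vertex of `S 0` has no parent in `S 0`, so at most `k - 1` edges lie inside `S 0`.
  have h1 : ((Finset.univ.erase r).filter fun v => v ∈ S 0 ∧ parent G r v ∈ S 0).card + 1 ≤ k := by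
    rw [← h0, Set.ncard_eq_toFinset_card' (S 0)]
    have hsub : insert t ((Finset.univ.erase r).filter fun v => v ∈ S 0 ∧ parent G r v ∈ S 0) ⊆
        (S 0).toFinset := by
      intro v hv
      simp only [Finset.mem_insert, Finset.mem_filter] at hv
      rcases hv with rfl | hv
      · simpa using ht
      · simpa using hv.2.1
    have hnot : t ∉ (Finset.univ.erase r).filter fun v => v ∈ S 0 ∧ parent G r v ∈ S 0 := by
      intro h
      simp only [Finset.mem_filter, Finset.mem_erase] at h
      have a := hmin _ h.2.2
      have b := dist_parent hG h.1.1
      omega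
    have := Finset.card_le_card hsub
    rwa [Finset.card_insert_of_notMem hnot] at this
  have h2 := Finset.card_filter_add_card_filter_not (s := Finset.univ.erase r)
    (fun v => v ∈ S 0 ∧ parent G r v ∈ S 0)
  rw [Finset.card_erase_of_mem (Finset.mem_univ r), Finset.card_univ] at h2
  have h3 : (∑ v ∈ Finset.univ.erase r, if v ∈ S 0 ∧ parent G r v ∈ S 0 then 0 else 1) =
      ((Finset.univ.erase r).filter fun v => ¬ (v ∈ S 0 ∧ parent G r v ∈ S 0)).card := by
    rw [Finset.card_filter]
    exact Finset.sum_congr rfl fun v _ => by split_ifs <;> rfl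
  rw [h3]
  omega

/-- The edges with two deep sides that are passed only once form a path, which is short. -/
theorem card_le_of_passed_once [Finite V] (hG : G.IsTree) (hS : IsSweep G k T S) {L : ℕ}
    (hL : ∀ x y, G.dist x y ≤ L) {F : Finset V} (hF : ∀ v ∈ F, IsBothDeep G r k v)
    (hc : ∀ v ∈ F, (crossings G r T S v).card ≤ 1)
    (hc' : ∀ v ∈ F, ¬ (v ∈ S 0 ∧ parent G r v ∈ S 0)) : F.card ≤ L + 2 - 2 * k := by
  classical
  -- Each edge is given the direction of its only crossing: `Fd` collects the edges crossed
  -- downwards, `Fu` those crossed upwards.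
  have hends : ∀ v ∈ F, EndsIn S T {x | IsAnc G r v x} ∨ EndsIn S T {x | ¬ IsAnc G r v x} := by
    intro v hv
    obtain ⟨h1, h2⟩ := hS.exists_inside hG (hF v hv)
    rcases hS.start_side hG (hc' v hv) with h | h
    · exact Or.inl (hS.endsIn_of_crossings (hc v hv) (B := {x | ¬ IsAnc G r v x})
        (fun x => Iff.rfl) (fun t => Or.inl) (fun t => Or.inr) h h1)
    · exact Or.inr (hS.endsIn_of_crossings (hc v hv) (B := {x | IsAnc G r v x})
        (fun x => by simp) (fun t => Or.inr) (fun t => Or.inl)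
        (fun x hx => not_not.2 (h x hx)) h2)
  set Fd := F.filter fun v => EndsIn S T {x | IsAnc G r v x} with hFd
  set Fu := F.filter fun v => EndsIn S T {x | ¬ IsAnc G r v x} with hFu
  have hcard : F.card ≤ Fd.card + Fu.card := by
    refine le_trans (Finset.card_le_card fun v hv => ?_) (Finset.card_union_le _ _)
    rcases hends v hv with h | h
    · exact Finset.mem_union_left _ (Finset.mem_filter.2 ⟨hv, h⟩)
    · exact Finset.mem_union_right _ (Finset.mem_filter.2 ⟨hv, h⟩)
  have hdF : ∀ v ∈ Fd, IsBothDeep G r k v := fun v hv => hF v (Finset.mem_filter.1 hv).1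
  have huF : ∀ v ∈ Fu, IsBothDeep G r k v := fun v hv => hF v (Finset.mem_filter.1 hv).1
  have hdd : ∀ v ∈ Fd, ∀ w ∈ Fd, IsAnc G r v w ∨ IsAnc G r w v := by
    intro v hv w hw
    obtain ⟨x, h1, h2⟩ := (Finset.mem_filter.1 hv).2.exists_mem (Finset.mem_filter.1 hw).2
    exact IsAnc.total h1 h2
  obtain ⟨s, hs⟩ := hS.nonempty (Nat.zero_le _)
  -- Edges crossed upwards all lie above the starting point `s`; those crossed downwards are
  -- comparable because their final sides meet.
  have huu : ∀ v ∈ Fu, ∀ w ∈ Fu, IsAnc G r v w ∨ IsAnc G r w v := by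
    intro v hv w hw
    exact (not_not.1 ((Finset.mem_filter.1 hv).2.1 s hs)).total
      (not_not.1 ((Finset.mem_filter.1 hw).2.1 s hs))
  have hdu : ∀ v ∈ Fd, ∀ w ∈ Fu, ¬ IsAnc G r v w ∧ ¬ IsAnc G r w v := by
    intro v hv w hw
    refine ⟨fun h => ?_, fun h => ?_⟩
    · exact (Finset.mem_filter.1 hv).2.1 s hs
        (h.trans (not_not.1 ((Finset.mem_filter.1 hw).2.1 s hs)))
    · obtain ⟨x, h1, h2⟩ := (Finset.mem_filter.1 hv).2.exists_mem (Finset.mem_filter.1 hw).2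
      exact h2 (h.trans h1)
  have single : ∀ C : Finset V, C.Nonempty → (∀ v ∈ C, IsBothDeep G r k v) →
      (∀ v ∈ C, ∀ w ∈ C, IsAnc G r v w ∨ IsAnc G r w v) → C.card + 2 * k ≤ L + 2 := by
    intro C hne hC hch
    obtain ⟨v, hv, z, hvz, hz⟩ := exists_long_of_chain hG hne hch fun v hv => (hC v hv).2.1
    obtain ⟨hr, -, y, hvy, hy⟩ := hC v hv
    have h1 := dist_into_subtree hG hr hvy hvz
    have h2 := hL y z
    omega
  rcases Finset.eq_empty_or_nonempty Fd with hd0 | hdne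
  · rcases Finset.eq_empty_or_nonempty Fu with hu0 | hune
    · rw [hd0, hu0] at hcard
      simp at hcard
      simp [hcard]
    · have := single Fu hune huF huu
      rw [hd0] at hcard
      simp at hcard
      omega
  · rcases Finset.eq_empty_or_nonempty Fu with hu0 | hune
    · have := single Fd hdne hdF hdd
      rw [hu0] at hcard
      simp at hcard
      omega
    -- The two chains hang in disjoint branches, so the path from `y` up through `Fu` and down
    -- through `Fd` to `z` contains both. Its length is at most `L`.
    · obtain ⟨v, hv, z, hvz, hz⟩ := exists_long_of_chain hG hdne hdd fun v hv => (hdF v hv).2.1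
      obtain ⟨w, hw, y, hwy, hy⟩ := exists_long_of_chain hG hune huu fun v hv => (huF v hv).2.1
      have h1 : ¬ IsAnc G r v y := fun h => by
        rcases h.total hwy with h' | h'
        · exact (hdu v hv w hw).1 h'
        · exact (hdu v hv w hw).2 h'
      have h2 : ¬ IsAnc G r w (parent G r v) := fun h =>
        (hdu v hv w hw).2 (h.trans (IsAnc.parent_left v))
      have h3 := dist_into_subtree hG (hdF v hv).1 h1 hvz
      have h4 := dist_into_subtree hG (huF w hw).1 h2 hwy
      rw [SimpleGraph.dist_comm] at h4
      have h5 := hL y z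
      omega

open Classical in
-- `E` contains the disjoint sets `D` and `Q`, the latter on the selected path; `F` are the members
-- of `E` that are crossed no more often than the first visits require. From `F.card ≤ Q.card` it
-- follows that `E \ F` has at least `D.card` members, each of them crossed once more than required.
theorem lower_bound [Fintype V] (hG : G.IsTree) (hS : IsSweep G k T S) (hk : 1 ≤ k) {g : V}
    (hL : ∀ x y, G.dist x y ≤ G.dist r g) :
    Fintype.card V + (Finset.univ.filter fun v => ¬ IsAnc G r v g ∧ IsDeep G r k v).card ≤
      T + k := by
  set D := Finset.univ.filter fun v => ¬ IsAnc G r v g ∧ IsDeep G r k v with hD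
  set Q := Finset.univ.filter fun v => IsAnc G r v g ∧ k ≤ G.dist r v ∧
    G.dist r v + k ≤ G.dist r g + 1 with hQ
  set E := Finset.univ.filter fun v => IsBothDeep G r k v with hE
  set F := E.filter fun v => (crossings G r T S v).card ≤
    if v ∈ S 0 ∧ parent G r v ∈ S 0 then 0 else 1 with hF
  have hDE : D ⊆ E := by
    intro v hv
    simp only [hD, hE, Finset.mem_filter, Finset.mem_univ, true_and] at hv ⊢
    obtain ⟨hvg, z, hvz, hz⟩ := hv
    obtain ⟨c, hcg, hcv, hne, hd⟩ := dist_le_of_off_path hG hL hvg hvz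
    have h1 := hcv.dist_lt hG hne
    have hr := hcv.ne_root hne
    have h2 := dist_parent hG hr
    -- The root is the far vertex on the upper side: the branch at `v` has height at least `k - 1`,
    -- and the path from `r` to the branching point `c` is at least as long.
    refine ⟨hr, ⟨z, hvz, hz⟩, r, fun h => hr (h.antisymm hG (IsAnc.root hG v)), by omega⟩
  have hQE : Q ⊆ E := by
    intro v hv
    simp only [hQ, hE, Finset.mem_filter, Finset.mem_univ, true_and] at hv ⊢
    obtain ⟨hvg, h1, h2⟩ := hv
    have hr : v ≠ r := by rintro rfl; simp at h1; omega
    have h3 := dist_parent hG hr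
    exact ⟨hr, ⟨g, hvg, h2⟩, r, fun h => hr (h.antisymm hG (IsAnc.root hG v)), by omega⟩
  have hDQ : D.card + Q.card ≤ E.card := by
    rw [← Finset.card_union_of_disjoint]
    · exact Finset.card_le_card (Finset.union_subset hDE hQE)
    · refine Finset.disjoint_left.2 fun v h1 h2 => ?_
      exact (Finset.mem_filter.1 h1).2.1 (Finset.mem_filter.1 h2).2.1
  have hQc : G.dist r g + 2 - 2 * k ≤ Q.card := by
    -- The path has a vertex at each depth from `k` to `G.dist r g + 1 - k`, and all of them belong
    -- to `Q`.
    have h1 : (Finset.Icc k (G.dist r g + 1 - k)).card ≤ (Q.image (G.dist r)).card := by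
      refine Finset.card_le_card fun i hi => ?_
      rw [Finset.mem_Icc] at hi
      obtain ⟨a, ha, hai⟩ := IsAnc.exists_of_dist (r := r) hG (b := g) (i := i) (by omega)
      exact Finset.mem_image.2 ⟨a, Finset.mem_filter.2 ⟨Finset.mem_univ _, ha, by omega, by omega⟩,
        hai⟩
    have h2 := Finset.card_image_le (s := Q) (f := G.dist r)
    rw [Nat.card_Icc] at h1
    omega
  have hFc : F.card ≤ G.dist r g + 2 - 2 * k := by
    -- An edge inside `S 0` with two deep sides is still crossed at some time, which is more than
    -- the 0 crossings required of it.
    have hb : ∀ v ∈ F, ¬ (v ∈ S 0 ∧ parent G r v ∈ S 0) := by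
      intro v hv h
      rw [hF, Finset.mem_filter, if_pos h, hE, Finset.mem_filter] at hv
      obtain ⟨⟨i, hi, hi'⟩, j, hj, hj'⟩ := hS.exists_inside hG hv.1.2
      have := hS.exists_crossing hi hj hi' hj'
      omega
    refine hS.card_le_of_passed_once hG (r := r) hL (fun v hv => ?_) (fun v hv => ?_) hb
    · exact (Finset.mem_filter.1 (Finset.mem_filter.1 hv).1).2
    · have := (Finset.mem_filter.1 hv).2
      rwa [if_neg (hb v hv)] at this
  have hsum := hS.sum_crossings_le (r := r) hG (Finset.univ.erase r)
  have hstart := hS.card_le_sum_start (r := r) hG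
  have hmain : (∑ v ∈ Finset.univ.erase r, if v ∈ S 0 ∧ parent G r v ∈ S 0 then 0 else 1) +
      (E \ F).card ≤ ∑ v ∈ Finset.univ.erase r, (crossings G r T S v).card := by
    have h1 : (E \ F).card = ∑ v ∈ Finset.univ.erase r, if v ∈ E \ F then 1 else 0 := by
      rw [← Finset.card_filter]
      congr 1
      ext v
      simp only [Finset.mem_filter, Finset.mem_erase, Finset.mem_univ, and_true]
      exact ⟨fun h => ⟨((Finset.mem_filter.1 (Finset.mem_sdiff.1 h).1).2).1, h⟩, fun h => h.2⟩
    rw [h1, ← Finset.sum_add_distrib]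
    refine Finset.sum_le_sum fun v hv => ?_
    by_cases hvE : v ∈ E \ F
    · rw [if_pos hvE]
      obtain ⟨h2, h3⟩ := Finset.mem_sdiff.1 hvE
      have h4 : ¬ (crossings G r T S v).card ≤
        if v ∈ S 0 ∧ parent G r v ∈ S 0 then 0 else 1 := fun h => h3 (Finset.mem_filter.2 ⟨h2, h⟩)
      omega
    · rw [if_neg hvE]
      split_ifs with h2
      · omega
      · exact hS.crossings_pos hG (Finset.mem_erase.1 hv).1 h2
  have hEF := Finset.card_sdiff_add_card_eq_card (Finset.filter_subset (fun v =>
    (crossings G r T S v).card ≤ if v ∈ S 0 ∧ parent G r v ∈ S 0 then 0 else 1) E)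
  rw [← hF] at hEF
  omega

end IsSweep

/-- The occupied sets of a restricted spanning walk form a sweep. -/
theorem IsRestrictedSpanningWalk.isSweep {k : ℕ} {W : List (Fin k → V)}
    (hW : IsRestrictedSpanningWalk G W) [Finite V] :
    IsSweep G k (W.length - 1) fun t => {x | ∃ c, W[t]? = some c ∧ x ∈ Set.range c} := by
  have hpos := List.length_pos_of_ne_nil hW.nonempty
  have hset : ∀ t (ht : t < W.length),
      {x | ∃ c, W[t]? = some c ∧ x ∈ Set.range c} = Set.range W[t] := by
    intro t ht
    ext x
    simp [List.getElem?_eq_getElem ht]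
  constructor
  · intro t ht
    rw [hset t (by omega)]
    exact (hW.config _ (List.getElem_mem _)).2
  · intro t ht
    rw [hset t (by omega), ← Nat.card_coe_set_eq,
      Nat.card_range_of_injective (hW.config _ (List.getElem_mem _)).1, Nat.card_fin]
  · intro t ht
    rw [hset t (by omega), hset (t + 1) (by omega)]
    obtain ⟨hadj, hone⟩ := List.isChain_iff_getElem.1 hW.chain t (by omega)
    obtain ⟨x, hx⟩ := Set.ncard_eq_one.1 hone
    have hx' : x ∈ Set.range W[t + 1] \ Set.range W[t] := by rw [hx]; rfl
    obtain ⟨⟨i, hi⟩, hx2⟩ := hx'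
    refine ⟨x, W[t] i, ?_, ⟨i, rfl⟩, fun y hy => ?_⟩
    · rw [← hi]
      refine (hadj i).resolve_left fun h => hx2 ⟨i, by rw [h, hi]⟩
    · by_cases hyt : y ∈ Set.range W[t]
      · exact Or.inr hyt
      · left
        have : y ∈ Set.range W[t + 1] \ Set.range W[t] := ⟨hy, hyt⟩
        rw [hx] at this
        exact this
  · intro v
    obtain ⟨c, hc, hv⟩ := hW.spanning v
    obtain ⟨t, ht, rfl⟩ := List.getElem_of_mem hc
    exact ⟨t, by omega, W[t], List.getElem?_eq_getElem ht, hv⟩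

end LowerBound

/-! ### Detours are deep vertices off the longest path -/

section Detour

variable {V : Type} {G : SimpleGraph V} {a b : V}

theorem IsLongestPath.length_eq (hG : G.IsTree) {P : G.Walk a b} (hP : IsLongestPath G P) :
    P.length = G.dist a b := by
  obtain ⟨p, hp, hd⟩ := hG.connected.exists_path_of_dist a b
  rw [← hd, (hG.existsUnique_path a b).unique hp hP.1]

theorem IsLongestPath.dist_le (hG : G.IsTree) {P : G.Walk a b} (hP : IsLongestPath G P) (x y : V) :
    G.dist x y ≤ G.dist a b := by
  obtain ⟨p, hp, hd⟩ := hG.connected.exists_path_of_dist x y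
  rw [← hd, ← hP.length_eq hG]
  exact hP.2 x y p hp

theorem mem_edges_of_walk_into {r x y v : V} (hG : G.IsTree) (p : G.Walk x y)
    (hx : ¬ IsAnc G r v x) (hy : IsAnc G r v y) : s(v, parent G r v) ∈ p.edges := by
  induction p with
  | nil => exact absurd hy hx
  | @cons x x' y h p ih =>
    rw [SimpleGraph.Walk.edges_cons]
    by_cases hx' : IsAnc G r v x'
    · obtain ⟨rfl, -, rfl⟩ := eq_of_adj_leaving hG h.symm hx' hx
      rw [Sym2.eq_swap]
      exact List.mem_cons_self
    · exact List.mem_cons_of_mem _ (ih hx' hy)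

theorem IsLongestPath.mem_support (hG : G.IsTree) {P : G.Walk a b} (hP : IsLongestPath G P)
    {w : V} :
    w ∈ P.support ↔ IsAnc G a w b := by
  constructor
  · intro h
    obtain ⟨q, q', rfl⟩ := SimpleGraph.Walk.mem_support_iff_exists_append.1 h
    have h1 := hP.length_eq hG
    rw [SimpleGraph.Walk.length_append] at h1
    have h2 := SimpleGraph.dist_le q
    have h3 := SimpleGraph.dist_le q'
    obtain ⟨c, hcw, hcb, hd⟩ := exists_common_anc (r := a) hG w b
    rw [← hcw.eq_of_dist_le hG (by omega)]
    exact hcb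
  · intro h
    by_cases hw : w = a
    · subst hw; simp
    · exact P.fst_mem_support_of_mem_edges (mem_edges_of_walk_into hG P
        (fun h' => hw (h'.antisymm hG (IsAnc.root hG w))) h)

theorem IsLongestPath.mem_edges (hG : G.IsTree) {P : G.Walk a b} (hP : IsLongestPath G P) {v : V}
    (hv : v ≠ a) : s(v, parent G a v) ∈ P.edges ↔ IsAnc G a v b :=
  ⟨fun h => (hP.mem_support hG).1 (P.fst_mem_support_of_mem_edges h), fun h =>
    mem_edges_of_walk_into hG P (fun h' => hv (h'.antisymm hG (IsAnc.root hG v))) h⟩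

/-- The nearest vertex of the path is outside the subtree of `v`, hence reached through the parent.
This decides which end of the edge plays the role of `v` in `detour`. -/
theorem IsLongestPath.distToPath_parent_lt (hG : G.IsTree) {P : G.Walk a b}
    (hP : IsLongestPath G P) {v : V} (hv : ¬ IsAnc G a v b) :
    distToPath G P (parent G a v) < distToPath G P v := by
  have hr : v ≠ a := by rintro rfl; exact hv (IsAnc.root hG b)
  obtain ⟨w, hw, hd⟩ := Nat.sInf_mem (s := {m | ∃ w ∈ P.support, G.dist v w = m})
    ⟨_, a, P.start_mem_support, rfl⟩
  have h1 := dist_into_subtree (r := a) (y := w) hG hr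
    (fun h => hv (h.trans ((hP.mem_support hG).1 hw))) (IsAnc.refl v)
  have h2 : distToPath G P (parent G a v) ≤ G.dist (parent G a v) w := Nat.sInf_le ⟨w, hw, rfl⟩
  have h3 : distToPath G P v = G.dist v w := hd.symm
  rw [SimpleGraph.dist_comm (u := w), SimpleGraph.dist_comm (u := w)] at h1
  omega

/-- The descending path from `v` to `z` avoids the deleted edge, and deleting an edge cannot shorten
distances between vertices that stay connected. -/
theorem branch_dist (hG : G.IsTree) {r v z : V} (hv : v ≠ r) (hz : IsAnc G r v z) :
    (G.deleteEdges {s(v, parent G r v)}).dist v z + G.dist r v = G.dist r z := by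
  have key : ∃ p : (G.deleteEdges {s(v, parent G r v)}).Walk v z,
      p.length + G.dist r v = G.dist r z := by
    induction hn : G.dist r z using Nat.strong_induction_on generalizing z with
    | _ n ih =>
      by_cases hvz : v = z
      · subst hvz; exact ⟨SimpleGraph.Walk.nil, by simpa using hn⟩
      · have hzr := hz.ne_root hvz
        have hd := dist_parent hG hzr
        obtain ⟨p, hp⟩ := ih _ (by omega) (hz.parent_right hvz) rfl
        have hadj : (G.deleteEdges {s(v, parent G r v)}).Adj (parent G r z) z := by
          rw [SimpleGraph.deleteEdges_adj]
          refine ⟨(adj_parent hG hzr).symm, fun h => ?_⟩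
          rcases Sym2.eq_iff.1 h with ⟨-, h2⟩ | ⟨-, h2⟩
          · exact not_isAnc_parent hG hv (h2 ▸ hz)
          · exact hvz h2.symm
        exact ⟨p.concat hadj, by rw [SimpleGraph.Walk.length_concat]; omega⟩
  obtain ⟨p, hp⟩ := key
  have h1 := SimpleGraph.dist_le p
  have h2 := p.reachable.dist_anti (G.deleteEdges_le {s(v, parent G r v)})
  have h3 := dist_of_isAnc hG hz
  omega

theorem isAnc_of_branch_reachable (hG : G.IsTree) {r v z : V}
    (h : (G.deleteEdges {s(v, parent G r v)}).Reachable v z) : IsAnc G r v z := by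
  obtain ⟨p⟩ := h
  suffices H : ∀ x y (p : (G.deleteEdges {s(v, parent G r v)}).Walk x y), IsAnc G r v x →
      IsAnc G r v y from H _ _ p (IsAnc.refl v)
  intro x y p hx
  induction p with
  | nil => exact hx
  | @cons x x' y h p ih =>
    refine ih ?_
    rw [SimpleGraph.deleteEdges_adj] at h
    by_contra hx'
    obtain ⟨rfl, -, rfl⟩ := eq_of_adj_leaving hG h.1 hx hx'
    exact h.2 rfl

theorem lt_branchHeight_iff [Fintype V] (hG : G.IsTree) {r v : V} {k : ℕ} (hv : v ≠ r) :
    k < branchHeight G s(v, parent G r v) v + 2 ↔ IsDeep G r k v := by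
  constructor
  · intro h
    obtain ⟨z, -, hz⟩ := Finset.exists_mem_eq_sup Finset.univ ⟨v, Finset.mem_univ v⟩
      fun z => (G.deleteEdges {s(v, parent G r v)}).dist v z
    unfold branchHeight at h
    rw [hz] at h
    by_cases hr : (G.deleteEdges {s(v, parent G r v)}).Reachable v z
    · have hvz := isAnc_of_branch_reachable hG hr
      have := branch_dist hG hv hvz
      exact ⟨z, hvz, by omega⟩
    -- The maximum is attained by the default value 0 between components. Then `k ≤ 1`, and `v`
    -- itself is a witness.
    · rw [SimpleGraph.dist_eq_zero_of_not_reachable hr] at h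
      exact ⟨v, IsAnc.refl v, by omega⟩
  · rintro ⟨z, hvz, hz⟩
    have h1 := branch_dist hG hv hvz
    have h2 : (G.deleteEdges {s(v, parent G r v)}).dist v z ≤
      branchHeight G s(v, parent G r v) v := Finset.le_sup
        (f := fun z => (G.deleteEdges {s(v, parent G r v)}).dist v z) (Finset.mem_univ z)
    omega

open Classical in
theorem detour_eq [Fintype V] (hG : G.IsTree) {P : G.Walk a b} (hP : IsLongestPath G P) (k : ℕ)
    {v : V}
    (hv : v ≠ a) : detour G k P s(v, parent G a v) =
      if ¬ IsAnc G a v b ∧ IsDeep G a k v then 1 else 0 := by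
  unfold detour
  by_cases hvb : IsAnc G a v b
  · rw [if_pos ((hP.mem_edges hG hv).2 hvb), if_neg (by simp [hvb])]
  · rw [if_neg (fun h => hvb ((hP.mem_edges hG hv).1 h))]
    have hlt := hP.distToPath_parent_lt hG hvb
    congr 1
    refine propext ⟨?_, ?_⟩
    · rintro ⟨u, w, he, hd, hk⟩
      rcases Sym2.eq_iff.1 he with ⟨rfl, rfl⟩ | ⟨rfl, rfl⟩
      · omega
      · exact ⟨hvb, (lt_branchHeight_iff hG hv).1 hk⟩
    · rintro ⟨-, h⟩
      exact ⟨_, v, Sym2.eq_swap, hlt, (lt_branchHeight_iff hG hv).2 h⟩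

theorem edgeFinset_eq_image [Fintype V] [DecidableEq V] [DecidableRel G.Adj] (hG : G.IsTree)
    (r : V) :
    G.edgeFinset = (Finset.univ.erase r).image fun v => s(v, parent G r v) := by
  ext e
  induction e with
  | _ x y =>
    rw [SimpleGraph.mem_edgeFinset, SimpleGraph.mem_edgeSet, Finset.mem_image]
    constructor
    · intro h
      rcases adj_cases (r := r) hG h with ⟨h1, rfl⟩ | ⟨h1, rfl⟩
      · exact ⟨x, by simp [h1], rfl⟩
      · exact ⟨y, by simp [h1], Sym2.eq_swap⟩
    · rintro ⟨v, hv, he⟩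
      have h1 := adj_parent hG (Finset.ne_of_mem_erase hv)
      rcases Sym2.eq_iff.1 he with ⟨rfl, rfl⟩ | ⟨rfl, rfl⟩
      · exact h1
      · exact h1.symm

theorem edge_above_injOn (hG : G.IsTree) {r v w : V} (hv : v ≠ r) (hw : w ≠ r)
    (h : s(v, parent G r v) = s(w, parent G r w)) : v = w := by
  rcases Sym2.eq_iff.1 h with ⟨h1, -⟩ | ⟨h1, h2⟩
  · exact h1
  · have a := dist_parent hG hv
    have b := dist_parent hG hw
    rw [h2] at a
    rw [← h1] at b
    omega

open Classical in
/-- The detours are the deep vertices off the path. -/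
theorem sum_detour [Fintype V] [DecidableEq V] [DecidableRel G.Adj] (hG : G.IsTree) {P : G.Walk a b}
    (hP : IsLongestPath G P) (k : ℕ) : ∑ e ∈ G.edgeFinset, detour G k P e =
      (Finset.univ.filter fun v => ¬ IsAnc G a v b ∧ IsDeep G a k v).card := by
  rw [edgeFinset_eq_image hG a, Finset.sum_image fun v hv w hw => edge_above_injOn hG
    (Finset.ne_of_mem_erase hv) (Finset.ne_of_mem_erase hw),
    Finset.sum_congr rfl fun v hv => detour_eq hG hP k (Finset.ne_of_mem_erase hv),
    ← Finset.card_filter]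
  congr 1
  ext v
  simp only [Finset.mem_filter, Finset.mem_erase, Finset.mem_univ, and_true, true_and]
  refine ⟨fun h => h.2, fun h => ⟨?_, h⟩⟩
  rintro rfl
  exact h.1 (IsAnc.root hG b)

end Detour

/-! ## Results and costs of the basic computations -/

namespace Timed

variable {α β : Type}

theorem val_bind (x : Timed α) (f : α → Timed β) : (x >>= f).val = (f x.val).val := rfl

theorem cost_bind (x : Timed α) (f : α → Timed β) : (x >>= f).cost = x.cost + (f x.val).cost := rfl

theorem val_pure (a : α) : (pure a : Timed α).val = a := rfl

theorem cost_pure (a : α) : (pure a : Timed α).cost = 0 := rfl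

theorem cost_tick : tick.cost = 1 := rfl

theorem cost_charge (m : ℕ) : (charge m).cost = m := rfl

end Timed

open Timed

section Basic

variable {α : Type}

theorem findT_val (p : α → Bool) (l : List α) : (findT p l).val = l.find? p := by
  induction l with
  | nil => rfl
  | cons x xs ih =>
    rw [findT, val_bind, List.find?_cons]
    cases h : p x
    · simpa using ih
    · rfl

theorem findT_cost_le (p : α → Bool) (l : List α) : (findT p l).cost ≤ l.length + 1 := by
  induction l with
  | nil => exact le_rfl
  | cons x xs ih =>
    rw [findT, cost_bind, cost_tick, List.length_cons]
    split_ifs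
    · rw [cost_pure]; omega
    · omega

theorem countT_val (p : α → Bool) (l : List α) : (countT p l).val = (l.filter p).length := by
  induction l with
  | nil => rfl
  | cons x xs ih =>
    rw [countT, val_bind, val_bind, val_pure, ih, List.filter_cons]
    split_ifs <;> rfl

theorem countT_cost (p : α → Bool) (l : List α) : (countT p l).cost = l.length + 1 := by
  induction l with
  | nil => rfl
  | cons x xs ih =>
    rw [countT, cost_bind, cost_bind, cost_pure, ih, cost_tick, List.length_cons]
    omega

theorem filterT_val (p : α → Timed Bool) (l : List α) :
    (filterT p l).val = l.filter fun x => (p x).val := by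
  induction l with
  | nil => rfl
  | cons x xs ih =>
    rw [filterT, val_bind, val_bind, val_bind, val_pure, ih, List.filter_cons]

theorem filterT_cost_le (p : α → Timed Bool) (l : List α) {c : ℕ} (hc : ∀ x, (p x).cost ≤ c) :
    (filterT p l).cost ≤ l.length * (c + 1) + 1 := by
  induction l with
  | nil => simp [filterT, cost_bind, cost_pure, cost_tick]
  | cons x xs ih =>
    rw [filterT, cost_bind, cost_bind, cost_bind, cost_pure, cost_tick, List.length_cons,
      Nat.succ_mul]
    have := hc x
    omega

theorem argMinT_cost (f : α → ℕ) (y : α) (l : List α) : (argMinT f y l).cost = l.length + 1 := by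
  induction l generalizing y with
  | nil => rfl
  | cons x xs ih =>
    rw [argMinT, cost_bind, cost_tick, List.length_cons]
    split_ifs <;> rw [ih] <;> omega

theorem argMaxT_cost (f : α → ℕ) (y : α) (l : List α) : (argMaxT f y l).cost = l.length + 1 := by
  induction l generalizing y with
  | nil => rfl
  | cons x xs ih =>
    rw [argMaxT, cost_bind, cost_tick, List.length_cons]
    split_ifs <;> rw [ih] <;> omega

theorem argMinT_spec (f : α → ℕ) (y : α) (l : List α) :
    (argMinT f y l).val ∈ y :: l ∧ ∀ x ∈ y :: l, f (argMinT f y l).val ≤ f x := by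
  induction l generalizing y with
  | nil => simp [argMinT, val_bind, val_pure]
  | cons x xs ih =>
    rw [argMinT, val_bind]
    split_ifs with h
    · obtain ⟨h1, h2⟩ := ih x
      refine ⟨List.mem_cons_of_mem _ h1, fun z hz => ?_⟩
      rcases List.mem_cons.1 hz with rfl | hz
      · exact (h2 x List.mem_cons_self).trans h.le
      · exact h2 z hz
    · obtain ⟨h1, h2⟩ := ih y
      refine ⟨?_, fun z hz => ?_⟩
      · rcases List.mem_cons.1 h1 with h1 | h1
        · rw [h1]; exact List.mem_cons_self
        · exact List.mem_cons_of_mem _ (List.mem_cons_of_mem _ h1)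
      · rcases List.mem_cons.1 hz with rfl | hz
        · exact h2 _ List.mem_cons_self
        · rcases List.mem_cons.1 hz with rfl | hz
          · exact (h2 y List.mem_cons_self).trans (not_lt.1 h)
          · exact h2 z (List.mem_cons_of_mem _ hz)

theorem argMaxT_spec (f : α → ℕ) (y : α) (l : List α) :
    (argMaxT f y l).val ∈ y :: l ∧ ∀ x ∈ y :: l, f x ≤ f (argMaxT f y l).val := by
  induction l generalizing y with
  | nil => simp [argMaxT, val_bind, val_pure]
  | cons x xs ih =>
    rw [argMaxT, val_bind]
    split_ifs with h
    · obtain ⟨h1, h2⟩ := ih x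
      refine ⟨List.mem_cons_of_mem _ h1, fun z hz => ?_⟩
      rcases List.mem_cons.1 hz with rfl | hz
      · exact h.le.trans (h2 x List.mem_cons_self)
      · exact h2 z hz
    · obtain ⟨h1, h2⟩ := ih y
      refine ⟨?_, fun z hz => ?_⟩
      · rcases List.mem_cons.1 h1 with h1 | h1
        · rw [h1]; exact List.mem_cons_self
        · exact List.mem_cons_of_mem _ (List.mem_cons_of_mem _ h1)
      · rcases List.mem_cons.1 hz with rfl | hz
        · exact h2 _ List.mem_cons_self
        · rcases List.mem_cons.1 hz with rfl | hz
          · exact (not_lt.1 h).trans (h2 y List.mem_cons_self)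
          · exact h2 z (List.mem_cons_of_mem _ hz)

theorem storeT_cost {V β : Type} [DecidableEq V] (key : α → V) (g : α → β) (l : List α)
    (a : V → β) : (storeT key g l a).cost = l.length + 1 := by
  induction l generalizing a with
  | nil => rfl
  | cons x xs ih =>
    rw [storeT, cost_bind, cost_tick, List.length_cons, ih]
    omega

/-- Storing the values of a function `f` of the key. -/
theorem storeT_val {V β : Type} [DecidableEq V] (key : α → V) (g : α → β) (f : V → β) (l : List α)
    (hf : ∀ x ∈ l, g x = f (key x)) (a : V → β) (v : V) :
    (storeT key g l a).val v = if v ∈ l.map key then f v else a v := by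
  induction l generalizing a with
  | nil => rfl
  | cons x xs ih =>
    rw [storeT, val_bind, ih fun y hy => hf y (List.mem_cons_of_mem _ hy)]
    by_cases h1 : v ∈ xs.map key
    · rw [if_pos h1, if_pos (by rw [List.map_cons]; exact List.mem_cons_of_mem _ h1)]
    · rw [if_neg h1]
      by_cases h2 : v = key x
      · subst h2
        rw [Function.update_self, if_pos (by simp), hf x List.mem_cons_self]
      · rw [Function.update_of_ne h2, if_neg (by simp [h2] at h1 ⊢; exact h1)]

end Basic

/-! ## Ascending paths -/

section Ascend

variable {V : Type}

theorem mem_iterate_parent {G : SimpleGraph V} (hG : G.IsTree) {q v x : V} :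
    x ∈ List.iterate (parent G q) v (G.dist q v + 1) ↔ IsAnc G q x v := by
  rw [List.mem_iterate]
  constructor
  · rintro ⟨m, -, rfl⟩
    exact ⟨m, rfl⟩
  · intro h
    induction hn : G.dist q v using Nat.strong_induction_on generalizing v with
    | _ n ih =>
      by_cases hxv : x = v
      · exact ⟨0, by omega, by simp [hxv]⟩
      · have hd := dist_parent hG (h.ne_root hxv)
        obtain ⟨m, hm, hx⟩ := ih _ (by omega) (h.parent_right hxv) rfl
        exact ⟨m + 1, by omega, by rw [hx]; rfl⟩

theorem dist_iterate_parent {G : SimpleGraph V} (hG : G.IsTree) {q v : V} {i : ℕ}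
    (hi : i ≤ G.dist q v) : G.dist q ((parent G q)^[i] v) + i = G.dist q v := by
  induction i with
  | zero => simp
  | succ i ih =>
    have h1 := ih (by omega)
    rw [Function.iterate_succ_apply']
    have h2 : (parent G q)^[i] v ≠ q := by
      intro h
      rw [h] at h1
      simp at h1
      omega
    have := dist_parent hG h2
    omega

theorem iterate_parent_dist {G : SimpleGraph V} (hG : G.IsTree) (q v : V) :
    (parent G q)^[G.dist q v] v = q := by
  have h := dist_iterate_parent hG (le_refl (G.dist q v))
  exact (hG.connected.dist_eq_zero_iff.1 (by omega)).symm

theorem nodup_iterate_parent {G : SimpleGraph V} (hG : G.IsTree) {q v : V} :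
    (List.iterate (parent G q) v (G.dist q v + 1)).Nodup := by
  rw [List.nodup_iff_injective_getElem]
  rintro ⟨i, hi⟩ ⟨j, hj⟩ hij
  simp only [List.getElem_iterate] at hij
  rw [List.length_iterate] at hi hj
  have h1 := dist_iterate_parent hG (q := q) (v := v) (i := i) (by omega)
  have h2 := dist_iterate_parent hG (q := q) (v := v) (i := j) (by omega)
  rw [hij] at h1
  exact Fin.ext (by change i = j; omega)

theorem isChain_iterate_parent {G : SimpleGraph V} (hG : G.IsTree) {q v : V} :
    (List.iterate (parent G q) v (G.dist q v + 1)).IsChain G.Adj := by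
  induction hn : G.dist q v generalizing v with
  | zero => simp
  | succ n ih =>
    have hv : v ≠ q := by rintro rfl; simp at hn
    have hd := dist_parent hG hv
    have h1 := ih (v := parent G q v) (by omega)
    exact List.isChain_cons_cons.2 ⟨adj_parent hG hv, h1⟩

end Ascend

/-! ## Depth-first search of a forest -/

section Search

variable {V : Type} [DecidableEq V]

theorem pushNbrs_val (active : V → Bool) (x : Visit V) (ws : List V) (st : List (Visit V)) :
    (pushNbrs active x ws st).val =
      ((ws.filter fun w => active w && decide (x.pred ≠ some w)).map
        fun w => (⟨w, some x.vertex, x.depth + 1⟩ : Visit V)).reverse ++ st := by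
  induction ws generalizing st with
  | nil => rfl
  | cons w ws ih =>
    rw [pushNbrs, val_bind, List.filter_cons]
    split_ifs with h
    · rw [ih]; simp
    · rw [ih]

theorem pushNbrs_cost (active : V → Bool) (x : Visit V) (ws : List V) (st : List (Visit V)) :
    (pushNbrs active x ws st).cost = ws.length + 1 := by
  induction ws generalizing st with
  | nil => rfl
  | cons w ws ih =>
    rw [pushNbrs, cost_bind, cost_tick, List.length_cons]
    split_ifs <;> rw [ih] <;> omega

theorem search_cost_le (A : AdjLists V) (active : V → Bool) {d : ℕ}
    (hd : ∀ v, (A.nbrs v).length ≤ d) (m : ℕ) (st acc : List (Visit V)) :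
    (search A active m st acc).cost ≤ m * (d + 2) + 1 := by
  induction m generalizing st acc with
  | zero => simp [search, cost_bind, cost_pure, cost_tick]
  | succ m ih =>
    cases st with
    | nil => simp [search, cost_bind, cost_pure, cost_tick]
    | cons x st =>
      rw [search, cost_bind, cost_tick, cost_bind, pushNbrs_cost, Nat.succ_mul]
      have h1 := hd x.vertex
      have h2 := ih (pushNbrs active x (A.nbrs x.vertex) st).val (x :: acc)
      omega

theorem search_length_le (A : AdjLists V) (active : V → Bool) (m : ℕ) (st acc : List (Visit V)) :
    (search A active m st acc).val.length ≤ m + acc.length := by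
  induction m generalizing st acc with
  | zero => simp [search, val_bind, val_pure]
  | succ m ih =>
    cases st with
    | nil => simp only [search, val_bind, val_pure]; omega
    | cons x st =>
      rw [search, val_bind, val_bind]
      refine (ih _ _).trans ?_
      rw [List.length_cons]
      omega

theorem traceBack_cost_le (o : Option V) (l : List (Visit V)) :
    (traceBack o l).cost ≤ l.length + 1 := by
  induction l generalizing o with
  | nil => cases o <;> exact le_rfl
  | cons x xs ih =>
    cases o with
    | none => simp [traceBack, cost_bind, cost_pure, cost_tick]
    | some v =>
      rw [traceBack, cost_bind, cost_tick, List.length_cons]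
      split_ifs
      · rw [cost_bind, cost_pure]
        have := ih x.pred
        omega
      · have := ih (some v)
        omega

theorem traceBack_length_le (o : Option V) (l : List (Visit V)) :
    (traceBack o l).val.length ≤ l.length := by
  induction l generalizing o with
  | nil => cases o <;> exact le_rfl
  | cons x xs ih =>
    cases o with
    | none => simp [traceBack, val_bind, val_pure]
    | some v =>
      rw [traceBack, val_bind, List.length_cons]
      split_ifs
      · rw [val_bind, val_pure, List.length_cons]
        have := ih x.pred
        omega
      · have := ih (some v)
        omega

/-- In the list of visits, every predecessor occurs after its successors. -/
def PredBelow : List (Visit V) → Prop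
  | [] => True
  | e :: l => (∀ u, e.pred = some u → u ∈ l.map Visit.vertex) ∧ PredBelow l

/-- The outcome of a search whose visits are to be labelled by `pr` and `dp`. -/
structure IsSearchResult (G : SimpleGraph V) (active : V → Bool) (pr : V → Option V) (dp : V → ℕ)
    (Dom : Set V) (l : List (Visit V)) : Prop where
  labels : ∀ e ∈ l, e.vertex ∈ Dom ∧ e.pred = pr e.vertex ∧ e.depth = dp e.vertex
  nodup : (l.map Visit.vertex).Nodup
  predBelow : PredBelow l
  closed : ∀ x ∈ l.map Visit.vertex, ∀ w, G.Adj x w → active w = true → pr x ≠ some w →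
    w ∈ l.map Visit.vertex

/-- The hypotheses on `st` and `acc` are the loop invariant. The labels `pr` and `dp` are prescribed
in advance, so that the lemma serves searches from one root as well as the search from all vertices
of a path at once; `hpush` says that pushing agrees with the labels. -/
theorem search_spec [Finite V] {G : SimpleGraph V} {A : AdjLists V} (hA : A.Represents G)
    {active : V → Bool} {pr : V → Option V} {dp : V → ℕ} {Dom : Set V}
    (hpush : ∀ x w, x ∈ Dom → G.Adj x w → active w = true → pr x ≠ some w →
      w ∈ Dom ∧ pr w = some x ∧ dp w = dp x + 1)
    (m : ℕ) (st acc : List (Visit V))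
    (hlab : ∀ e ∈ st ++ acc, e.vertex ∈ Dom ∧ e.pred = pr e.vertex ∧ e.depth = dp e.vertex)
    (hnd : ((st ++ acc).map Visit.vertex).Nodup)
    (hpred : ∀ e ∈ st ++ acc, ∀ u, e.pred = some u → u ∈ acc.map Visit.vertex)
    (hbelow : PredBelow acc)
    (hclosed : ∀ x ∈ acc.map Visit.vertex, ∀ w, G.Adj x w → active w = true → pr x ≠ some w →
      w ∈ (st ++ acc).map Visit.vertex)
    (hm : Dom.ncard ≤ m + acc.length) :
    IsSearchResult G active pr dp Dom (search A active m st acc).val ∧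
      ∀ x ∈ (st ++ acc).map Visit.vertex, x ∈ (search A active m st acc).val.map Visit.vertex := by
  induction m generalizing st acc with
  | zero =>
    -- When the rounds are used up, the distinct vertices in `acc` already fill `Dom`, so nothing is
    -- left on the stack.
    have hst : st = [] := by
      have h1 : ((st ++ acc).map Visit.vertex).length ≤ Dom.ncard := by
        rw [← List.toFinset_card_of_nodup hnd, ← Set.ncard_coe_finset]
        refine Set.ncard_le_ncard (fun v hv => ?_) (Set.toFinite _)
        simp only [List.coe_toFinset, Set.mem_ofPred_eq, List.mem_map] at hv
        obtain ⟨e, he, rfl⟩ := hv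
        exact (hlab e he).1
      rw [List.length_map, List.length_append] at h1
      exact List.length_eq_zero_iff.1 (by omega)
    subst hst
    simp only [search, val_bind, val_pure]
    exact ⟨⟨hlab, hnd, hbelow, hclosed⟩, fun x hx => hx⟩
  | succ m ih =>
    cases st with
    | nil =>
      simp only [search, val_bind, val_pure]
      exact ⟨⟨hlab, hnd, hbelow, hclosed⟩, fun x hx => hx⟩
    | cons x st =>
      rw [search, val_bind, val_bind, pushNbrs_val]
      set new := (A.nbrs x.vertex).filter fun w => active w && decide (x.pred ≠ some w) with hnew
      obtain ⟨hx1, hx2, hx3⟩ := hlab x (by simp)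
      have hmem : ∀ w, w ∈ new ↔ G.Adj x.vertex w ∧ active w = true ∧ pr x.vertex ≠ some w := by
        intro w
        simp [hnew, hA.mem_nbrs, hx2]
      have hxacc : x.vertex ∉ acc.map Visit.vertex := by
        rw [List.cons_append, List.map_cons, List.nodup_cons] at hnd
        intro h
        exact hnd.1 (by rw [List.map_append]; exact List.mem_append_right _ h)
      -- The label of a pushed vertex names `x` as its predecessor. Had it occurred before, `x`
      -- would have been visited already.
      have hfresh : ∀ w ∈ new, w ∉ ((x :: st) ++ acc).map Visit.vertex := by
        intro w hw h
        obtain ⟨e, he, rfl⟩ := List.mem_map.1 h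
        obtain ⟨h1, h2, h3⟩ := (hmem _).1 hw
        have h4 := (hpush _ _ hx1 h1 h2 h3).2.1
        exact hxacc (hpred e he _ (by rw [(hlab e he).2.1, h4]))
      set mk : V → Visit V := fun w => ⟨w, some x.vertex, x.depth + 1⟩ with hmk
      have hverts : ((new.map mk).reverse).map Visit.vertex = new.reverse := by
        rw [List.map_reverse, List.map_map]
        congr 1
        exact List.map_id' new
      have hperm : ∀ y, y ∈ (((new.map mk).reverse ++ st) ++ x :: acc).map Visit.vertex ↔
          y ∈ new ∨ y ∈ ((x :: st) ++ acc).map Visit.vertex := by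
        intro y
        rw [List.map_append, List.map_append, hverts]
        simp only [List.mem_append, List.mem_reverse, List.map_cons, List.mem_cons,
          List.cons_append, List.map_append]
        tauto
      refine And.imp_right (fun h2 y hy => h2 y ((hperm y).2 (Or.inr hy)))
        (ih ((new.map mk).reverse ++ st) (x :: acc) ?_ ?_ ?_ ?_ ?_ ?_)
      · intro e he
        simp only [List.mem_append, List.mem_reverse, List.mem_map, List.mem_cons] at he
        rcases he with (⟨w, hw, rfl⟩ | he) | he | he
        · obtain ⟨h1, h2, h3⟩ := (hmem w).1 hw
          obtain ⟨h4, h5, h6⟩ := hpush _ _ hx1 h1 h2 h3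
          exact ⟨h4, h5.symm, by rw [h6, ← hx3]⟩
        · exact hlab e (by simp [he])
        · exact hlab e (by simp [he])
        · exact hlab e (by simp [he])
      · have hp : List.Perm ((((new.map mk).reverse ++ st) ++ x :: acc).map Visit.vertex)
            (new ++ ((x :: st) ++ acc).map Visit.vertex) := by
          rw [List.append_assoc, List.map_append, hverts]
          refine List.Perm.append (List.reverse_perm new) (List.Perm.map _ ?_)
          exact List.perm_middle
        rw [hp.nodup_iff, List.nodup_append]
        refine ⟨(hA.nbrs_nodup _).filter _, hnd, ?_⟩
        rintro a ha b hb rfl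
        exact hfresh a ha hb
      · intro e he u hu
        simp only [List.mem_append, List.mem_reverse, List.mem_map, List.mem_cons] at he
        rw [List.map_cons, List.mem_cons]
        rcases he with (⟨w, hw, rfl⟩ | he) | he | he
        · exact Or.inl (Option.some.inj hu).symm
        · exact Or.inr (hpred e (by simp [he]) u hu)
        · exact Or.inr (hpred e (by simp [he]) u hu)
        · exact Or.inr (hpred e (by simp [he]) u hu)
      · exact ⟨fun u hu => hpred x (by simp) u hu, hbelow⟩
      · intro y hy w hyw haw hpw
        rw [hperm]
        rw [List.map_cons, List.mem_cons] at hy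
        rcases hy with rfl | hy
        · exact Or.inl ((hmem w).2 ⟨hyw, haw, hpw⟩)
        · exact Or.inr (hclosed y hy w hyw haw hpw)
      · rw [List.length_cons]; omega

theorem traceBack_none (l : List (Visit V)) : (traceBack none l).val = [] := by
  cases l <;> rfl

/-- One pass suffices, since by `PredBelow` the predecessor of an entry is found in the remainder of
the list. -/
theorem traceBack_eq {f : V → V} {pr : V → Option V} {n : V → ℕ}
    (hq : ∀ v, pr v = none → n v = 0) (hpr : ∀ v u, pr v = some u → f v = u ∧ n v = n u + 1)
    {l : List (Visit V)} (hl : ∀ e ∈ l, e.pred = pr e.vertex) (hb : PredBelow l) {v : V}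
    (hv : v ∈ l.map Visit.vertex) : (traceBack (some v) l).val = List.iterate f v (n v + 1) := by
  induction l generalizing v with
  | nil => simp at hv
  | cons e l ih =>
    rw [traceBack, val_bind]
    have hl' : ∀ e ∈ l, e.pred = pr e.vertex := fun e he => hl e (List.mem_cons_of_mem _ he)
    split_ifs with h
    · rw [val_bind, val_pure]
      have h1 := hl e List.mem_cons_self
      rw [h] at h1
      cases h2 : pr v with
      | none =>
        rw [h1, h2, traceBack_none, hq v h2]
        rfl
      | some u =>
        obtain ⟨h3, h4⟩ := hpr v u h2
        rw [h1, h2, ih hl' hb.2 (hb.1 u (by rw [h1, h2])), h4, ← h3]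
        rfl
    · rw [List.map_cons, List.mem_cons] at hv
      exact ih hl' hb.2 (hv.resolve_left fun h' => h h'.symm)

/-- The labels of a search of a tree from the root `q`. -/
noncomputable def treePred (G : SimpleGraph V) (q v : V) : Option V :=
  if v = q then none else some (parent G q v)

/-- A search from `q` inside a set that contains with each vertex its parent. -/
theorem search_from [Finite V] {G : SimpleGraph V} (hG : G.IsTree) {A : AdjLists V}
    (hA : A.Represents G) {active : V → Bool} {q : V} (hq : active q = true)
    (hpar : ∀ v, active v = true → active (parent G q v) = true) {m : ℕ}
    (hm : {v | active v = true}.ncard ≤ m) :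
    IsSearchResult G active (treePred G q) (G.dist q) {v | active v = true}
      (search A active m [⟨q, none, 0⟩] []).val ∧
    ∀ v, active v = true → v ∈ (search A active m [⟨q, none, 0⟩] []).val.map Visit.vertex := by
  obtain ⟨h1, h2⟩ := search_spec hA (active := active) (pr := treePred G q) (dp := G.dist q)
    (Dom := {v | active v = true}) (fun x w hx hxw hw hpw => by
      rcases adj_cases (r := q) hG hxw with ⟨h1, h2⟩ | ⟨h1, h2⟩
      · exact absurd (by rw [treePred, if_neg h1, h2]) hpw
      · refine ⟨hw, by rw [treePred, if_neg h1, h2], ?_⟩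
        rw [← dist_parent hG h1, h2]) m [⟨q, none, 0⟩] [] (by simp [hq, treePred]) (by simp)
    (by simp) trivial (by simp) (by simpa using hm)
  refine ⟨h1, fun v hv => ?_⟩
  induction hn : G.dist q v using Nat.strong_induction_on generalizing v with
  | _ n ih =>
    by_cases hvq : v = q
    · exact h2 v (by simp [hvq])
    · have hd := dist_parent hG hvq
      have h3 := ih _ (by omega) (parent G q v) (hpar v hv) rfl
      refine h1.closed _ h3 v (adj_parent hG hvq).symm hv fun h => ?_
      rw [treePred] at h
      split_ifs at h with h4
      have h5 := Option.some.inj h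
      have h6 := dist_parent hG h4
      rw [h5] at h6
      omega

theorem traceBack_from {G : SimpleGraph V} (hG : G.IsTree) {active : V → Bool} {q : V}
    {Dom : Set V} {l : List (Visit V)}
    (hl : IsSearchResult G active (treePred G q) (G.dist q) Dom l) {v : V}
    (hv : v ∈ l.map Visit.vertex) :
    (traceBack (some v) l).val = List.iterate (parent G q) v (G.dist q v + 1) := by
  refine traceBack_eq (pr := treePred G q) (fun v h => ?_) (fun v u h => ?_)
    (fun e he => (hl.labels e he).2.1) hl.predBelow hv
  · rw [treePred] at h
    split_ifs at h with h1
    rw [h1]; simp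
  · rw [treePred] at h
    split_ifs at h with h1
    have h2 := Option.some.inj h
    exact ⟨h2, by rw [← h2, dist_parent hG h1]⟩

end Search

/-! ### Correctness and cost of the preparation -/

section Prepare

variable {V : Type}

/-- The data `S` describe a longest path of the tree `G`, and the distances to it. -/
structure IsPrep (G : SimpleGraph V) (S : Prep V) : Prop where
  onPath : ∀ v, S.onPath v = true ↔ IsAnc G S.start v S.goal
  dist_on : ∀ v, IsAnc G S.start v S.goal → S.distP v = 0
  dist_off : ∀ v, ¬ IsAnc G S.start v S.goal → S.distP v = S.distP (parent G S.start v) + 1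
  diam : ∀ x y, G.dist x y ≤ G.dist S.start S.goal

/-- The number of steps from `v` towards the root `r` until the path to `g` is met. -/
noncomputable def pathDist (G : SimpleGraph V) (r g v : V) : ℕ :=
  sInf {m | IsAnc G r ((parent G r)^[m] v) g}

theorem pathDist_on {G : SimpleGraph V} {r g v : V} (h : IsAnc G r v g) : pathDist G r g v = 0 :=
  Nat.sInf_eq_zero.2 (Or.inl h)

theorem pathDist_off {G : SimpleGraph V} (hG : G.IsTree) {r g v : V} (h : ¬ IsAnc G r v g) :
    pathDist G r g v = pathDist G r g (parent G r v) + 1 := by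
  have hne : ∀ v, {m | IsAnc G r ((parent G r)^[m] v) g}.Nonempty := by
    intro v
    obtain ⟨m, hm⟩ := IsAnc.root (r := r) hG v
    exact ⟨m, by rw [Set.mem_ofPred_eq, hm]; exact IsAnc.root hG g⟩
  apply le_antisymm
  · exact Nat.sInf_le (Nat.sInf_mem (hne (parent G r v)))
  · have h1 := Nat.sInf_mem (hne v)
    change IsAnc G r ((parent G r)^[pathDist G r g v] v) g at h1
    cases hm : pathDist G r g v with
    | zero => rw [hm] at h1; exact absurd h1 h
    | succ m =>
      rw [hm] at h1
      exact Nat.succ_le_succ (Nat.sInf_le h1)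

/-- Every longest path can serve as the selected path. -/
theorem exists_isPrep {G : SimpleGraph V} (hG : G.IsTree) {a b : V} {P : G.Walk a b}
    (hP : IsLongestPath G P) : ∃ S : Prep V, IsPrep G S ∧ S.start = a ∧ S.goal = b := by
  classical
  exact ⟨⟨a, b, fun v => decide (IsAnc G a v b), pathDist G a b⟩,
    ⟨fun v => decide_eq_true_iff, fun v => pathDist_on, fun v => pathDist_off hG,
      hP.dist_le hG⟩, rfl, rfl⟩

theorem isAnc_iff_dist {G : SimpleGraph V} (hG : G.IsTree) {r a b : V} :
    IsAnc G r a b ↔ G.dist r a + G.dist a b = G.dist r b := by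
  constructor
  · intro h
    have := dist_of_isAnc hG h
    omega
  · intro h
    obtain ⟨c, hca, hcb, hd⟩ := exists_common_anc (r := r) hG a b
    rw [← hca.eq_of_dist_le hG (by omega)]
    exact hcb

/-- Being above an end means lying on the geodesic, which is symmetric. It is needed because
`prepare` searches from `a` but declares `b` the start of the path. -/
theorem isAnc_comm {G : SimpleGraph V} (hG : G.IsTree) {a b w : V} :
    IsAnc G a w b ↔ IsAnc G b w a := by
  rw [isAnc_iff_dist hG, isAnc_iff_dist hG, SimpleGraph.dist_comm (u := a) (v := w),
    SimpleGraph.dist_comm (u := w) (v := b), SimpleGraph.dist_comm (u := a) (v := b), add_comm]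

/-- A vertex farthest from a farthest vertex spans a diameter. -/
theorem dist_le_of_farthest {G : SimpleGraph V} (hG : G.IsTree) {q a b : V}
    (ha : ∀ v, G.dist q v ≤ G.dist q a) (hb : ∀ v, G.dist a v ≤ G.dist a b) (x y : V) :
    G.dist x y ≤ G.dist a b := by
  have h1 := four_point hG q a x y
  have h2 := ha x
  have h3 := ha y
  have h4 := hb x
  have h5 := hb y
  rcases le_max_iff.1 h1 with h | h <;> omega

theorem AdjLists.Represents.length_verts [Fintype V] {G : SimpleGraph V} {A : AdjLists V}
    (hA : A.Represents G) : A.verts.length = Fintype.card V := by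
  classical
  rw [← List.toFinset_card_of_nodup hA.verts_nodup, ← Finset.card_univ]
  congr 1
  ext v
  simp [hA.mem_verts v]

/-- The farthest vertex found by a search of the whole tree. -/
theorem argMaxT_search [Fintype V] [DecidableEq V] {G : SimpleGraph V} (hG : G.IsTree)
    {A : AdjLists V}
    (hA : A.Represents G) (q : V) :
    IsSearchResult G (fun _ => true) (treePred G q) (G.dist q) {v | (fun _ => true) v = true}
      (search A (fun _ => true) A.verts.length [⟨q, none, 0⟩] []).val ∧
    (∀ v, v ∈ (search A (fun _ => true) A.verts.length [⟨q, none, 0⟩] []).val.map Visit.vertex) ∧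
    ∀ v, G.dist q v ≤ G.dist q (argMaxT Visit.depth ⟨q, none, 0⟩
      (search A (fun _ => true) A.verts.length [⟨q, none, 0⟩] []).val).val.vertex := by
  have hcard : {v : V | (fun _ => true) v = true}.ncard ≤ A.verts.length := by
    rw [hA.length_verts, ← Nat.card_eq_fintype_card]
    exact Set.ncard_le_card _
  obtain ⟨h1, h2⟩ := search_from hG hA (active := fun _ => true) (q := q) rfl (fun _ _ => rfl) hcard
  refine ⟨h1, fun v => h2 v rfl, fun v => ?_⟩
  obtain ⟨h3, h4⟩ := argMaxT_spec Visit.depth ⟨q, none, 0⟩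
    (search A (fun _ => true) A.verts.length [⟨q, none, 0⟩] []).val
  obtain ⟨e, he, hev⟩ := List.mem_map.1 (h2 v rfl)
  have h5 := h4 e (List.mem_cons_of_mem _ he)
  rw [(h1.labels e he).2.2, hev] at h5
  refine h5.trans (le_of_eq ?_)
  rcases List.mem_cons.1 h3 with h6 | h6
  · rw [h6]; simp
  · exact (h1.labels _ h6).2.2

theorem isPrep_prepare [Fintype V] [DecidableEq V] {G : SimpleGraph V} (hG : G.IsTree)
    {A : AdjLists V} (hA : A.Represents G)
    (root : V) : IsPrep G (prepare A root).val := by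
  obtain ⟨-, -, ha⟩ := argMaxT_search hG hA root
  set l₁ := (search A (fun _ => true) A.verts.length [⟨root, none, 0⟩] []).val with hl₁
  set a := (argMaxT Visit.depth ⟨root, none, 0⟩ l₁).val.vertex with haa
  obtain ⟨hl₂, hmem, hb⟩ := argMaxT_search hG hA a
  set l₂ := (search A (fun _ => true) A.verts.length [⟨a, none, 0⟩] []).val with hll₂
  set b := (argMaxT Visit.depth ⟨a, none, 0⟩ l₂).val.vertex with hbb
  set p := (traceBack (some b) l₂).val with hp
  set onPath := (storeT id (fun _ => true) p fun _ => false).val with honPath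
  set l₃ := (search A (fun v => !onPath v) A.verts.length (p.map fun v => ⟨v, none, 0⟩) []).val
    with hl₃
  have hval : (prepare A root).val =
    ⟨b, a, onPath, (storeT Visit.vertex Visit.depth l₃ fun _ => 0).val⟩ := rfl
  have hpp : p = List.iterate (parent G a) b (G.dist a b + 1) := traceBack_from hG hl₂ (hmem b)
  have hpm : ∀ v, v ∈ p ↔ IsAnc G b v a := by
    intro v
    rw [hpp, mem_iterate_parent hG, isAnc_comm hG]
  have hon : ∀ v, onPath v = true ↔ IsAnc G b v a := by
    intro v
    rw [honPath, storeT_val id _ (fun _ => true) p (fun _ _ => rfl), List.map_id, ← hpm]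
    split_ifs with h <;> simp [h]
  have hpn : p.Nodup := hpp ▸ nodup_iterate_parent hG
  -- The third search starts from all vertices of the path at once: these have no predecessor, and
  -- the predecessor of any other vertex is its parent in the tree rooted at `b`.
  obtain ⟨h3, h4⟩ := search_spec hA (active := fun v => !onPath v)
    (pr := fun v => if onPath v = true then none else some (parent G b v))
    (dp := pathDist G b a) (Dom := Set.univ) (fun x w _ hxw hw hpw => by
      simp only [Bool.not_eq_true'] at hw
      have hwa : ¬ IsAnc G b w a := by rw [← hon, hw]; simp
      rcases adj_cases (r := b) hG hxw with ⟨h1, h2⟩ | ⟨h1, h2⟩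
      · have hxa : ¬ onPath x = true := by
          rw [hon]
          intro h
          exact hwa ((h2 ▸ IsAnc.parent_left x : IsAnc G b w x).trans h)
        exact absurd (by rw [if_neg hxa, h2]) hpw
      · refine ⟨trivial, ?_, ?_⟩
        · rw [hw, if_neg (by simp), h2]
        · rw [pathDist_off hG hwa, h2]) A.verts.length (p.map fun v => ⟨v, none, 0⟩) [] (by
      intro e he
      rw [List.append_nil, List.mem_map] at he
      obtain ⟨v, hv, rfl⟩ := he
      refine ⟨trivial, ?_, (pathDist_on ((hpm v).1 hv)).symm⟩
      dsimp only
      rw [if_pos ((hon v).2 ((hpm v).1 hv))]) (by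
      rw [List.append_nil, List.map_map]
      exact (List.map_id' p).symm ▸ hpn) (by
      intro e he u hu
      rw [List.append_nil, List.mem_map] at he
      obtain ⟨v, hv, rfl⟩ := he
      simp at hu) trivial (by simp) (by
      rw [hA.length_verts, ← Nat.card_eq_fintype_card]
      exact Set.ncard_le_card _)
  rw [← hl₃] at h3 h4
  have hall : ∀ v, v ∈ l₃.map Visit.vertex := by
    intro v
    induction hn : G.dist b v using Nat.strong_induction_on generalizing v with
    | _ n ih =>
      by_cases hv : IsAnc G b v a
      · refine h4 v ?_
        rw [List.append_nil, List.map_map]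
        exact (List.map_id' p).symm ▸ (hpm v).2 hv
      · have hvb : v ≠ b := by rintro h; rw [h] at hv; exact hv (IsAnc.root hG a)
        have hd := dist_parent hG hvb
        have hoff : onPath v = false := by
          rw [← Bool.not_eq_true, hon]; exact hv
        refine h3.closed _ (ih _ (by omega) (parent G b v) rfl) v (adj_parent hG hvb).symm
          (by simp [hoff]) fun h => ?_
        split_ifs at h with h5
        have h6 := Option.some.inj h
        have h7 : parent G b v ≠ b := by
          intro h8
          rw [h8, parent_root] at h6
          exact hvb h6.symm
        have h9 := dist_parent hG h7
        rw [h6] at h9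
        omega
  have hdistP : (storeT Visit.vertex Visit.depth l₃ fun _ => 0).val = pathDist G b a := by
    funext v
    rw [storeT_val Visit.vertex Visit.depth (pathDist G b a) l₃ fun e he => (h3.labels e he).2.2,
      if_pos (hall v)]
  rw [hval, hdistP]
  refine ⟨hon, fun v => pathDist_on, fun v => pathDist_off hG, fun x y => ?_⟩
  rw [SimpleGraph.dist_comm (u := b)]
  exact dist_le_of_farthest hG ha hb x y

theorem prepare_cost_le [DecidableEq V] {A : AdjLists V} {d : ℕ} (hd : ∀ v, (A.nbrs v).length ≤ d)
    (root : V) :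
    (prepare A root).cost ≤ 3 * (A.verts.length * (d + 2) + 1) + 8 * (A.verts.length + 1) := by
  set n := A.verts.length with hn
  set r₀ : Visit V := ⟨root, none, 0⟩
  set s₁ := search A (fun _ => true) n [r₀] [] with hs₁
  set a := argMaxT Visit.depth r₀ s₁.val with ha
  set r₁ : Visit V := ⟨a.val.vertex, none, 0⟩
  set s₂ := search A (fun _ => true) n [r₁] [] with hs₂
  set b := argMaxT Visit.depth r₁ s₂.val with hb
  set p := traceBack (some b.val.vertex) s₂.val with hp
  set st := storeT id (fun _ => true) p.val fun _ => false with hst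
  set s₃ := search A (fun v => !st.val v) n (p.val.map fun v => ⟨v, none, 0⟩) [] with hs₃
  have hcost : (prepare A root).cost = s₁.cost + (a.cost + (s₂.cost + (b.cost + (p.cost +
      ((n + 1 + 0) + (st.cost + (p.val.length + (s₃.cost + ((n + 1 + 0) +
      ((storeT Visit.vertex Visit.depth s₃.val fun _ => 0).cost + 0)))))))))) := rfl
  have h1 := search_cost_le A (fun _ => true) hd n [r₀] []
  have h2 := search_cost_le A (fun _ => true) hd n [r₁] []
  have h3 := search_cost_le A (fun v => !st.val v) hd n (p.val.map fun v => ⟨v, none, 0⟩) []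
  have h4 := search_length_le A (fun _ => true) n [r₀] []
  have h5 := search_length_le A (fun _ => true) n [r₁] []
  have h6 := search_length_le A (fun v => !st.val v) n (p.val.map fun v => ⟨v, none, 0⟩) []
  have h7 := traceBack_cost_le (some b.val.vertex) s₂.val
  have h8 := traceBack_length_le (some b.val.vertex) s₂.val
  rw [← hs₁] at h1 h4
  rw [← hs₂] at h2 h5
  rw [← hs₃] at h3 h6
  rw [← hp] at h7 h8
  simp only [List.length_nil, add_zero] at h4 h5 h6
  rw [hcost, ha, hb, hst, argMaxT_cost, argMaxT_cost, storeT_cost, storeT_cost]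
  omega

end Prepare

/-! ### Loops with a decreasing measure -/

namespace WhileRun

variable {σ : Type} {guard : σ → Bool} {body : σ → Timed σ}

theorem exists_of_measure (Inv : σ → Prop) (μ : σ → ℕ)
    (hstep : ∀ s, Inv s → guard s = true → Inv (body s).val ∧ μ (body s).val < μ s) (s : σ)
    (hs : Inv s) : ∃ s' t, WhileRun guard body s s' t := by
  induction hn : μ s using Nat.strong_induction_on generalizing s with
  | _ n ih =>
    cases hg : guard s with
    | false => exact ⟨s, 1, exit hg⟩
    | true =>
      obtain ⟨h1, h2⟩ := hstep s hs hg
      obtain ⟨s', t, h⟩ := ih _ (by omega) _ h1 rfl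
      exact ⟨s', _, iter hg h⟩

/-- Each iteration pays `c` for the body and 1 for the test and lowers `μ`; the last summand is the
failing test. -/
theorem spec (Inv : σ → Prop) (μ : σ → ℕ) (c : ℕ)
    (hstep : ∀ s, Inv s → guard s = true → Inv (body s).val ∧ μ (body s).val < μ s)
    (hcost : ∀ s, (body s).cost ≤ c) {s s' : σ} {t : ℕ} (h : WhileRun guard body s s' t)
    (hs : Inv s) : Inv s' ∧ guard s' = false ∧ t ≤ μ s * (c + 1) + 1 := by
  induction h with
  | exit hg => exact ⟨hs, hg, by omega⟩
  | @iter s s' t hg h ih =>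
    obtain ⟨h1, h2⟩ := hstep s hs hg
    obtain ⟨h3, h4, h5⟩ := ih h1
    refine ⟨h3, h4, ?_⟩
    have h6 := hcost s
    have h7 : (μ (body s).val + 1) * (c + 1) ≤ μ s * (c + 1) := Nat.mul_le_mul_right _ h2
    rw [Nat.succ_mul] at h7
    omega

end WhileRun

/-! ## The exploration is a depth-first search -/

section Explore

variable {V : Type} {G : SimpleGraph V} {S : Prep V}

theorem nextUnexplored_some {explored : V → Bool} {nbrs : List V} {w : V}
    (h : (nextUnexplored S explored nbrs).val = some w) :
    w ∈ nbrs ∧ explored w = false ∧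
      (S.onPath w = true → ∀ w' ∈ nbrs, explored w' = false → S.onPath w' = true) := by
  unfold nextUnexplored at h
  rw [val_bind, findT_val] at h
  cases hx : nbrs.find? fun w => !explored w && !S.onPath w with
  | some x =>
    rw [hx] at h
    change some x = some w at h
    have h1 := List.mem_of_find?_eq_some hx
    have h2 := List.find?_some hx
    obtain rfl := Option.some.inj h
    simp only [Bool.and_eq_true, Bool.not_eq_true'] at h2
    exact ⟨h1, h2.1, fun h3 => by rw [h2.2] at h3; simp at h3⟩
  | none =>
    rw [hx] at h
    change (findT _ _).val = some w at h
    rw [findT_val] at h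
    have h2 := List.find?_some h
    simp only [Bool.not_eq_true'] at h2
    refine ⟨List.mem_of_find?_eq_some h, h2, fun _ w' hw' he => ?_⟩
    rw [List.find?_eq_none] at hx
    have := hx w' hw'
    simpa [he] using this

theorem nextUnexplored_none {explored : V → Bool} {nbrs : List V}
    (h : (nextUnexplored S explored nbrs).val = none) {w : V} (hw : w ∈ nbrs) :
    explored w = true := by
  unfold nextUnexplored at h
  rw [val_bind, findT_val] at h
  cases hx : nbrs.find? fun w => !explored w && !S.onPath w with
  | some x =>
    rw [hx] at h
    change some x = none at h
    simp at h
  | none =>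
    rw [hx] at h
    change (findT _ _).val = none at h
    rw [findT_val, List.find?_eq_none] at h
    simpa using h w hw

theorem nextUnexplored_cost_le (explored : V → Bool) (nbrs : List V) :
    (nextUnexplored S explored nbrs).cost ≤ 2 * (nbrs.length + 1) := by
  unfold nextUnexplored
  rw [cost_bind]
  have h1 := findT_cost_le (fun w => !explored w && !S.onPath w) nbrs
  have h2 := findT_cost_le (fun w => !explored w) nbrs
  cases (findT (fun w => !explored w && !S.onPath w) nbrs).val with
  | some x => simp only [cost_pure]; omega
  | none => simp only; omega

/-- The exploration proceeds as a depth-first search from the start of the selected path, which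
leaves the path whenever it can; `cur` is the vertex that the search has reached. -/
structure IsSearchState (G : SimpleGraph V) (S : Prep V) (explored : V → Bool)
    (par : V → Option V) (stamp : V → ℕ) (clock : ℕ) (cur : V) : Prop where
  cur_mem : explored cur = true
  up : ∀ v, explored v = true → explored (parent G S.start v) = true
  par_eq : ∀ v, explored v = true → v ≠ S.start → par v = some (parent G S.start v)
  open_anc : ∀ v w, explored v = true → G.Adj v w → explored w = false → IsAnc G S.start v cur
  stamp_lt : ∀ v, explored v = true → stamp v < clock
  -- The search has not left the branch at `c` since it entered it, so what is explored in this
  -- branch is newer than everything explored outside.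
  stamp_mono : ∀ a y c, explored a = true → explored y = true → IsAnc G S.start c cur →
    IsAnc G S.start c y → ¬ IsAnc G S.start c a → stamp a < stamp y
  -- The search moves on along the path only after all other neighbours are exhausted.
  path : ∀ y, IsAnc G S.start y S.goal → explored y = true → y ≠ S.start →
    ∀ w, G.Adj (parent G S.start y) w → explored w = true
  goal : explored S.goal = true → cur = S.goal

namespace IsSearchState

variable {explored : V → Bool} {par : V → Option V} {stamp : V → ℕ} {clock : ℕ} {cur : V}

theorem anc_mem (h : IsSearchState G S explored par stamp clock cur) {a b : V}
    (hb : explored b = true) (hab : IsAnc G S.start a b) : explored a = true := by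
  obtain ⟨m, rfl⟩ := hab
  induction m with
  | zero => exact hb
  | succ m ih =>
    rw [Function.iterate_succ_apply']
    exact h.up _ ih

theorem root_mem (hG : G.IsTree) (h : IsSearchState G S explored par stamp clock cur) :
    explored S.start = true :=
  h.anc_mem h.cur_mem (IsAnc.root hG cur)

theorem all_explored_of_no_open (hG : G.IsTree)
    (h : IsSearchState G S explored par stamp clock cur)
    (hno : ∀ v w, explored v = true → G.Adj v w → explored w = true) (v : V) :
    explored v = true := by
  induction hn : G.dist S.start v using Nat.strong_induction_on generalizing v with
  | _ n ih =>
    by_cases hv : v = S.start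
    · rw [hv]; exact h.root_mem hG
    · have := dist_parent hG hv
      exact hno _ v (ih _ (by omega) (parent G S.start v) rfl) (adj_parent hG hv).symm

/-- A vertex with an unexplored neighbour would lie above the current vertex, which is the goal. The
goal has no children because the path is longest, and the other vertices of the path were exhausted
before the search went further down. -/
theorem all_explored (hG : G.IsTree) (hS : IsPrep G S)
    (h : IsSearchState G S explored par stamp clock cur) (hg : explored S.goal = true) (v : V) :
    explored v = true := by
  refine h.all_explored_of_no_open hG (fun u w hu huw => ?_) v
  by_contra hw
  rw [Bool.not_eq_true] at hw
  have h1 := h.open_anc u w hu huw hw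
  rw [h.goal hg] at h1
  by_cases hug : u = S.goal
  · subst hug
    rcases adj_cases (r := S.start) hG huw with ⟨h2, rfl⟩ | ⟨h2, h3⟩
    · rw [h.up _ hu] at hw
      simp at hw
    · have h4 := dist_parent hG h2
      have h5 := hS.diam S.start w
      rw [h3] at h4
      omega
  · obtain ⟨y, hy, rfl, hyg⟩ := h1.exists_child hug
    have := h.path y hyg (h.anc_mem hg hyg) hy w huw
    rw [this] at hw
    simp at hw

/-- The last explored vertex of the path lies above the current vertex and is still open. -/
theorem exists_last_on_path [Finite V] (hG : G.IsTree)
    (h : IsSearchState G S explored par stamp clock cur) (hg : explored S.goal = false) :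
    ∃ x w, IsAnc G S.start x S.goal ∧ explored x = true ∧ IsAnc G S.start x cur ∧
      (∀ y, IsAnc G S.start y S.goal → explored y = true → IsAnc G S.start y x) ∧
      G.Adj x w ∧ explored w = false := by
  obtain ⟨x, ⟨hx, hxe⟩, hmax⟩ := Set.exists_max_image
    {x | IsAnc G S.start x S.goal ∧ explored x = true} (G.dist S.start) (Set.toFinite _)
    ⟨S.start, IsAnc.root hG _, h.root_mem hG⟩
  have hxg : x ≠ S.goal := by rintro rfl; rw [hg] at hxe; simp at hxe
  obtain ⟨w, hw, hwx, hwg⟩ := hx.exists_child hxg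
  have hadj : G.Adj x w := hwx ▸ (adj_parent hG hw).symm
  have hwe : explored w = false := by
    by_contra hwe
    rw [Bool.not_eq_false] at hwe
    have h1 := hmax w ⟨hwg, hwe⟩
    have h2 := dist_parent hG hw
    rw [hwx] at h2
    omega
  exact ⟨x, w, hx, hxe, h.open_anc x w hxe hadj hwe,
    fun y hy hye => hy.of_dist_le hG hx (hmax y ⟨hy, hye⟩), hadj, hwe⟩

theorem child_of_unexplored (hG : G.IsTree) (h : IsSearchState G S explored par stamp clock cur)
    {u w : V} (hu : explored u = true) (huw : G.Adj u w) (hw : explored w = false) :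
    w ≠ S.start ∧ parent G S.start w = u := by
  rcases adj_cases (r := S.start) hG huw with ⟨-, rfl⟩ | h1
  · rw [h.up _ hu] at hw
    simp at hw
  · exact h1

/-- The new vertex may be attached to any `u` above the current vertex, as long as no vertex below
`u` is skipped while it still has unexplored neighbours (`hopen`). This covers a change of the head.
-/
theorem explore [DecidableEq V] (hG : G.IsTree) (hS : IsPrep G S)
    (h : IsSearchState G S explored par stamp clock cur) {u w : V} {clock' : ℕ}
    (hu : explored u = true) (huc : IsAnc G S.start u cur)
    (hopen : ∀ v x, explored v = true → G.Adj v x → explored x = false → IsAnc G S.start v u)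
    (huw : G.Adj u w) (hw : explored w = false)
    (hpref : S.onPath w = true → ∀ x, G.Adj u x → explored x = false → S.onPath x = true)
    (hclock : clock < clock') :
    IsSearchState G S (Function.update explored w true) (Function.update par w (some u))
      (Function.update stamp w clock) clock' w := by
  obtain ⟨hwr, hwu⟩ := h.child_of_unexplored hG hu huw hw
  have hg : explored S.goal = false := by
    by_contra hg
    rw [Bool.not_eq_false] at hg
    rw [h.all_explored hG hS hg w] at hw
    simp at hw
  have hold : ∀ {v}, Function.update explored w true v = true ↔ v = w ∨ explored v = true := by
    intro v
    by_cases hvw : v = w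
    · simp [hvw]
    · simp [hvw]
  have hnew : ∀ {v}, Function.update explored w true v = false ↔ v ≠ w ∧ explored v = false := by
    intro v
    by_cases hvw : v = w
    · simp [hvw]
    · simp [hvw]
  have hne : ∀ {v}, explored v = true → v ≠ w := by
    rintro v hv rfl
    rw [hw] at hv
    simp at hv
  have huw' : IsAnc G S.start u w := hwu ▸ IsAnc.parent_left w
  constructor
  · exact hold.2 (Or.inl rfl)
  · intro v hv
    rcases hold.1 hv with rfl | hv
    · exact hold.2 (Or.inr (hwu ▸ hu))
    · exact hold.2 (Or.inr (h.up v hv))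
  · intro v hv hvr
    rcases hold.1 hv with rfl | hv
    · rw [Function.update_self, hwu]
    · rw [Function.update_of_ne (hne hv)]
      exact h.par_eq v hv hvr
  · intro v x hv hvx hx
    rcases hold.1 hv with rfl | hv
    · exact IsAnc.refl v
    · exact (hopen v x hv hvx (hnew.1 hx).2).trans huw'
  · intro v hv
    rcases hold.1 hv with rfl | hv
    · rw [Function.update_self]; exact hclock
    · rw [Function.update_of_ne (hne hv)]
      exact (h.stamp_lt v hv).trans hclock
  · intro a y c ha hy hcw hcy hca
    rcases hold.1 ha with rfl | hae
    · exact absurd hcw hca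
    · rw [Function.update_of_ne (hne hae)]
      rcases hold.1 hy with rfl | hye
      · rw [Function.update_self]; exact h.stamp_lt a hae
      · rw [Function.update_of_ne (hne hye)]
        have hcw' : c ≠ w := hne (h.anc_mem hye hcy)
        have h1 := hcw.parent_right hcw'
        rw [hwu] at h1
        exact h.stamp_mono a y c hae hye (h1.trans huc) hcy hca
  · intro y hyg hy hyr x hyx
    rcases hold.1 hy with rfl | hy
    · rw [hwu] at hyx
      by_contra hx
      rw [Bool.not_eq_true] at hx
      obtain ⟨hxw, hx⟩ := hnew.1 hx
      -- A path vertex is chosen only if all unexplored neighbours are on the path; but `u` has just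
      -- one child on the path.
      have h1 := (hS.onPath x).1 (hpref ((hS.onPath y).2 hyg) x hyx hx)
      obtain ⟨hxr, hxu⟩ := h.child_of_unexplored hG hu hyx hx
      have h2 := dist_parent hG hxr
      have h3 := dist_parent hG hwr
      rw [hxu] at h2
      rw [hwu] at h3
      exact hxw (h1.eq_of_dist_eq hG hyg (by omega))
    · exact hold.2 (Or.inr (h.path y hyg hy hyr x hyx))
  · intro hg'
    rcases hold.1 hg' with h1 | h1
    · exact h1.symm
    · rw [h1] at hg
      simp at hg

theorem retreat (h : IsSearchState G S explored par stamp clock cur) {u : V} {clock' : ℕ}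
    (hu : IsAnc G S.start u cur) (hg : explored S.goal = false)
    (hopen : ∀ v x, explored v = true → G.Adj v x → explored x = false → IsAnc G S.start v u)
    (hclock : clock ≤ clock') : IsSearchState G S explored par stamp clock' u where
  cur_mem := h.anc_mem h.cur_mem hu
  up := h.up
  par_eq := h.par_eq
  open_anc := hopen
  stamp_lt v hv := (h.stamp_lt v hv).trans_le hclock
  stamp_mono a y c ha hy hc := h.stamp_mono a y c ha hy (hc.trans hu)
  path := h.path
  goal h' := by rw [h'] at hg; simp at hg

end IsSearchState

end Explore

/-! ## Deployment -/

section Deployment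

variable {V : Type} {G : SimpleGraph V} {S : Prep V}

/-- Agent `i < k` stands on `pos i`, and `occ` tells which agent stands on a vertex. -/
def IsPlacement (k : ℕ) (pos : ℕ → V) (occ : V → Option ℕ) : Prop :=
  ∀ v i, occ v = some i ↔ i < k ∧ pos i = v

namespace IsPlacement

variable {k : ℕ} {pos : ℕ → V} {occ : V → Option ℕ}

theorem isSome_iff (h : IsPlacement k pos occ) {v : V} :
    (occ v).isSome = true ↔ ∃ i < k, pos i = v := by
  rw [Option.isSome_iff_exists]
  exact exists_congr fun i => h v i

theorem isSome_pos (h : IsPlacement k pos occ) {i : ℕ} (hi : i < k) :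
    (occ (pos i)).isSome = true := h.isSome_iff.2 ⟨i, hi, rfl⟩

theorem inj (h : IsPlacement k pos occ) {i j : ℕ} (hi : i < k) (hj : j < k)
    (hij : pos i = pos j) : i = j := by
  have h1 := (h (pos j) i).2 ⟨hi, hij⟩
  have h2 := (h (pos j) j).2 ⟨hj, rfl⟩
  rw [h1] at h2
  exact Option.some.inj h2

theorem ncard (h : IsPlacement k pos occ) : {v | (occ v).isSome = true}.ncard = k := by
  have h1 : {v | (occ v).isSome = true} = pos '' Set.Iio k := by
    ext v
    rw [Set.mem_ofPred_eq, h.isSome_iff]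
    rfl
  have h2 : Set.InjOn pos (Set.Iio k) := fun i hi j hj => h.inj hi hj
  rw [h1, h2.ncard_image, ← Finset.coe_range, Set.ncard_coe_finset, Finset.card_range]

end IsPlacement

/-- The invariant of the deployment. -/
structure IsDeployState (G : SimpleGraph V) (S : Prep V) (k : ℕ) (d : Deploy V) : Prop where
  search : IsSearchState G S d.explored d.parent d.stamp d.count d.cur
  one_le : 1 ≤ d.count
  le : d.count ≤ k
  placement : IsPlacement d.count d.pos d.occ
  explored_iff : ∀ v, d.explored v = (d.occ v).isSome
  first : d.pos 0 = S.start
  last : d.count = k → d.cur = d.pos (k - 1) ∧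
    ∀ x, d.explored x = true → IsAnc G S.start d.cur x → x = d.cur

namespace IsDeployState

variable {k : ℕ} {d : Deploy V}

theorem card_le [Fintype V] (h : IsDeployState G S k d) (hall : ∀ v, d.explored v = true) :
    Fintype.card V ≤ d.count := by
  have h1 := h.placement.ncard
  have h2 : {v | (d.occ v).isSome = true} = Set.univ := by
    ext v
    simp [← h.explored_iff, hall v]
  rw [h2, Set.ncard_univ, Nat.card_eq_fintype_card] at h1
  omega

theorem init [DecidableEq V] (hG : G.IsTree) (A : AdjLists V) (hk : 1 ≤ k) :
    IsDeployState G S k (deployInit A k S).val := by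
  have hval : (deployInit A k S).val =
    { cur := S.start
      explored := Function.update (fun _ => false) S.start true
      parent := fun _ => none
      stamp := fun _ => 0
      count := 1
      pos := fun _ => S.start
      occ := Function.update (fun _ => none) S.start (some 0) } := rfl
  rw [hval]
  have hex : ∀ {v}, Function.update (fun _ => false) S.start true v = true ↔ v = S.start := by
    intro v
    by_cases hv : v = S.start <;> simp [hv]
  have hanc : ∀ {v}, IsAnc G S.start v S.start → v = S.start := fun {v} hv =>
    hv.antisymm hG (IsAnc.root hG v)
  constructor
  · constructor
    · exact hex.2 rfl
    · intro v hv
      rw [hex.1 hv, parent_root]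
      exact hex.2 rfl
    · intro v hv hvr
      exact absurd (hex.1 hv) hvr
    · intro v w hv _ _
      rw [hex.1 hv]
      exact IsAnc.refl _
    · intro v _
      exact Nat.one_pos
    · intro a y c ha hy hc hcy hca
      rw [hex.1 ha] at hca
      exact absurd hc hca
    · intro y _ hy hyr
      exact absurd (hex.1 hy) hyr
    · intro hg
      exact (hex.1 hg).symm
  · exact le_rfl
  · exact hk
  · intro v i
    by_cases hv : v = S.start
    · subst hv
      simp only [Function.update_self, Option.some.injEq, and_true]
      omega
    · simp only [Function.update_of_ne hv, reduceCtorEq, false_iff, not_and]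
      exact fun _ h => hv h.symm
  · intro v
    by_cases hv : v = S.start <;> simp [hv]
  · rfl
  · intro _
    exact ⟨rfl, fun x hx _ => hex.1 hx⟩

/-- In the measure, exploring raises the depth by 1 but lowers the other term by 2, and going back
lowers the depth. -/
theorem step [Fintype V] [DecidableEq V] (hG : G.IsTree) (hS : IsPrep G S) {A : AdjLists V}
    (hA : A.Represents G) (hkn : k ≤ Fintype.card V) (h : IsDeployState G S k d)
    (hd : d.count < k) :
    IsDeployState G S k (deployStep A S d).val ∧
      2 * (k - (deployStep A S d).val.count) + G.dist S.start (deployStep A S d).val.cur <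
        2 * (k - d.count) + G.dist S.start d.cur := by
  have hnot : ¬ ∀ v, d.explored v = true := fun hall => by
    have := h.card_le hall
    omega
  have hg : d.explored S.goal = false := by
    by_contra hg
    rw [Bool.not_eq_false] at hg
    exact hnot (h.search.all_explored hG hS hg)
  cases hx : (nextUnexplored S d.explored (A.nbrs d.cur)).val with
  | some w =>
    have hval : (deployStep A S d).val =
      { cur := w
        explored := Function.update d.explored w true
        parent := Function.update d.parent w (some d.cur)
        stamp := Function.update d.stamp w d.count
        count := d.count + 1
        pos := Function.update d.pos d.count w
        occ := Function.update d.occ w (some d.count) } := by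
      unfold deployStep
      simp only [val_bind, hx]
      rfl
    obtain ⟨h1, h2, h3⟩ := nextUnexplored_some hx
    rw [hA.mem_nbrs] at h1
    have hwd := (h.search.child_of_unexplored hG h.search.cur_mem h1 h2)
    rw [hval]
    refine ⟨⟨?_, ?_, ?_, ?_, ?_, ?_, ?_⟩, ?_⟩
    · exact h.search.explore hG hS h.search.cur_mem (IsAnc.refl _) h.search.open_anc h1 h2
        (fun hw x hx => h3 hw x ((hA.mem_nbrs _ _).2 hx)) (Nat.lt_succ_self _)
    · exact Nat.succ_pos _
    · exact hd
    · intro v i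
      have hocc : d.occ w = none := by
        have := h.explored_iff w
        rw [h2] at this
        simpa using this.symm
      by_cases hv : v = w
      · subst hv
        simp only [Function.update_self, Option.some.injEq]
        constructor
        · rintro rfl
          exact ⟨Nat.lt_succ_self _, Function.update_self ..⟩
        · rintro ⟨hi, hp⟩
          by_contra hne
          rw [Function.update_of_ne (Ne.symm hne)] at hp
          have := (h.placement v i).2 ⟨by omega, hp⟩
          rw [hocc] at this
          simp at this
      · simp only [Function.update_of_ne hv]
        rw [h.placement v i]
        constructor
        · rintro ⟨hi, hp⟩
          exact ⟨by omega, by rw [Function.update_of_ne (by omega)]; exact hp⟩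
        · rintro ⟨hi, hp⟩
          by_cases hne : i = d.count
          · subst hne
            rw [Function.update_self] at hp
            exact absurd hp.symm hv
          · rw [Function.update_of_ne hne] at hp
            exact ⟨by omega, hp⟩
    · intro v
      by_cases hv : v = w
      · subst hv; simp
      · simp [Function.update_of_ne hv, h.explored_iff v]
    · have := h.one_le
      change Function.update d.pos d.count w 0 = S.start
      rw [Function.update_of_ne (by omega)]
      exact h.first
    · intro hk
      change d.count + 1 = k at hk
      refine ⟨?_, fun x hx hwx => ?_⟩
      · change w = Function.update d.pos d.count w (k - 1)
        rw [← hk, Nat.add_sub_cancel, Function.update_self]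
      · by_contra hxw
        change Function.update d.explored w true x = true at hx
        rw [Function.update_of_ne hxw] at hx
        rw [h.search.anc_mem hx hwx] at h2
        simp at h2
    · have := dist_parent hG hwd.1
      rw [hwd.2] at this
      change 2 * (k - (d.count + 1)) + G.dist S.start w < _
      omega
  | none =>
    have hclosed : ∀ w, G.Adj d.cur w → d.explored w = true := fun w hw =>
      nextUnexplored_none hx ((hA.mem_nbrs _ _).2 hw)
    have hopen : ∀ v x, d.explored v = true → G.Adj v x → d.explored x = false →
        IsAnc G S.start v d.cur ∧ v ≠ d.cur := by
      intro v x hv hvx hxe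
      refine ⟨h.search.open_anc v x hv hvx hxe, ?_⟩
      rintro rfl
      rw [hclosed x hvx] at hxe
      simp at hxe
    -- An exhausted root would mean that all vertices are explored, although fewer than `k ≤ n` are.
    have hcr : d.cur ≠ S.start := by
      intro hcr
      refine hnot (h.search.all_explored_of_no_open hG fun v w hv hvw => ?_)
      by_contra hw
      rw [Bool.not_eq_true] at hw
      obtain ⟨h1, h2⟩ := hopen v w hv hvw hw
      rw [hcr] at h1 h2
      exact h2 (h1.antisymm hG (IsAnc.root hG v))
    have hval : (deployStep A S d).val = { d with cur := parent G S.start d.cur } := by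
      unfold deployStep
      simp only [val_bind, hx, val_pure]
      rw [h.search.par_eq _ h.search.cur_mem hcr]
      rfl
    rw [hval]
    refine ⟨⟨?_, h.one_le, h.le, h.placement, h.explored_iff, h.first, ?_⟩, ?_⟩
    · exact h.search.retreat (IsAnc.parent_left _) hg (fun v x hv hvx hxe =>
        (hopen v x hv hvx hxe).1.parent_right (hopen v x hv hvx hxe).2) le_rfl
    · intro hk
      change d.count = k at hk
      omega
    · have := dist_parent hG hcr
      change 2 * (k - d.count) + G.dist S.start (parent G S.start d.cur) < _
      omega

end IsDeployState

theorem deployStep_cost_le [DecidableEq V] {A : AdjLists V} {m : ℕ}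
    (hm : ∀ v, (A.nbrs v).length ≤ m) (d : Deploy V) :
    (deployStep A S d).cost ≤ 2 * m + 3 := by
  unfold deployStep
  have h1 := nextUnexplored_cost_le (S := S) d.explored (A.nbrs d.cur)
  have h2 := hm d.cur
  rw [cost_bind, cost_tick, cost_bind]
  cases (nextUnexplored S d.explored (A.nbrs d.cur)).val <;> simp only [cost_pure] <;> omega

end Deployment

/-! ## Moving the agents -/

section Follow

variable {V : Type} [DecidableEq V] {G : SimpleGraph V} {k : ℕ}

theorem followHead_cost_le (dest : V) (p : List V) (pos : ℕ → V) (occ : V → Option ℕ) :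
    (followHead dest p pos occ).cost ≤ p.length + 1 := by
  induction p generalizing dest pos occ with
  | nil => exact le_rfl
  | cons v vs ih =>
    cases vs with
    | nil => simp [followHead, cost_bind, cost_pure, cost_tick]
    | cons v' vs =>
      rw [followHead, cost_bind, cost_tick, List.length_cons]
      have := ih v (Function.update pos ((occ v).getD 0) dest)
        (Function.update (Function.update occ dest (some ((occ v).getD 0))) v none)
      dsimp only
      omega

theorem IsPlacement.move {pos : ℕ → V} {occ : V → Option ℕ} (h : IsPlacement k pos occ)
    {v dest : V} {i : ℕ} (hi : occ v = some i) (hdest : occ dest = none) :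
    IsPlacement k (Function.update pos i dest)
      (Function.update (Function.update occ dest (some i)) v none) := by
  have hvd : v ≠ dest := by rintro rfl; rw [hi] at hdest; simp at hdest
  obtain ⟨hik, hiv⟩ := (h v i).1 hi
  intro x j
  by_cases hxv : x = v
  · subst hxv
    simp only [Function.update_self, reduceCtorEq, false_iff, not_and]
    intro hj hx
    by_cases hji : j = i
    · subst hji; rw [Function.update_self] at hx; exact hvd hx.symm
    · rw [Function.update_of_ne hji] at hx
      exact hji (h.inj hj hik (hx.trans hiv.symm))
  · rw [Function.update_of_ne hxv]
    by_cases hxd : x = dest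
    · subst hxd
      rw [Function.update_self, Option.some.injEq]
      constructor
      · rintro rfl; exact ⟨hik, Function.update_self ..⟩
      · rintro ⟨hj, hx⟩
        by_contra hji
        rw [Function.update_of_ne (Ne.symm hji)] at hx
        have := (h x j).2 ⟨hj, hx⟩
        rw [hdest] at this
        simp at this
    · rw [Function.update_of_ne hxd, h x j]
      refine and_congr_right fun hj => ?_
      by_cases hji : j = i
      · subst hji
        rw [Function.update_self, hiv]
        exact ⟨fun h => absurd h.symm hxv, fun h => absurd h.symm hxd⟩
      · rw [Function.update_of_ne hji]

/-- The vertex just left is free and becomes the next destination. The clause on agents outside `p`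
is for the induction: it shows that an agent that has moved does not move again. -/
theorem followHead_spec {p : List V} (hne : p ≠ []) {dest : V} {pos : ℕ → V} {occ : V → Option ℕ}
    (h : IsPlacement k pos occ) (hdest : occ dest = none) (hocc : ∀ v ∈ p, (occ v).isSome = true)
    (hnd : p.Nodup) (hadj : (dest :: p).IsChain G.Adj) :
    IsPlacement k (followHead dest p pos occ).val.1 (followHead dest p pos occ).val.2.1 ∧
    (∀ v, ((followHead dest p pos occ).val.2.1 v).isSome = true ↔
      (v = dest ∨ (occ v).isSome = true) ∧ v ≠ p.getLast hne) ∧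
    (∀ i < k, pos i = (followHead dest p pos occ).val.1 i ∨
      G.Adj (pos i) ((followHead dest p pos occ).val.1 i)) ∧
    (∀ i < k, pos i ∉ p → (followHead dest p pos occ).val.1 i = pos i) ∧
    G.Adj (p.getLast hne) (followHead dest p pos occ).val.2.2 ∧
    ((p.length = 1 ∧ (followHead dest p pos occ).val.2.2 = dest) ∨
      (followHead dest p pos occ).val.2.2 ∈ p) := by
  induction p generalizing dest pos occ with
  | nil => exact absurd rfl hne
  | cons v vs ih =>
    obtain ⟨i, hi⟩ := Option.isSome_iff_exists.1 (hocc v List.mem_cons_self)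
    have hvd : v ≠ dest := by rintro rfl; rw [hi] at hdest; simp at hdest
    obtain ⟨hik, hiv⟩ := (h v i).1 hi
    have hmove := h.move hi hdest
    have hdv : G.Adj dest v := (List.isChain_cons_cons.1 hadj).1
    set pos' := Function.update pos i dest with hpos'
    set occ' := Function.update (Function.update occ dest (some i)) v none with hocc'
    have hsome : ∀ x, (occ' x).isSome = true ↔ (x = dest ∨ (occ x).isSome = true) ∧ x ≠ v := by
      intro x
      by_cases hxv : x = v
      · subst hxv; simp [hocc']
      · by_cases hxd : x = dest
        · subst hxd; simp [hocc', hxv]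
        · simp [hocc', hxv, hxd]
    have hother : ∀ j, j ≠ i → pos' j = pos j := fun j hj => Function.update_of_ne hj _ _
    cases vs with
    | nil =>
      have hval : (followHead dest [v] pos occ).val = (pos', occ', dest) := by
        rw [followHead, val_bind]
        simp only [hi, Option.getD_some]
        rfl
      rw [hval]
      refine ⟨hmove, hsome, fun j hj => ?_, fun j hj hjv => ?_, hdv.symm, Or.inl ⟨rfl, rfl⟩⟩
      · by_cases hji : j = i
        · subst hji
          right
          rw [hiv]
          simpa [hpos'] using hdv.symm
        · exact Or.inl (hother j hji).symm
      · refine hother j ?_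
        rintro rfl
        exact hjv (by simp [hiv])
    | cons v' vs =>
      have hval : (followHead dest (v :: v' :: vs) pos occ).val =
          (followHead v (v' :: vs) pos' occ').val := by
        rw [followHead, val_bind]
        simp only [hi, Option.getD_some]
        rfl
      have hdvs : dest ∉ v' :: vs := by
        intro hd
        have := hocc dest (List.mem_cons_of_mem _ hd)
        rw [hdest] at this
        simp at this
      have hvvs : v ∉ v' :: vs := (List.nodup_cons.1 hnd).1
      obtain ⟨h1, h2, h3, h4, h5, h6⟩ := ih (by simp) (dest := v) (pos := pos') (occ := occ') hmove
        (by simp [hocc']) (fun x hx => by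
          rw [hsome]
          exact ⟨Or.inr (hocc x (List.mem_cons_of_mem _ hx)), fun hxv => hvvs (hxv ▸ hx)⟩)
        (List.nodup_cons.1 hnd).2 (List.isChain_cons_cons.1 hadj).2
      rw [hval, List.getLast_cons (by simp)]
      refine ⟨h1, fun x => ?_, fun j hj => ?_, fun j hj hjv => ?_, h5, Or.inr ?_⟩
      · rw [h2, hsome]
        by_cases hxv : x = v
        · subst hxv
          simp [hi]
        · simp [hxv]
      · by_cases hji : j = i
        · subst hji
          right
          have hpj : pos' j = dest := by simp [hpos']
          rw [h4 j hj (by rw [hpj]; exact hdvs), hpj, hiv]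
          exact hdv.symm
        · rw [← hother j hji]
          exact h3 j hj
      · have hji : j ≠ i := by
          rintro rfl
          exact hjv (by simp [hiv])
        rw [h4 j hj (by rw [hother j hji]; exact fun h => hjv (List.mem_cons_of_mem _ h)),
          hother j hji]
      · rcases h6 with ⟨-, h6⟩ | h6
        · rw [h6]; exact List.mem_cons_self
        · exact List.mem_cons_of_mem _ h6

end Follow

/-! ## The invariant of the occupied set -/

section Occupied

variable {V : Type} {G : SimpleGraph V} {r g : V} {O : Set V} {k : ℕ}

/-- `u` is the only neighbour of `t` in `O`. -/
def IsLeafAt (G : SimpleGraph V) (O : Set V) (t u : V) : Prop :=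
  u ∈ O ∧ G.Adj t u ∧ ∀ x ∈ O, G.Adj t x → x = u

/-- No branch of `O` leaves the path from the head `h` to the tail `t` on its descending part. -/
def IsBareTrail (G : SimpleGraph V) (r : V) (O : Set V) (h t : V) : Prop :=
  ∀ x ∈ O, ¬ IsAnc G r x h → ∀ c, IsAnc G r c x → IsAnc G r c h → IsAnc G r c t

/-- The tail follows the selected path from its start, and the branches of `O` leave the path to the
head near the start. -/
def IsFirstTrail (G : SimpleGraph V) (r g : V) (O : Set V) (h t : V) : Prop :=
  IsAnc G r t g ∧ (∀ x ∈ O, IsAnc G r t x) ∧ ∀ x ∈ O, ¬ IsAnc G r x h →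
    ∀ c, IsAnc G r c x → IsAnc G r c h → G.dist r c + G.dist r t < G.dist r h

/-- A branch off the path that contains `O` is deep. -/
def OnlyInDeep (G : SimpleGraph V) (r g : V) (k : ℕ) (O : Set V) : Prop :=
  ∀ v, ¬ IsAnc G r v g → (∀ x ∈ O, IsAnc G r v x) → IsDeep G r k v

/-- The only occupied neighbour of `t` is its child towards `h`; so the parent of `t` is not
occupied, and `t` is the top. -/
theorem IsLeafAt.of_isAnc (hG : G.IsTree) {top h t u : V} (hO : IsTop G r O top)
    (ht : t ∈ O) (hh : h ∈ O) (hth : t ≠ h) (hu : IsLeafAt G O t u) (hanc : IsAnc G r t h) :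
    u ≠ r ∧ parent G r u = t ∧ IsAnc G r u h ∧ top = t := by
  obtain ⟨c, hcr, hct, hch⟩ := hanc.exists_child hth
  have hc : c ∈ O := hO.mem_of_isAnc hG hh
    ((hO.isAnc hG ht).trans (hct ▸ IsAnc.parent_left c)) hch
  obtain rfl := hu.2.2 c hc (hct ▸ (adj_parent hG hcr).symm)
  refine ⟨hcr, hct, hch, ?_⟩
  by_contra htop
  obtain ⟨htr, hp⟩ := hO.2 t ht (Ne.symm htop)
  have h1 := hu.2.2 _ hp (adj_parent hG htr)
  have h2 := dist_parent hG htr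
  have h3 := dist_parent hG hcr
  rw [h1] at h2
  rw [hct] at h3
  omega

theorem IsLeafAt.of_not_isAnc (hG : G.IsTree) {top h t u : V} (hO : IsTop G r O top)
    (ht : t ∈ O) (hh : h ∈ O) (hu : IsLeafAt G O t u) (hanc : ¬ IsAnc G r t h) :
    t ≠ r ∧ u = parent G r t ∧ t ≠ top := by
  have htop : t ≠ top := by rintro rfl; exact hanc (hO.isAnc hG hh)
  obtain ⟨htr, hp⟩ := hO.2 t ht htop
  exact ⟨htr, (hu.2.2 _ hp (adj_parent hG htr)).symm, htop⟩

theorem IsTop.isLeafAt_of_no_child (hG : G.IsTree) {top y : V} (hO : IsTop G r O top)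
    (hy : y ∈ O) (hyt : y ≠ top) (hno : ∀ z ∈ O, z ≠ r → parent G r z ≠ y) :
    IsLeafAt G O y (parent G r y) := by
  obtain ⟨hyr, hp⟩ := hO.2 y hy hyt
  refine ⟨hp, adj_parent hG hyr, fun x hx hyx => ?_⟩
  rcases adj_cases (r := r) hG hyx with ⟨-, h⟩ | ⟨h1, h2⟩
  · exact h.symm
  · exact absurd h2 (hno x hx h1)

/-- Above every member of `O` that is not above `h` there is a leaf of `O` below it. -/
theorem IsTop.exists_leaf_below [Finite V] (hG : G.IsTree) {top h x : V} (hO : IsTop G r O top)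
    (hh : h ∈ O) (hx : x ∈ O) (hxh : ¬ IsAnc G r x h) :
    ∃ y ∈ O, IsAnc G r x y ∧ ¬ IsAnc G r y h ∧ ∃ u, IsLeafAt G O y u := by
  obtain ⟨y, hy, hxy, hno⟩ := IsTop.exists_below (r := r) hG hx
  have hyh : ¬ IsAnc G r y h := fun h' => hxh (hxy.trans h')
  have hyt : y ≠ top := by rintro rfl; exact hyh (hO.isAnc hG hh)
  exact ⟨y, hy, hxy, hyh, _, hO.isLeafAt_of_no_child hG hy hyt hno⟩

/-- If `O` is a chain ending in `h`, its top is a leaf; otherwise there is a leaf below a vertex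
that is not above `h`. -/
theorem IsTop.exists_leaf_ne [Finite V] (hG : G.IsTree) {top h : V} (hO : IsTop G r O top)
    (hh : h ∈ O) (h2 : 2 ≤ O.ncard) : ∃ y ∈ O, y ≠ h ∧ ∃ u, IsLeafAt G O y u := by
  by_cases hall : ∀ x ∈ O, IsAnc G r x h
  · have hth : top ≠ h := by
      rintro rfl
      have : O ⊆ {top} := fun x hx => (hall x hx).antisymm hG (hO.isAnc hG hx)
      have := Set.ncard_le_ncard this
      rw [Set.ncard_singleton] at this
      omega
    obtain ⟨c, hcr, hct, hch⟩ := (hO.isAnc hG hh).exists_child hth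
    have hc : c ∈ O := hO.mem_of_isAnc hG hh (hct ▸ IsAnc.parent_left c) hch
    refine ⟨top, hO.1, hth, c, hc, hct ▸ (adj_parent hG hcr).symm, fun x hx hadj => ?_⟩
    rcases adj_cases (r := r) hG hadj with ⟨h1, h3⟩ | ⟨h1, h3⟩
    · have h4 := (hO.isAnc hG hx).dist_add hG
      have h5 := dist_parent hG h1
      rw [h3] at h5
      omega
    · refine (hall x hx).eq_of_dist_eq hG hch ?_
      rw [← dist_parent hG h1, ← dist_parent hG hcr, h3, hct]
  · push Not at hall
    obtain ⟨x, hx, hxh⟩ := hall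
    obtain ⟨y, hy, -, hyh, hu⟩ := hO.exists_leaf_below hG hh hx hxh
    exact ⟨y, hy, by rintro rfl; exact hyh (IsAnc.refl _), hu⟩

/-- The occupied set after the head moves down to `w` and the tail is left. -/
theorem IsTop.move_down (hG : G.IsTree) {top h t u w : V} (hO : IsTop G r O top) (ht : t ∈ O)
    (hh : h ∈ O) (hth : t ≠ h) (hu : IsLeafAt G O t u) (hw : w ≠ r) (hwh : parent G r w = h) :
    ∃ top', IsTop G r (insert w O \ {t}) top' := by
  by_cases hanc : IsAnc G r t h
  · obtain ⟨-, hut, -, rfl⟩ := hu.of_isAnc hG hO ht hh hth hanc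
    -- The tail that leaves is the old top, and its only neighbour takes its place.
    refine ⟨u, ⟨Or.inr hu.1, fun h => hu.2.1.ne (Eq.symm h)⟩, ?_⟩
    rintro x ⟨rfl | hx, hxt⟩ hxu
    · exact ⟨hw, Or.inr (hwh ▸ hh), hwh ▸ Ne.symm hth⟩
    · obtain ⟨h1, h2⟩ := hO.2 x hx hxt
      refine ⟨h1, Or.inr h2, fun h => hxu ?_⟩
      have h : parent G r x = top := h
      exact hu.2.2 x hx (h ▸ (adj_parent hG h1).symm)
  · obtain ⟨htr, hut, htop⟩ := hu.of_not_isAnc hG hO ht hh hanc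
    refine ⟨top, ⟨Or.inr hO.1, htop.symm⟩, ?_⟩
    rintro x ⟨rfl | hx, hxt⟩ hxtop
    · exact ⟨hw, Or.inr (hwh ▸ hh), hwh ▸ Ne.symm hth⟩
    · obtain ⟨h1, h2⟩ := hO.2 x hx hxtop
      refine ⟨h1, Or.inr h2, fun h => ?_⟩
      have h : parent G r x = t := h
      have h3 := hu.2.2 x hx (h ▸ (adj_parent hG h1).symm)
      have h4 := dist_parent hG h1
      have h5 := dist_parent hG htr
      rw [h] at h4
      rw [← hut, ← h3] at h5
      omega

/-- The occupied set after its top `h` moves up and the tail is left. -/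
theorem IsTop.move_up (hG : G.IsTree) {h t u : V} (hO : IsTop G r O h) (ht : t ∈ O)
    (hth : t ≠ h) (hu : IsLeafAt G O t u) (hr : h ≠ r) :
    IsTop G r (insert (parent G r h) O \ {t}) (parent G r h) := by
  have hanc : ¬ IsAnc G r t h := fun h' => hth (h'.antisymm hG (hO.isAnc hG ht))
  obtain ⟨htr, hut, -⟩ := hu.of_not_isAnc hG hO ht hO.1 hanc
  have hpO : parent G r h ∉ O := fun h' => not_isAnc_parent hG hr (hO.isAnc hG h')
  refine ⟨⟨Or.inl rfl, fun h' => ?_⟩, ?_⟩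
  · have h' : parent G r h = t := h'
    exact hpO (h' ▸ ht)
  rintro x ⟨rfl | hx, hxt⟩ hxtop
  · exact absurd rfl hxtop
  · by_cases hxh : x = h
    · subst hxh
      refine ⟨hr, Or.inl rfl, fun h' => ?_⟩
      have h' : parent G r x = t := h'
      exact hpO (h' ▸ ht)
    · obtain ⟨h1, h2⟩ := hO.2 x hx hxh
      refine ⟨h1, Or.inr h2, fun h => ?_⟩
      have h : parent G r x = t := h
      have h3 := hu.2.2 x hx (h ▸ (adj_parent hG h1).symm)
      have h4 := dist_parent hG h1
      have h5 := dist_parent hG htr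
      rw [h] at h4
      rw [← hut, ← h3] at h5
      omega

/-- When the trail leaves its topmost vertex for a branch off the selected path, then all of `O` in
that branch lies on the trail. -/
theorem isAnc_head_of_off_path (hG : G.IsTree) (hL : ∀ x y, G.dist x y ≤ G.dist r g)
    {h t u w x : V} (htrail : IsBareTrail G r O h t ∨ IsFirstTrail G r g O h t) (hur : u ≠ r)
    (hut : parent G r u = t) (huh : IsAnc G r u h) (hug : ¬ IsAnc G r u g) (hw : w ≠ r)
    (hwh : parent G r w = h) (hx : x ∈ O) (hux : IsAnc G r u x) : IsAnc G r x h := by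
  by_contra hxh
  have hd := dist_parent hG hur
  rw [hut] at hd
  rcases htrail with h1 | h1
  · have := (h1 x hx hxh u hux huh).dist_add hG
    omega
  -- With a first trail, a side branch at or below `u` gives `2 * G.dist r t + 1 < G.dist r h`.
  -- Maximality of the selected path gives `G.dist r h + 1 ≤ 2 * G.dist r t`.
  · have h2 := h1.2.2 x hx hxh u hux huh
    have h3 := dist_parent hG hw
    obtain ⟨c, -, hcu, hne, h4⟩ := dist_le_of_off_path hG hL hug
      (huh.trans (hwh ▸ IsAnc.parent_left w : IsAnc G r h w))
    have h5 := (hut ▸ hcu.parent_right hne : IsAnc G r c t).dist_add hG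
    rw [hwh] at h3
    omega

/-- A bare trail stays bare, because the tail moves along it and nothing hangs at the new head. On a
first trail head and tail both get one level deeper, which preserves the strict inequality; when the
tail turns off the path, `isAnc_head_of_off_path` shows the trail to be bare. -/
theorem trail_down (hG : G.IsTree) (hL : ∀ x y, G.dist x y ≤ G.dist r g) {top h t u w : V}
    (hO : IsTop G r O top) (ht : t ∈ O) (hh : h ∈ O) (hth : t ≠ h) (hu : IsLeafAt G O t u)
    (hw : w ≠ r) (hwh : parent G r w = h) (hwO : ∀ x ∈ O, ¬ IsAnc G r w x)
    (htrail : IsBareTrail G r O h t ∨ IsFirstTrail G r g O h t) :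
    IsBareTrail G r (insert w O \ {t}) w u ∨ IsFirstTrail G r g (insert w O \ {t}) w u := by
  have hhw : IsAnc G r h w := hwh ▸ IsAnc.parent_left w
  have hdw := dist_parent hG hw
  rw [hwh] at hdw
  have hred : ∀ x ∈ insert w O \ {t}, ¬ IsAnc G r x w → x ∈ O ∧ ¬ IsAnc G r x h ∧
      ∀ c, IsAnc G r c x → IsAnc G r c w → IsAnc G r c h := by
    rintro x ⟨rfl | hx, hxt⟩ hxw
    · exact absurd (IsAnc.refl _) hxw
    · refine ⟨hx, fun h' => hxw (h'.trans hhw), fun c hcx hcw => ?_⟩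
      rw [← hwh]
      refine hcw.parent_right ?_
      rintro rfl
      exact hwO x hx hcx
  rcases htrail with hN | hI
  · left
    intro x hx hxw c hcx hcw
    obtain ⟨h1, h2, h3⟩ := hred x hx hxw
    have hch := h3 c hcx hcw
    have hct := hN x h1 h2 c hcx hch
    by_cases hanc : IsAnc G r t h
    · obtain ⟨-, hut, -, -⟩ := hu.of_isAnc hG hO ht hh hth hanc
      exact hct.trans (hut ▸ IsAnc.parent_left u)
    · obtain ⟨-, rfl, -⟩ := hu.of_not_isAnc hG hO ht hh hanc
      refine hct.parent_right ?_
      rintro rfl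
      exact hanc hch
  · have hanc := hI.2.1 h hh
    obtain ⟨hur, hut, huh, -⟩ := hu.of_isAnc hG hO ht hh hth hanc
    have hdu := dist_parent hG hur
    rw [hut] at hdu
    have hux : ∀ x ∈ O, x ≠ t → IsAnc G r u x := by
      intro x hx hxt
      obtain ⟨c, hcr, hct, hcx⟩ := (hI.2.1 x hx).exists_child (Ne.symm hxt)
      have hc : c ∈ O := hO.mem_of_isAnc hG hx
        ((hO.isAnc hG ht).trans (hct ▸ IsAnc.parent_left c)) hcx
      rw [← hu.2.2 c hc (hct ▸ (adj_parent hG hcr).symm)]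
      exact hcx
    by_cases hug : IsAnc G r u g
    · right
      refine ⟨hug, ?_, ?_⟩
      · rintro x ⟨rfl | hx, hxt⟩
        · exact huh.trans hhw
        · exact hux x hx hxt
      · intro x hx hxw c hcx hcw
        obtain ⟨h1, h2, h3⟩ := hred x hx hxw
        have := hI.2.2 x h1 h2 c hcx (h3 c hcx hcw)
        omega
    · left
      intro x hx hxw
      obtain ⟨h1, h2, -⟩ := hred x hx hxw
      exact absurd (isAnc_head_of_off_path hG hL (Or.inr hI) hur hut huh hug hw hwh h1
        (hux x h1 hx.2)) h2

/-- Only a branch that the tail has just entered is new, so `v` is the child `u` of the vacated `t`.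
By `isAnc_head_of_off_path` the agents then form a chain between `v` and `w`, and `k` vertices at
different depths make `v` deep. -/
theorem onlyInDeep_down [Finite V] (hG : G.IsTree) (hL : ∀ x y, G.dist x y ≤ G.dist r g)
    {top h t u w : V} (hO : IsTop G r O top) (ht : t ∈ O) (hh : h ∈ O) (hth : t ≠ h)
    (hu : IsLeafAt G O t u) (hw : w ≠ r) (hwh : parent G r w = h)
    (hwO : ∀ x ∈ O, ¬ IsAnc G r w x) (hcard : (insert w O \ {t}).ncard = k)
    (htrail : IsBareTrail G r O h t ∨ IsFirstTrail G r g O h t) (hdeep : OnlyInDeep G r g k O) :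
    OnlyInDeep G r g k (insert w O \ {t}) := by
  intro v hvg hv
  by_cases hvt : IsAnc G r v t
  · refine hdeep v hvg fun x hx => ?_
    by_cases hxt : x = t
    · rwa [hxt]
    · exact hv x ⟨Or.inr hx, hxt⟩
  have hwt : w ≠ t := by rintro rfl; exact hwO w ht (IsAnc.refl w)
  have hvw := hv w ⟨Or.inl rfl, hwt⟩
  have hvu := hv u ⟨Or.inr hu.1, fun h => hu.2.1.ne (Eq.symm h)⟩
  have hvw' : v ≠ w := by rintro rfl; exact hwO u hu.1 hvu
  have hvh : IsAnc G r v h := hwh ▸ hvw.parent_right hvw'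
  by_cases hanc : IsAnc G r t h
  · obtain ⟨hur, hut, huh, -⟩ := hu.of_isAnc hG hO ht hh hth hanc
    have hvu' : v = u := by
      by_contra hne
      exact hvt (hut ▸ hvu.parent_right hne)
    subst hvu'
    have hchain : ∀ x ∈ insert w O \ {t}, IsAnc G r x w := by
      intro x hx
      rcases hx.1 with rfl | hxO
      · exact IsAnc.refl _
      · exact (isAnc_head_of_off_path hG hL htrail hur hut huh hvg hw hwh hxO (hv x hx)).trans
          (hwh ▸ IsAnc.parent_left w)
    have hle : (insert w O \ {t}).ncard ≤ (Finset.Icc (G.dist r v) (G.dist r w)).card := by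
      rw [← Set.ncard_coe_finset]
      refine Set.ncard_le_ncard_of_injOn (G.dist r) (fun x hx => ?_) (fun x hx y hy hxy => ?_)
        (Finset.finite_toSet _)
      · exact Finset.mem_coe.2 (Finset.mem_Icc.2
          ⟨(hv x hx).dist_add hG, (hchain x hx).dist_add hG⟩)
      · exact (hchain x hx).eq_of_dist_eq hG (hchain y hy) hxy
    rw [hcard, Nat.card_Icc] at hle
    exact ⟨w, hvw, by have := hvw.dist_add hG; omega⟩
  · obtain ⟨-, rfl, -⟩ := hu.of_not_isAnc hG hO ht hh hanc
    exact absurd (hvu.trans (IsAnc.parent_left t)) hvt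

end Occupied

/-! ### The choice of the tail, and the costs of the choices -/

section Choice

variable {V : Type} {G : SimpleGraph V} {S : Prep V} {A : AdjLists V} {k : ℕ}

/-- The set of the occupied vertices. -/
def occupied (occ : V → Option ℕ) : Set V := {v | (occ v).isSome = true}

theorem isLeafT_val (hA : A.Represents G) (occ : V → Option ℕ) (v : V) :
    (isLeafT A occ v).val = true ↔ ∃ u, IsLeafAt G (occupied occ) v u := by
  unfold isLeafT
  rw [val_bind, val_pure, countT_val, decide_eq_true_iff]
  have hmem : ∀ x, x ∈ (A.nbrs v).filter (fun w => (occ w).isSome) ↔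
      G.Adj v x ∧ x ∈ occupied occ := by
    intro x
    rw [List.mem_filter, hA.mem_nbrs]
    rfl
  constructor
  · intro h
    obtain ⟨u, hu⟩ := List.length_eq_one_iff.1 h
    have h1 := (hmem u).1 (by rw [hu]; simp)
    refine ⟨u, h1.2, h1.1, fun x hx hvx => ?_⟩
    have := (hmem x).2 ⟨hvx, hx⟩
    rw [hu] at this
    simpa using this
  · rintro ⟨u, hu, hvu, huniq⟩
    refine le_antisymm ?_ (List.length_pos_of_mem ((hmem u).2 ⟨hvu, hu⟩))
    have h1 : (A.nbrs v).filter (fun w => (occ w).isSome) ⊆ [u] := fun x hx => by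
      simp [huniq x ((hmem x).1 hx).2 ((hmem x).1 hx).1]
    exact (((hA.nbrs_nodup v).filter _).subperm h1).length_le

theorem isLeafT_cost_le {m : ℕ} (hm : ∀ v, (A.nbrs v).length ≤ m) (occ : V → Option ℕ) (v : V) :
    (isLeafT A occ v).cost ≤ m + 1 := by
  unfold isLeafT
  rw [cost_bind, cost_pure, countT_cost]
  have := hm v
  omega

/-- The last explored vertex of the first list, or of the second one if the first is empty. -/
def pickTail (stamp : V → ℕ) (t : V) (l₂ l₁ : List V) : Timed V :=
  match l₂, l₁ with
  | y :: ys, _ => argMaxT stamp y ys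
  | [], y :: ys => argMaxT stamp y ys
  | [], [] => pure t

variable [DecidableEq V]

theorem chooseTail_of_leaf (hA : A.Represents G) (s : State V k) {h t : V}
    (ht : ∃ u, IsLeafAt G (occupied s.occ) t u) : (chooseTail A S s h t).val = t := by
  unfold chooseTail
  rw [val_bind, if_pos ((isLeafT_val hA s.occ t).2 ht), val_pure]

/-- The tail that replaces a tail which is not a leaf. -/
theorem chooseTail_of_not_leaf (hA : A.Represents G) {s : State V k}
    (hs : IsPlacement k s.pos s.occ) {h t : V} (hh : h ∈ occupied s.occ)
    (ht : ¬ ∃ u, IsLeafAt G (occupied s.occ) t u) :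
    ((∀ y ∈ occupied s.occ, y ≠ h → ¬ ∃ u, IsLeafAt G (occupied s.occ) y u) ∧
      (chooseTail A S s h t).val = t) ∨
    ∃ n ∈ occupied s.occ, (∀ x ∈ occupied s.occ, S.distP n ≤ S.distP x) ∧
      (chooseTail A S s h t).val ∈ occupied s.occ ∧ (chooseTail A S s h t).val ≠ h ∧
      (∃ u, IsLeafAt G (occupied s.occ) (chooseTail A S s h t).val u) ∧
      ∀ y ∈ occupied s.occ, y ≠ h → y ≠ n → (∃ u, IsLeafAt G (occupied s.occ) y u) →
        s.stamp y ≤ s.stamp (chooseTail A S s h t).val := by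
  set n := (argMinT S.distP h ((List.range k).map s.pos)).val with hn
  set l₁ := (((List.range k).map s.pos).filter fun v => (isLeafT A s.occ v).val).filter
    fun v => decide (v ≠ h) with hl₁
  set l₂ := l₁.filter fun v => decide (v ≠ n) with hl₂
  have hval : (chooseTail A S s h t).val = (pickTail s.stamp t l₂ l₁).val := by
    unfold chooseTail
    rw [val_bind, if_neg (fun h' => ht ((isLeafT_val hA s.occ t).1 h'))]
    simp only [val_bind, filterT_val]
    rfl
  have hocc : ∀ v, v ∈ (List.range k).map s.pos ↔ v ∈ occupied s.occ := by
    intro v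
    rw [List.mem_map]
    simp only [List.mem_range]
    exact hs.isSome_iff.symm
  have hm₁ : ∀ v, v ∈ l₁ ↔ v ∈ occupied s.occ ∧ v ≠ h ∧
      ∃ u, IsLeafAt G (occupied s.occ) v u := by
    intro v
    rw [hl₁, List.mem_filter, List.mem_filter, hocc, isLeafT_val hA, decide_eq_true_iff]
    tauto
  have hm₂ : ∀ v, v ∈ l₂ ↔ v ∈ l₁ ∧ v ≠ n := by
    intro v
    rw [hl₂, List.mem_filter, decide_eq_true_iff]
  obtain ⟨hn1, hn2⟩ := argMinT_spec S.distP h ((List.range k).map s.pos)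
  rw [← hn] at hn1 hn2
  have hnO : n ∈ occupied s.occ := by
    rcases List.mem_cons.1 hn1 with h1 | h1
    · rw [h1]; exact hh
    · exact (hocc n).1 h1
  have hnmin : ∀ x ∈ occupied s.occ, S.distP n ≤ S.distP x := fun x hx =>
    hn2 x (List.mem_cons_of_mem _ ((hocc x).2 hx))
  cases h₂ : l₂ with
  | cons y ys =>
    right
    rw [h₂] at hval
    change (chooseTail A S s h t).val = (argMaxT s.stamp y ys).val at hval
    obtain ⟨h1, h2⟩ := argMaxT_spec s.stamp y ys
    rw [← hval, ← h₂] at h1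
    rw [← hval, ← h₂] at h2
    obtain ⟨h3, h4, h5⟩ := (hm₁ _).1 ((hm₂ _).1 h1).1
    exact ⟨n, hnO, hnmin, h3, h4, h5, fun y hy hyh hyn hyl =>
      h2 y ((hm₂ y).2 ⟨(hm₁ y).2 ⟨hy, hyh, hyl⟩, hyn⟩)⟩
  | nil =>
    have hnone : ∀ y ∈ l₁, y = n := by
      intro y hy
      by_contra hyn
      have := (hm₂ y).2 ⟨hy, hyn⟩
      rw [h₂] at this
      simp at this
    cases h₁ : l₁ with
    | cons y ys =>
      right
      rw [h₂, h₁] at hval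
      change (chooseTail A S s h t).val = (argMaxT s.stamp y ys).val at hval
      obtain ⟨h1, h2⟩ := argMaxT_spec s.stamp y ys
      rw [← hval, ← h₁] at h1
      obtain ⟨h3, h4, h5⟩ := (hm₁ _).1 h1
      exact ⟨n, hnO, hnmin, h3, h4, h5, fun y hy hyh hyn hyl =>
        absurd (hnone y ((hm₁ y).2 ⟨hy, hyh, hyl⟩)) hyn⟩
    | nil =>
      left
      rw [h₂, h₁] at hval
      refine ⟨fun y hy hyh hyl => ?_, hval⟩
      have := (hm₁ y).2 ⟨hy, hyh, hyl⟩
      rw [h₁] at this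
      simp at this

theorem chooseTail_cost_le {m : ℕ} (hm : ∀ v, (A.nbrs v).length ≤ m) (s : State V k) (h t : V) :
    (chooseTail A S s h t).cost ≤ (m + 1) + (k + (k + 1) + (k * (m + 2) + 1) + (k + 1) + (k + 1) +
      (k + 1)) := by
  unfold chooseTail
  rw [cost_bind]
  have h0 := isLeafT_cost_le hm s.occ t
  split_ifs
  · rw [cost_pure]; omega
  · simp only [cost_bind, cost_charge, argMinT_cost, List.length_map, List.length_range]
    have h1 := filterT_cost_le (isLeafT A s.occ) ((List.range k).map s.pos) fun x =>
      isLeafT_cost_le hm s.occ x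
    have hlen1 : (filterT (isLeafT A s.occ) ((List.range k).map s.pos)).val.length ≤ k := by
      rw [filterT_val]
      exact (List.length_filter_le _ _).trans (by simp)
    rw [List.length_map, List.length_range, show m + 1 + 1 = m + 2 from rfl] at h1
    set L := (filterT (isLeafT A s.occ) ((List.range k).map s.pos)).val with hL
    have h2 := filterT_cost_le (fun v => (pure (decide (v ≠ h)) : Timed Bool)) L (c := 0)
      fun x => le_rfl
    have hlen2 : (filterT (fun v => (pure (decide (v ≠ h)) : Timed Bool)) L).val.length ≤ k := by
      rw [filterT_val]
      exact (List.length_filter_le _ _).trans hlen1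
    set L1 := (filterT (fun v => (pure (decide (v ≠ h)) : Timed Bool)) L).val with hL1
    set n := (argMinT S.distP h ((List.range k).map s.pos)).val with hn
    have h3 := filterT_cost_le (fun v => (pure (decide (v ≠ n)) : Timed Bool)) L1 (c := 0)
      fun x => le_rfl
    have hlen3 : (filterT (fun v => (pure (decide (v ≠ n)) : Timed Bool)) L1).val.length ≤ k := by
      rw [filterT_val]
      exact (List.length_filter_le _ _).trans hlen2
    set L2 := (filterT (fun v => (pure (decide (v ≠ n)) : Timed Bool)) L1).val with hL2
    have h4 : (pickTail s.stamp t L2 L1).cost ≤ k + 1 := by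
      cases hc2 : L2 with
      | cons y ys =>
        rw [hc2, List.length_cons] at hlen3
        change (argMaxT s.stamp y ys).cost ≤ _
        rw [argMaxT_cost]; omega
      | nil =>
        cases hc1 : L1 with
        | cons y ys =>
          rw [hc1, List.length_cons] at hlen2
          change (argMaxT s.stamp y ys).cost ≤ _
          rw [argMaxT_cost]; omega
        | nil => exact Nat.zero_le _
    change _ + (_ + (_ + (_ + (_ + (_ + (pickTail s.stamp t L2 L1).cost))))) ≤ _
    omega

theorem chooseHead_cost_le {m : ℕ} (hm : ∀ v, (A.nbrs v).length ≤ m) (s : State V k) :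
    (chooseHead A S s).cost ≤
      1 + 4 * (m + 1) + (k * (m + 2) + 1) + (k * (m + 2) + 1) + (k + 1) := by
  unfold chooseHead
  rw [cost_bind, cost_tick, cost_bind]
  have h0 := nextUnexplored_cost_le (S := S) s.explored (A.nbrs s.head)
  have h0' := hm s.head
  cases (nextUnexplored S s.explored (A.nbrs s.head)).val with
  | some w => simp only [cost_pure]; omega
  | none =>
    have h1 := search_cost_le A (fun v => (s.occ v).isSome) hm k [⟨s.head, none, 0⟩] []
    have h2 := search_length_le A (fun v => (s.occ v).isSome) k [⟨s.head, none, 0⟩] []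
    simp only [cost_bind]
    set l := (search A (fun v => (s.occ v).isSome) k [⟨s.head, none, 0⟩] []).val with hl
    simp only [List.length_nil, add_zero] at h2
    have h3 := filterT_cost_le (fun y : Visit V => (do
      let z ← findT (fun w => !s.explored w) (A.nbrs y.vertex)
      pure z.isSome : Timed Bool)) l (c := m + 1) (fun y => by
        rw [cost_bind, cost_pure]
        have h4 := findT_cost_le (fun w => !s.explored w) (A.nbrs y.vertex)
        have h5 := hm y.vertex
        omega)
    have h4 : (filterT (fun y : Visit V => (do
      let z ← findT (fun w => !s.explored w) (A.nbrs y.vertex)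
      pure z.isSome : Timed Bool)) l).val.length ≤ l.length := by
      rw [filterT_val]
      exact List.length_filter_le _ _
    have h5 : l.length * (m + 1 + 1) ≤ k * (m + 2) := Nat.mul_le_mul_right _ h2
    cases hc : (filterT (fun y : Visit V => (do
      let z ← findT (fun w => !s.explored w) (A.nbrs y.vertex)
      pure z.isSome : Timed Bool)) l).val with
    | cons y ys =>
      rw [hc, List.length_cons] at h4
      simp only [cost_bind, cost_pure, argMinT_cost]
      have h6 := nextUnexplored_cost_le (S := S) s.explored
        (A.nbrs (argMinT Visit.depth y ys).val.vertex)
      have h7 := hm (argMinT Visit.depth y ys).val.vertex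
      omega
    | nil =>
      simp only [cost_bind, cost_pure, argMinT_cost]
      omega

end Choice

/-! ### The invariant of the transition phase, and the choices made under it -/

section Transition

variable {V : Type} {G : SimpleGraph V} {S : Prep V} {k : ℕ}

/-- The invariant of the transition phase. -/
structure IsWalkState (G : SimpleGraph V) (S : Prep V) (s : State V k) : Prop where
  search : IsSearchState G S s.explored s.parent s.stamp s.clock s.head
  placement : IsPlacement k s.pos s.occ
  explored : ∀ v ∈ occupied s.occ, s.explored v = true
  top : ∃ t, IsTop G S.start (occupied s.occ) t
  head_mem : s.head ∈ occupied s.occ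
  tail_mem : s.tail ∈ occupied s.occ
  tail_ne : 2 ≤ k → s.tail ≠ s.head
  trail : IsBareTrail G S.start (occupied s.occ) s.head s.tail ∨
    IsFirstTrail G S.start S.goal (occupied s.occ) s.head s.tail
  deep : OnlyInDeep G S.start S.goal k (occupied s.occ)
  walk_head : ∃ W, s.walk = (fun i : Fin k => s.pos i) :: W
  config : ∀ c ∈ s.walk, IsConfiguration G c
  chain : s.walk.IsChain fun c c' => IsTransition G 1 c' c
  spanning : ∀ v, s.explored v = true → ∃ c ∈ s.walk, v ∈ Set.range c

theorem IsPlacement.range_eq {pos : ℕ → V} {occ : V → Option ℕ} (h : IsPlacement k pos occ) :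
    (Set.range fun i : Fin k => pos i) = occupied occ := by
  ext v
  constructor
  · rintro ⟨i, rfl⟩
    exact h.isSome_pos i.2
  · intro hv
    obtain ⟨i, hi, rfl⟩ := h.isSome_iff.1 hv
    exact ⟨⟨i, hi⟩, rfl⟩

theorem IsPlacement.isConfiguration (hG : G.IsTree) {pos : ℕ → V} {occ : V → Option ℕ} {r t : V}
    (h : IsPlacement k pos occ) (ht : IsTop G r (occupied occ) t) :
    IsConfiguration G fun i : Fin k => pos i := by
  refine ⟨fun i j hij => Fin.ext (h.inj i.2 j.2 hij), ?_⟩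
  rw [h.range_eq]
  exact ht.connected hG

/-- The occupied set is closed under steps towards one of its members. -/
theorem IsTop.parent_mem (hG : G.IsTree) {O : Set V} {r t q v : V} (hO : IsTop G r O t)
    (hq : q ∈ O) (hv : v ∈ O) : parent G q v ∈ O := by
  by_cases hvq : v = q
  · rw [hvq, parent_root]; exact hq
  · exact (mem_of_connected (r := q) hG (hO.connected hG) hv hq (IsAnc.refl v)
      fun h => hvq (h.antisymm hG (IsAnc.root hG v))).2.1

namespace IsWalkState

variable {s : State V k}

theorem goal_unexplored (h : IsWalkState G S s) (hg : s.head ≠ S.goal) :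
    s.explored S.goal = false := by
  by_contra h'
  rw [Bool.not_eq_false] at h'
  exact hg (h.search.goal h')

/-- An occupied vertex nearest to the path lies above the head; it is the top if the path is not
occupied. -/
theorem nearest [Finite V] (hG : G.IsTree) (hS : IsPrep G S) (h : IsWalkState G S s)
    (hg : s.head ≠ S.goal) {n : V} (hn : n ∈ occupied s.occ)
    (hmin : ∀ x ∈ occupied s.occ, S.distP n ≤ S.distP x) :
    IsAnc G S.start n s.head ∧ ((∀ x ∈ occupied s.occ, ¬ IsAnc G S.start x S.goal) →
      IsTop G S.start (occupied s.occ) n) := by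
  obtain ⟨t, ht⟩ := h.top
  have htop : (∀ x ∈ occupied s.occ, ¬ IsAnc G S.start x S.goal) → n = t := by
    intro hoff
    by_contra hnt
    have h1 := hS.dist_off n (hoff n hn)
    have h2 := hmin _ (ht.2 n hn hnt).2
    omega
  refine ⟨?_, fun hoff => htop hoff ▸ ht⟩
  by_cases hoff : ∀ x ∈ occupied s.occ, ¬ IsAnc G S.start x S.goal
  · rw [htop hoff]
    exact ht.isAnc hG h.head_mem
  · push Not at hoff
    obtain ⟨x, hx, hxg⟩ := hoff
    have hng : IsAnc G S.start n S.goal := by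
      by_contra hng
      have h1 := hS.dist_off n hng
      have h2 := hmin x hx
      rw [hS.dist_on x hxg] at h2
      omega
    -- All explored vertices of the path lie above the last one, which lies above the head.
    obtain ⟨y, w, -, -, hyh, hall, -⟩ := h.search.exists_last_on_path hG (h.goal_unexplored hg)
    exact (hall n hng (h.explored n hn)).trans hyh

/-- If no occupied vertex is open then the path is not occupied. -/
theorem off_path [Finite V] (hG : G.IsTree) (h : IsWalkState G S s) (hg : s.head ≠ S.goal)
    (hno : ∀ v ∈ occupied s.occ, ∀ w, G.Adj v w → s.explored w = true) :
    ∀ x ∈ occupied s.occ, ¬ IsAnc G S.start x S.goal := by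
  intro x hx hxg
  obtain ⟨t, ht⟩ := h.top
  obtain ⟨y, w, hyg, hye, hyh, hall, hyw, hw⟩ :=
    h.search.exists_last_on_path hG (h.goal_unexplored hg)
  have hy : y ∈ occupied s.occ := ht.mem_of_isAnc hG h.head_mem
    ((ht.isAnc hG hx).trans (hall x hxg (h.explored x hx))) hyh
  rw [hno y hy w hyw] at hw
  simp at hw

/-- The choice of the head and the target, when a new vertex is explored. -/
def IsDownChoice (G : SimpleGraph V) (S : Prep V) (s : State V k) (h t w : V) : Prop :=
  h ∈ occupied s.occ ∧ IsAnc G S.start h s.head ∧ G.Adj h w ∧ s.explored w = false ∧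
    (S.onPath w = true → ∀ x, G.Adj h x → s.explored x = false → S.onPath x = true) ∧
    (∀ v x, s.explored v = true → G.Adj v x → s.explored x = false → IsAnc G S.start v h) ∧
    ((h = s.head ∧ t = s.tail) ∨ (h ≠ s.head ∧ t = s.head))

/-- The choice of the head and the target, when all neighbours of occupied vertices are explored. -/
def IsUpChoice (G : SimpleGraph V) (S : Prep V) (s : State V k) (h t w : V) : Prop :=
  IsTop G S.start (occupied s.occ) h ∧ ¬ IsAnc G S.start h S.goal ∧ w = parent G S.start h ∧
    (∀ v x, s.explored v = true → G.Adj v x → s.explored x = false → IsAnc G S.start v w) ∧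
    ((h = s.head ∧ t = s.tail) ∨ (h ≠ s.head ∧ t = s.head))

/-- Vertices with unexplored neighbours form a chain above the head. The occupied one nearest to the
head is thus the lowest of them, and a search can continue from there. If none is occupied, the path
is not occupied either, the occupied vertex nearest to it is the top, and the whole chain lies
strictly above that. -/
theorem chooseHead_spec [Finite V] [DecidableEq V] (hG : G.IsTree) (hS : IsPrep G S)
    {A : AdjLists V} (hA : A.Represents G) (h : IsWalkState G S s) (hg : s.head ≠ S.goal) :
    IsDownChoice G S s (chooseHead A S s).val.1 (chooseHead A S s).val.2.1
      (chooseHead A S s).val.2.2 ∨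
    IsUpChoice G S s (chooseHead A S s).val.1 (chooseHead A S s).val.2.1
      (chooseHead A S s).val.2.2 := by
  obtain ⟨t, ht⟩ := h.top
  cases hx : (nextUnexplored S s.explored (A.nbrs s.head)).val with
  | some w =>
    have hval : (chooseHead A S s).val = (s.head, s.tail, w) := by
      unfold chooseHead
      simp only [val_bind, hx]
      rfl
    rw [hval]
    obtain ⟨h1, h2, h3⟩ := nextUnexplored_some hx
    exact Or.inl ⟨h.head_mem, IsAnc.refl _, (hA.mem_nbrs _ _).1 h1, h2,
      fun hw x hx => h3 hw x ((hA.mem_nbrs _ _).2 hx), h.search.open_anc, Or.inl ⟨rfl, rfl⟩⟩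
  | none =>
    obtain ⟨hl, hlm⟩ := search_from hG hA (active := fun v => (s.occ v).isSome) (q := s.head)
      (m := k) h.head_mem (fun v hv => ht.parent_mem hG h.head_mem hv) h.placement.ncard.le
    set l := (RHWP.search A (fun v => (s.occ v).isSome) k [⟨s.head, none, 0⟩] []).val with hldef
    set p : Visit V → Bool := fun y =>
      ((A.nbrs y.vertex).find? fun w => !s.explored w).isSome with hp
    have hpe : ∀ y, p y = true ↔ ∃ w, G.Adj y.vertex w ∧ s.explored w = false := by
      intro y
      rw [hp, List.find?_isSome]
      simp only [hA.mem_nbrs, Bool.not_eq_true']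
    have hheadc : ∀ w, G.Adj s.head w → s.explored w = true := fun w hw =>
      nextUnexplored_none hx ((hA.mem_nbrs _ _).2 hw)
    cases hc : l.filter p with
    | cons y ys =>
      set e := (argMinT Visit.depth y ys).val with he
      obtain ⟨h1, h2⟩ := argMinT_spec Visit.depth y ys
      rw [← he, ← hc, List.mem_filter, hpe] at h1
      rw [← he, ← hc] at h2
      obtain ⟨hel, w₀, hw₀, hw₀e⟩ := h1
      obtain ⟨heO, -, hed⟩ := hl.labels e hel
      have hee : s.explored e.vertex = true := h.explored _ heO
      have hval : (chooseHead A S s).val = (e.vertex, s.head,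
          (nextUnexplored S s.explored (A.nbrs e.vertex)).val.getD e.vertex) := by
        unfold chooseHead
        simp only [val_bind, hx, filterT_val, findT_val, val_pure]
        change (match l.filter p with
          | y :: ys => _
          | [] => _ : Timed (V × V × V)).val = _
        rw [hc]
        rfl
      rw [hval]
      left
      cases hz : (nextUnexplored S s.explored (A.nbrs e.vertex)).val with
      | none =>
        have := nextUnexplored_none hz ((hA.mem_nbrs _ _).2 hw₀)
        rw [hw₀e] at this
        simp at this
      | some w =>
        obtain ⟨h3, h4, h5⟩ := nextUnexplored_some hz
        have heh : IsAnc G S.start e.vertex s.head := h.search.open_anc _ _ hee hw₀ hw₀e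
        refine ⟨heO, heh, (hA.mem_nbrs _ _).1 h3, h4,
          fun hw x hx => h5 hw x ((hA.mem_nbrs _ _).2 hx), fun v x hv hvx hxe => ?_, Or.inr ⟨?_,
            rfl⟩⟩
        · have hvh := h.search.open_anc v x hv hvx hxe
          rcases hvh.total heh with h6 | h6
          · exact h6
          · have hvO : v ∈ occupied s.occ :=
              ht.mem_of_isAnc hG h.head_mem ((ht.isAnc hG heO).trans h6) hvh
            obtain ⟨e', he', hev⟩ := List.mem_map.1 (hlm v hvO)
            have h7 := h2 e' (List.mem_filter.2 ⟨he', (hpe e').2 ⟨x, by rw [hev]; exact hvx, hxe⟩⟩)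
            rw [hed, (hl.labels e' he').2.2, hev] at h7
            have h8 := dist_of_isAnc hG hvh
            have h9 := dist_of_isAnc hG heh
            rw [SimpleGraph.dist_comm, SimpleGraph.dist_comm (v := v)] at h7
            rw [h6.eq_of_dist_le hG (by omega)]
            exact IsAnc.refl _
        · intro h6
          change e.vertex = s.head at h6
          rw [h6] at hw₀
          rw [hheadc w₀ hw₀] at hw₀e
          simp at hw₀e
    | nil =>
      have hno : ∀ v ∈ occupied s.occ, ∀ w, G.Adj v w → s.explored w = true := by
        intro v hv w hvw
        by_contra hw
        rw [Bool.not_eq_true] at hw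
        obtain ⟨e, he, rfl⟩ := List.mem_map.1 (hlm v hv)
        have := List.mem_filter.2 ⟨he, (hpe e).2 ⟨w, hvw, hw⟩⟩
        rw [hc] at this
        simp at this
      set e := (argMinT (fun y : Visit V => S.distP y.vertex) ⟨s.head, none, 0⟩ l).val with he
      obtain ⟨h1, h2⟩ := argMinT_spec (fun y : Visit V => S.distP y.vertex) ⟨s.head, none, 0⟩ l
      rw [← he] at h1 h2
      have heO : e.vertex ∈ occupied s.occ := by
        rcases List.mem_cons.1 h1 with h3 | h3
        · rw [h3]; exact h.head_mem
        · exact (hl.labels e h3).1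
      have hmin : ∀ x ∈ occupied s.occ, S.distP e.vertex ≤ S.distP x := by
        intro x hx
        obtain ⟨e', he', rfl⟩ := List.mem_map.1 (hlm x hx)
        exact h2 e' (List.mem_cons_of_mem _ he')
      have hoff := h.off_path hG hg hno
      have htop := (h.nearest hG hS hg heO hmin).2 hoff
      have her : e.vertex ≠ S.start := by
        intro h3
        exact hoff _ heO (h3 ▸ IsAnc.root hG S.goal)
      have hval : (chooseHead A S s).val = (e.vertex,
        (if e.vertex = s.head then s.tail else s.head),
          (s.parent e.vertex).getD e.vertex) := by
        unfold chooseHead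
        simp only [val_bind, hx, filterT_val, findT_val, val_pure]
        change (match l.filter p with
          | y :: ys => _
          | [] => _ : Timed (V × V × V)).val = _
        rw [hc]
        rfl
      rw [hval]
      right
      refine ⟨htop, hoff _ heO, ?_, fun v x hv hvx hxe => ?_, ?_⟩
      · change (s.parent e.vertex).getD e.vertex = _
        rw [h.search.par_eq _ (h.explored _ heO) her]
        rfl
      · change IsAnc G S.start v ((s.parent e.vertex).getD e.vertex)
        rw [h.search.par_eq _ (h.explored _ heO) her]
        change IsAnc G S.start v (parent G S.start e.vertex)
        have hvh := h.search.open_anc v x hv hvx hxe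
        have hvO : v ∉ occupied s.occ := fun hvO => by
          rw [hno v hvO x hvx] at hxe
          simp at hxe
        rcases hvh.total (htop.isAnc hG h.head_mem) with h6 | h6
        · refine h6.parent_right ?_
          intro h7
          exact hvO (h7 ▸ heO)
        · exact absurd (htop.mem_of_isAnc hG h.head_mem h6 hvh) hvO
      · dsimp only
        split_ifs with h3
        · exact Or.inl ⟨h3, rfl⟩
        · exact Or.inr ⟨h3, rfl⟩

/-- The tail that is chosen together with the head. -/
theorem chooseTail_spec [Finite V] [DecidableEq V] (hG : G.IsTree) (hS : IsPrep G S)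
    {A : AdjLists V} (hA : A.Represents G) (hs : IsWalkState G S s) (hg : s.head ≠ S.goal)
    {h t₀ w : V} (hc : IsDownChoice G S s h t₀ w ∨ IsUpChoice G S s h t₀ w) :
    (chooseTail A S s h t₀).val ∈ occupied s.occ ∧ (2 ≤ k →
      (chooseTail A S s h t₀).val ≠ h ∧
      (∃ u, IsLeafAt G (occupied s.occ) (chooseTail A S s h t₀).val u) ∧
      (IsBareTrail G S.start (occupied s.occ) h (chooseTail A S s h t₀).val ∨
        IsFirstTrail G S.start S.goal (occupied s.occ) h (chooseTail A S s h t₀).val)) := by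
  obtain ⟨top, htop⟩ := hs.top
  have hh : h ∈ occupied s.occ := by
    rcases hc with hc | hc
    · exact hc.1
    · exact hc.1.1
  have hcase : (h = s.head ∧ t₀ = s.tail) ∨ (h ≠ s.head ∧ t₀ = s.head) := by
    rcases hc with hc | hc
    · exact hc.2.2.2.2.2.2
    · exact hc.2.2.2.2
  have ht₀ : t₀ ∈ occupied s.occ := by
    rcases hcase with ⟨-, h1⟩ | ⟨-, h1⟩
    · rw [h1]; exact hs.tail_mem
    · rw [h1]; exact hs.head_mem
  have hne : 2 ≤ k → t₀ ≠ h := by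
    intro hk
    rcases hcase with ⟨h1, h2⟩ | ⟨h1, h2⟩
    · rw [h1, h2]; exact hs.tail_ne hk
    · rw [h2]; exact h1.symm
  have hhh : IsAnc G S.start h s.head := by
    rcases hc with hc | hc
    · exact hc.2.1
    · exact hc.1.isAnc hG hs.head_mem
  by_cases hleaf : ∃ u, IsLeafAt G (occupied s.occ) t₀ u
  · rw [chooseTail_of_leaf hA s hleaf]
    refine ⟨ht₀, fun hk => ⟨hne hk, hleaf, ?_⟩⟩
    rcases hcase with ⟨h1, h2⟩ | ⟨h1, h2⟩
    · rw [h1, h2]; exact hs.trail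
    -- The old head has become the tail, so every vertex above the new head is above the tail.
    · left
      intro x hx hxh c hcx hch
      rw [h2]
      exact hch.trans hhh
  · rcases chooseTail_of_not_leaf (S := S) hA hs.placement hh hleaf with ⟨h1, h2⟩ |
      ⟨n, hn, hmin, h1, h2, h3, h4⟩
    · refine ⟨by rw [h2]; exact ht₀, fun hk => ?_⟩
      obtain ⟨y, hy, hyh, hyl⟩ :=
        htop.exists_leaf_ne hG hh (by rw [occupied, hs.placement.ncard]; exact hk)
      exact absurd hyl (h1 y hy hyh)
    · refine ⟨h1, fun hk => ⟨h2, h3, Or.inl ?_⟩⟩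
      intro x hx hxh c hcx hch
      rcases hc with hc | hc
      -- If the chosen tail were not below `c`, a leaf below `x` would be in the newer branch at
      -- `c`, hence explored later, and would have been preferred.
      · by_contra hct
        obtain ⟨y, hy, hxy, hyh, hyl⟩ := htop.exists_leaf_below hG hh hx hxh
        -- The excluded vertex nearest to the path lies above the old head. As a leaf different from
        -- the old head it would be the top, hence above the new head as well.
        have hyn : y ≠ n := by
          rintro rfl
          have hyhead := (hs.nearest hG hS hg hn hmin).1
          rcases hcase with ⟨h5, -⟩ | ⟨h5, h6⟩
          · rw [h5] at hyh
            exact hyh hyhead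
          · have hyne : y ≠ s.head := by
              rintro rfl
              exact hleaf (h6 ▸ hyl)
            obtain ⟨u, hu⟩ := hyl
            obtain ⟨-, -, -, h7⟩ := hu.of_isAnc hG htop hy hs.head_mem hyne hyhead
            exact hyh (h7 ▸ htop.isAnc hG hh)
        have h5 := h4 y hy (by rintro rfl; exact hyh (IsAnc.refl _)) hyn hyl
        have h6 := hs.search.stamp_mono _ y c (hs.explored _ h1) (hs.explored y hy)
          (hch.trans hhh) (hcx.trans hxy) hct
        omega
      · exact hch.trans (hc.1.isAnc hG h1)

end IsWalkState

end Transition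

/-! ### A transition preserves the invariant and lowers the potential -/

section Step

variable {V : Type} {G : SimpleGraph V} {S : Prep V} {k : ℕ}

/-- The path along which the agents move. -/
theorem followPath_spec [Finite V] [DecidableEq V] (hG : G.IsTree) {A : AdjLists V}
    (hA : A.Represents G) {pos : ℕ → V} {occ : V → Option ℕ} (hp : IsPlacement k pos occ)
    {r top h t w : V} (htop : IsTop G r (occupied occ) top) (hh : h ∈ occupied occ)
    (ht : t ∈ occupied occ) (hw : w ∉ occupied occ) (hhw : G.Adj h w) {p : List V}
    (hpath : p = (traceBack (some h)
      (search A (fun v => (occ v).isSome) k [⟨t, none, 0⟩] []).val).val) :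
    IsPlacement k (followHead w p pos occ).val.1 (followHead w p pos occ).val.2.1 ∧
    occupied (followHead w p pos occ).val.2.1 = insert w (occupied occ) \ {t} ∧
    IsTransition G 1 (fun i : Fin k => pos i) (fun i => (followHead w p pos occ).val.1 i) ∧
    G.Adj t (followHead w p pos occ).val.2.2 ∧
    ((h = t ∧ (followHead w p pos occ).val.2.2 = w) ∨
      (followHead w p pos occ).val.2.2 ∈ occupied occ) := by
  have hpar : ∀ v, (occ v).isSome = true → (occ (parent G t v)).isSome = true :=
    fun v hv => htop.parent_mem hG ht hv
  obtain ⟨hl, hlm⟩ := search_from hG hA (active := fun v => (occ v).isSome) (q := t)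
    (m := k) ht hpar hp.ncard.le
  rw [traceBack_from hG hl (hlm h hh)] at hpath
  have hne : p ≠ [] := by rw [hpath]; simp
  have hmem : ∀ v ∈ p, (occ v).isSome = true := by
    intro v hv
    rw [hpath, mem_iterate_parent hG] at hv
    obtain ⟨m, rfl⟩ := hv
    clear hpath
    induction m with
    | zero => exact hh
    | succ m ih =>
      rw [Function.iterate_succ_apply']
      exact hpar _ ih
  have hlast : p.getLast hne = t := by
    subst hpath
    rw [List.getLast_eq_getElem]
    simp only [List.length_iterate, List.getElem_iterate, Nat.add_sub_cancel]
    exact iterate_parent_dist hG t h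
  have hwnone : occ w = none := by
    simpa [occupied] using hw
  have hchain : (w :: p).IsChain G.Adj := by
    have := isChain_iterate_parent hG (q := t) (v := h)
    rw [← hpath] at this
    rw [hpath, List.iterate] at this ⊢
    exact List.isChain_cons_cons.2 ⟨hhw.symm, this⟩
  obtain ⟨h1, h2, h3, h4, h5, h6⟩ := followHead_spec (G := G) hne hp hwnone hmem
    (hpath ▸ nodup_iterate_parent hG) hchain
  rw [hlast] at h2 h5
  have hO : occupied (followHead w p pos occ).val.2.1 = insert w (occupied occ) \ {t} := by
    ext v
    exact h2 v
  refine ⟨h1, hO, ⟨fun i => h3 i i.2, ?_⟩, h5, ?_⟩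
  · rw [h1.range_eq, hp.range_eq, hO]
    -- The target is the only newly occupied vertex, which makes this a 1-transition.
    have : (insert w (occupied occ) \ {t}) \ occupied occ = {w} := by
      ext v
      constructor
      · rintro ⟨⟨rfl | h7, -⟩, h8⟩
        · rfl
        · exact absurd h7 h8
      · rintro rfl
        refine ⟨⟨Or.inl rfl, ?_⟩, hw⟩
        rintro rfl
        exact hw ht
    rw [this, Set.ncard_singleton]
  · rcases h6 with ⟨h6, h7⟩ | h6
    · refine Or.inl ⟨?_, h7⟩
      rw [hpath, List.length_iterate] at h6
      exact (hG.connected.dist_eq_zero_iff.1 (by omega)).symm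
    · exact Or.inr (hmem _ h6)

open Classical in
/-- The number of transitions that can still be made. -/
noncomputable def potential [Fintype V] (G : SimpleGraph V) (S : Prep V) (k : ℕ)
    (explored : V → Bool) (head : V) : ℕ :=
  (Finset.univ.filter fun v => explored v = false).card +
    (Finset.univ.filter fun v => (¬ IsAnc G S.start v S.goal ∧ IsDeep G S.start k v) ∧
      (IsAnc G S.start v head ∨ ∃ x, IsAnc G S.start v x ∧ explored x = false)).card

/-- The first count loses `w`. The second does not grow: whatever lies above the new head `w` had
the unexplored `w` below it before. -/
theorem potential_explore [Fintype V] [DecidableEq V] {explored : V → Bool} {head w : V}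
    (hw : explored w = false) :
    potential G S k (Function.update explored w true) w < potential G S k explored head := by
  classical
  unfold potential
  refine add_lt_add_of_lt_of_le (Finset.card_lt_card ?_) (Finset.card_le_card ?_)
  · rw [Finset.ssubset_iff_of_subset]
    · exact ⟨w, by simp [hw], by simp⟩
    · intro v hv
      simp only [Finset.mem_filter, Finset.mem_univ, true_and] at hv ⊢
      by_cases hvw : v = w
      · rw [hvw]; exact hw
      · rwa [Function.update_of_ne hvw] at hv
  · intro v hv
    simp only [Finset.mem_filter, Finset.mem_univ, true_and] at hv ⊢
    refine ⟨hv.1, Or.inr ?_⟩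
    rcases hv.2 with h | ⟨x, hx, hxe⟩
    · exact ⟨w, h, hw⟩
    · refine ⟨x, hx, ?_⟩
      by_cases hxw : x = w
      · rw [hxw]; exact hw
      · rwa [Function.update_of_ne hxw] at hxe

theorem exists_open_below {explored : V → Bool} (hG : G.IsTree) {a x : V}
    (ha : explored a = true)
    (hax : IsAnc G S.start a x) (hx : explored x = false) :
    ∃ v w, IsAnc G S.start a v ∧ explored v = true ∧ G.Adj v w ∧ explored w = false := by
  induction hn : G.dist S.start x using Nat.strong_induction_on generalizing x with
  | _ n ih =>
    have hne : a ≠ x := by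
      rintro rfl
      rw [ha] at hx
      simp at hx
    have hr := hax.ne_root hne
    have hd := dist_parent hG hr
    cases hp : explored (parent G S.start x) with
    | true => exact ⟨_, x, hax.parent_right hne, hp, (adj_parent hG hr).symm, hx⟩
    | false => exact ih _ (by omega) (hax.parent_right hne) hp rfl

/-- The vertex `h` drops out of the second count: it is not above its parent, and an unexplored
vertex below `h` would lead to a vertex below `h` with an unexplored neighbour, while all of these
lie above the parent. -/
theorem potential_retreat [Fintype V] (hG : G.IsTree) {explored : V → Bool}
    {par : V → Option V} {stamp : V → ℕ} {clock : ℕ} {head : V}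
    (hs : IsSearchState G S explored par stamp clock head) {h : V} (hh : IsAnc G S.start h head)
    (hg : ¬ IsAnc G S.start h S.goal) (hdeep : IsDeep G S.start k h)
    (hopen : ∀ v x, explored v = true → G.Adj v x → explored x = false →
      IsAnc G S.start v (parent G S.start h)) :
    potential G S k explored (parent G S.start h) < potential G S k explored head := by
  classical
  have hr : h ≠ S.start := by rintro rfl; exact hg (IsAnc.root hG _)
  unfold potential
  refine Nat.add_lt_add_left (Finset.card_lt_card ?_) _
  rw [Finset.ssubset_iff_of_subset]
  · refine ⟨h, by simp [hg, hdeep, hh], ?_⟩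
    simp only [Finset.mem_filter, Finset.mem_univ, true_and]
    rintro ⟨-, h1 | ⟨x, hhx, hx⟩⟩
    · exact not_isAnc_parent hG hr h1
    · obtain ⟨v, w, hhv, hv, hvw, hw⟩ :=
        exists_open_below hG (hs.anc_mem hs.cur_mem hh) hhx hx
      exact not_isAnc_parent hG hr (hhv.trans (hopen v w hv hvw hw))
  · intro v hv
    simp only [Finset.mem_filter, Finset.mem_univ, true_and] at hv ⊢
    refine ⟨hv.1, hv.2.imp_left fun h1 => h1.trans ((IsAnc.parent_left h).trans hh)⟩

namespace IsWalkState

variable {s : State V k}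

/-- The case `k = 1` is separate throughout: head and tail coincide, there are no leaves, and every
vertex is deep. -/
theorem step [Fintype V] [DecidableEq V] (hG : G.IsTree) (hS : IsPrep G S) {A : AdjLists V}
    (hA : A.Represents G) (hk : 1 ≤ k) (hs : IsWalkState G S s) (hg : s.head ≠ S.goal) :
    IsWalkState G S (transitionStep A S s).val ∧
      potential G S k (transitionStep A S s).val.explored (transitionStep A S s).val.head <
        potential G S k s.explored s.head ∧
      (transitionStep A S s).val.walk.length = s.walk.length + 1 := by
  have hc := hs.chooseHead_spec hG hS hA hg
  set h := (chooseHead A S s).val.1 with hh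
  set t₀ := (chooseHead A S s).val.2.1 with ht₀
  set w := (chooseHead A S s).val.2.2 with hw
  obtain ⟨htO, htk⟩ := hs.chooseTail_spec hG hS hA hg hc
  set t := (chooseTail A S s h t₀).val with ht
  obtain ⟨top, htop⟩ := hs.top
  have hhO : h ∈ occupied s.occ := by
    rcases hc with hc | hc
    · exact hc.1
    · exact hc.1.1
  have hhh : IsAnc G S.start h s.head := by
    rcases hc with hc | hc
    · exact hc.2.1
    · exact hc.1.isAnc hG hs.head_mem
  have hup : IsUpChoice G S s h t₀ w → h ≠ S.start := by
    rintro ⟨-, h1, -⟩ h2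
    rw [h2] at h1
    exact h1 (IsAnc.root hG _)
  have hwO : w ∉ occupied s.occ := by
    intro h1
    rcases hc with hc | hc
    · have := hc.2.2.2.1
      rw [hs.explored w h1] at this
      simp at this
    · have h2 := hc.1.isAnc hG h1
      rw [hc.2.2.1] at h2
      exact not_isAnc_parent hG (hup hc) h2
  have hhw : G.Adj h w := by
    rcases hc with hc | hc
    · exact hc.2.2.1
    · rw [hc.2.2.1]
      exact adj_parent hG (hup hc)
  set p := (traceBack (some h)
    (RHWP.search A (fun v => (s.occ v).isSome) k [⟨t, none, 0⟩] []).val).val with hp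
  obtain ⟨hpl, hO, htr, hadj, hnext⟩ := followPath_spec hG hA hs.placement htop hhO htO hwO hhw hp
  set m := (followHead w p s.pos s.occ).val with hm
  have hval : (transitionStep A S s).val =
    { pos := m.1
      occ := m.2.1
      explored := Function.update s.explored w true
      parent := if (!s.explored w) = true then Function.update s.parent w (some h) else s.parent
      stamp := if (!s.explored w) = true then Function.update s.stamp w s.clock else s.stamp
      clock := s.clock + 1
      head := w
      tail := m.2.2
      walk := (fun i : Fin k => m.1 i) :: s.walk } := rfl
  have hcard : (occupied m.2.1).ncard = k := hpl.ncard
  have hone : k = 1 → t = h ∧ occupied s.occ = {h} := by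
    intro hk1
    obtain ⟨a, ha⟩ := Set.ncard_eq_one.1 (hs.placement.ncard.trans hk1)
    change occupied s.occ = {a} at ha
    have h1 : h = a := by rw [ha] at hhO; exact hhO
    have h2 : t = a := by rw [ha] at htO; exact htO
    exact ⟨h2.trans h1.symm, by rw [ha, h1]⟩
  have hwt : w ≠ t := by
    intro h1
    rw [h1] at hwO
    exact hwO htO
  have htail : 2 ≤ k → m.2.2 ∈ occupied s.occ := by
    intro hk2
    rcases hnext with ⟨h1, -⟩ | h1
    · exact absurd h1.symm (htk hk2).1
    · exact h1
  have hleaf : 2 ≤ k → IsLeafAt G (occupied s.occ) t m.2.2 := by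
    intro hk2
    obtain ⟨-, ⟨u, hu⟩, -⟩ := htk hk2
    rw [hu.2.2 _ (htail hk2) hadj]
    exact hu
  have hdown : IsDownChoice G S s h t₀ w → w ≠ S.start ∧ parent G S.start w = h ∧
      ∀ x ∈ occupied s.occ, ¬ IsAnc G S.start w x := by
    intro hc
    obtain ⟨h1, h2⟩ := hs.search.child_of_unexplored hG (hs.explored h hhO) hc.2.2.1 hc.2.2.2.1
    refine ⟨h1, h2, fun x hx hwx => ?_⟩
    have := hs.search.anc_mem (hs.explored x hx) hwx
    rw [hc.2.2.2.1] at this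
    simp at this
  have hk12 : k = 1 ∨ 2 ≤ k := by omega
  have hsingle : k = 1 → occupied m.2.1 = {w} ∧ m.2.2 = w := by
    intro hk1
    obtain ⟨h1, h2⟩ := hone hk1
    constructor
    · rw [hO, h2, h1]
      ext x
      constructor
      · rintro ⟨rfl | h3, h4⟩
        · rfl
        · exact absurd h3 h4
      · rintro rfl
        exact ⟨Or.inl rfl, fun h3 => hwt (h3.trans h1.symm)⟩
    · rcases hnext with ⟨-, h3⟩ | h3
      · exact h3
      · rw [h2] at h3
        have h3 : m.2.2 = h := h3
        rw [h3, h1] at hadj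
        exact absurd rfl hadj.ne
  have htop' : ∃ top', IsTop G S.start (occupied m.2.1) top' := by
    rcases hk12 with hk1 | hk2
    · rw [(hsingle hk1).1]
      exact ⟨w, rfl, fun x hx hxw => absurd hx hxw⟩
    · rw [hO]
      rcases hc with hc | hc
      · obtain ⟨h1, h2, -⟩ := hdown hc
        exact htop.move_down hG htO hhO (htk hk2).1 (hleaf hk2) h1 h2
      · rw [hc.2.2.1]
        exact ⟨_, hc.1.move_up hG htO (htk hk2).1 (hleaf hk2) (hup hc)⟩
  have hwm : w ∈ occupied m.2.1 := by
    rw [hO]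
    exact ⟨Or.inl rfl, hwt⟩
  have hconf : IsConfiguration G fun i : Fin k => m.1 i :=
    hpl.isConfiguration hG htop'.choose_spec
  have hsearch : IsSearchState G S (Function.update s.explored w true)
      (if (!s.explored w) = true then Function.update s.parent w (some h) else s.parent)
      (if (!s.explored w) = true then Function.update s.stamp w s.clock else s.stamp)
      (s.clock + 1) w := by
    rcases hc with hc | hc
    · rw [hc.2.2.2.1]
      exact hs.search.explore hG hS (hs.explored h hhO) hc.2.1 hc.2.2.2.2.2.1 hc.2.2.1 hc.2.2.2.1
        hc.2.2.2.2.1 (Nat.lt_succ_self _)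
    · have hwh : IsAnc G S.start w s.head := by
        rw [hc.2.2.1]
        exact (IsAnc.parent_left h).trans hhh
      have hwe : s.explored w = true := hs.search.anc_mem hs.search.cur_mem hwh
      have hupd : Function.update s.explored w true = s.explored := by
        rw [← hwe, Function.update_eq_self]
      rw [hupd, hwe]
      exact hs.search.retreat hwh (hs.goal_unexplored hg) hc.2.2.2.1 (Nat.le_succ _)
  have hpot : potential G S k (Function.update s.explored w true) w <
      potential G S k s.explored s.head := by
    rcases hc with hc | hc
    · exact potential_explore hc.2.2.2.1
    · have hwh : IsAnc G S.start w s.head := by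
        rw [hc.2.2.1]
        exact (IsAnc.parent_left h).trans hhh
      have hwe : s.explored w = true := hs.search.anc_mem hs.search.cur_mem hwh
      have hupd : Function.update s.explored w true = s.explored := by
        rw [← hwe, Function.update_eq_self]
      rw [hupd, hc.2.2.1]
      -- Here the invariant `OnlyInDeep` is spent: all agents are below `h`, so `h` is deep and pays
      -- for the move up.
      exact potential_retreat hG hs.search hhh hc.2.1
        (hs.deep h hc.2.1 fun x hx => hc.1.isAnc hG hx) (hc.2.2.1 ▸ hc.2.2.2.1)
  rw [hval]
  refine ⟨⟨hsearch, hpl, ?_, htop', hwm, ?_, ?_, ?_, ?_, ⟨_, rfl⟩, ?_, ?_, ?_⟩, hpot, rfl⟩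
  · intro v hv
    change v ∈ occupied m.2.1 at hv
    rw [hO] at hv
    change Function.update s.explored w true v = true
    rcases hv.1 with rfl | hv
    · exact Function.update_self ..
    · by_cases hvw : v = w
      · rw [hvw]; exact Function.update_self ..
      · rw [Function.update_of_ne hvw]
        exact hs.explored v hv
  · change m.2.2 ∈ occupied m.2.1
    rcases hk12 with hk1 | hk2
    · rw [(hsingle hk1).2]; exact hwm
    · rw [hO]
      exact ⟨Or.inr (htail hk2), fun h1 => hadj.ne (Eq.symm h1)⟩
  · intro hk2 h1
    change m.2.2 = w at h1
    exact hwO (h1 ▸ htail hk2)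
  · change IsBareTrail G S.start (occupied m.2.1) w m.2.2 ∨
      IsFirstTrail G S.start S.goal (occupied m.2.1) w m.2.2
    rcases hk12 with hk1 | hk2
    · left
      rw [(hsingle hk1).1]
      intro x hx hxw
      have hx : x = w := hx
      exact absurd (hx ▸ IsAnc.refl x) hxw
    · rcases hc with hc | hc
      · obtain ⟨h1, h2, h3⟩ := hdown hc
        rw [hO]
        exact trail_down hG hS.diam htop htO hhO (htk hk2).1 (hleaf hk2) h1 h2 h3 (htk hk2).2.2
      · left
        intro x _ _ c _ hcw
        rw [hc.2.2.1] at hcw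
        -- After a move up the head is above everything occupied, so the trail is bare.
        exact hcw.trans ((IsAnc.parent_left h).trans (hc.1.isAnc hG (htail hk2)))
  · change OnlyInDeep G S.start S.goal k (occupied m.2.1)
    rcases hk12 with hk1 | hk2
    · intro v _ _
      exact ⟨v, IsAnc.refl v, by omega⟩
    · rcases hc with hc | hc
      · obtain ⟨h1, h2, h3⟩ := hdown hc
        rw [hO] at hcard ⊢
        exact onlyInDeep_down hG hS.diam htop htO hhO (htk hk2).1 (hleaf hk2) h1 h2 h3 hcard
          (htk hk2).2.2 hs.deep
      · intro v hvg hv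
        refine hs.deep v hvg fun x hx => ?_
        have h1 := hv w hwm
        rw [hc.2.2.1] at h1
        exact h1.trans ((IsAnc.parent_left h).trans (hc.1.isAnc hG hx))
  · intro c hcm
    rcases List.mem_cons.1 hcm with rfl | hcm
    · exact hconf
    · exact hs.config c hcm
  · obtain ⟨W, hW⟩ := hs.walk_head
    have h1 := hs.chain
    change ((fun i : Fin k => m.1 i) :: s.walk).IsChain _
    rw [hW] at h1 ⊢
    exact List.isChain_cons_cons.2 ⟨htr, h1⟩
  · intro v hv
    change Function.update s.explored w true v = true at hv
    by_cases hvw : v = w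
    · refine ⟨_, List.mem_cons_self, ?_⟩
      rw [hpl.range_eq, hvw]
      exact hwm
    · rw [Function.update_of_ne hvw] at hv
      obtain ⟨c, hcm, hvc⟩ := hs.spanning v hv
      exact ⟨c, List.mem_cons_of_mem _ hcm, hvc⟩

theorem isRestrictedSpanningWalk (hG : G.IsTree) (hS : IsPrep G S) (hs : IsWalkState G S s)
    (hg : s.head = S.goal) : IsRestrictedSpanningWalk G s.walk.reverse := by
  obtain ⟨W, hW⟩ := hs.walk_head
  refine ⟨by simp [hW], fun c hc => hs.config c (List.mem_reverse.1 hc), ?_, fun v => ?_⟩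
  · rw [List.isChain_reverse]
    exact hs.chain
  · have hge : s.explored S.goal = true := hg ▸ hs.search.cur_mem
    obtain ⟨c, hc, hv⟩ := hs.spanning v (hs.search.all_explored hG hS hge v)
    exact ⟨c, List.mem_reverse.2 hc, hv⟩

/-- The state in which the transition phase starts. -/
theorem start (hG : G.IsTree) (hk : 1 ≤ k) {d : Deploy V}
    (hd : IsDeployState G S k d) (hdk : d.count = k) :
    IsWalkState G S (startState k S d).val ∧ (startState k S d).val.walk.length = 1 := by
  have hval : (startState k S d).val =
    { pos := d.pos, occ := d.occ, explored := d.explored, parent := d.parent, stamp := d.stamp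
      clock := d.count, head := d.pos (k - 1), tail := S.start
      walk := [fun i : Fin k => d.pos i] } := rfl
  obtain ⟨hcur, hlast⟩ := hd.last hdk
  have hpl : IsPlacement k d.pos d.occ := hdk ▸ hd.placement
  have hO : ∀ v, v ∈ occupied d.occ ↔ d.explored v = true := by
    intro v
    rw [hd.explored_iff v]
    rfl
  have htop : IsTop G S.start (occupied d.occ) S.start := by
    refine ⟨(hO _).2 (hd.search.root_mem hG), fun x hx hxr => ⟨hxr, (hO _).2 ?_⟩⟩
    exact hd.search.up x ((hO x).1 hx)
  have hconf := hpl.isConfiguration hG htop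
  rw [hval]
  refine ⟨⟨?_, hpl, fun v hv => (hO v).1 hv, ⟨_, htop⟩, ?_, htop.1, ?_, Or.inr ?_, ?_, ⟨_, rfl⟩, ?_,
    ?_, ?_⟩, rfl⟩
  · change IsSearchState G S d.explored d.parent d.stamp d.count (d.pos (k - 1))
    rw [← hcur]
    exact hd.search
  · exact hpl.isSome_pos (by omega)
  · intro hk2 h1
    change S.start = d.pos (k - 1) at h1
    rw [← hd.first] at h1
    have := hpl.inj (by omega) (by omega) h1
    omega
  · change IsFirstTrail G S.start S.goal (occupied d.occ) (d.pos (k - 1)) S.start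
    rw [← hcur]
    -- The tail has depth 0, so it suffices that branches leave strictly above the head; the newest
    -- vertex has nothing explored below it.
    refine ⟨IsAnc.root hG _, fun x _ => IsAnc.root hG x, fun x hx hxc c hcx hcc => ?_⟩
    rw [SimpleGraph.dist_self, add_zero]
    refine hcc.dist_lt hG ?_
    rintro rfl
    have := hlast x ((hO x).1 hx) hcx
    rw [this] at hxc
    exact hxc (IsAnc.refl _)
  · intro v hvg hv
    have h1 := (hv S.start htop.1).antisymm hG (IsAnc.root hG v)
    rw [h1] at hvg
    exact absurd (IsAnc.root hG _) hvg
  · intro c hc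
    rw [List.mem_singleton.1 hc]
    exact hconf
  · exact List.isChain_singleton _
  · intro v hv
    refine ⟨_, List.mem_singleton.2 rfl, ?_⟩
    rw [hpl.range_eq]
    exact (hO v).2 hv

end IsWalkState

end Step

/-! ## The whole algorithm -/

section Run

variable {V : Type} {G : SimpleGraph V} {S : Prep V} {k : ℕ}

theorem transitionStep_cost_le [DecidableEq V] {A : AdjLists V} {m : ℕ}
    (hm : ∀ v, (A.nbrs v).length ≤ m) (s : State V k) :
    (transitionStep A S s).cost ≤ 4 * (k * (m + 2)) + 5 * m + 9 * k + 20 := by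
  set c := chooseHead A S s with hc
  set t := chooseTail A S s c.val.1 c.val.2.1 with ht
  set l := search A (fun v => (s.occ v).isSome) k [⟨t.val, none, 0⟩] [] with hl
  set p := traceBack (some c.val.1) l.val with hp
  set f := followHead c.val.2.2 p.val s.pos s.occ with hf
  have hcost : (transitionStep A S s).cost =
    1 + (c.cost + (t.cost + (l.cost + (p.cost + (f.cost + (k + 1 + 0 + 0)))))) := rfl
  have h1 := chooseHead_cost_le (S := S) hm s
  have h2 := chooseTail_cost_le (S := S) hm s c.val.1 c.val.2.1
  have h3 := search_cost_le A (fun v => (s.occ v).isSome) hm k [⟨t.val, none, 0⟩] []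
  have h4 := search_length_le A (fun v => (s.occ v).isSome) k [⟨t.val, none, 0⟩] []
  have h5 := traceBack_cost_le (some c.val.1) l.val
  have h6 := traceBack_length_le (some c.val.1) l.val
  have h7 := followHead_cost_le c.val.2.2 p.val s.pos s.occ
  rw [← hc] at h1
  rw [← ht] at h2
  rw [← hl] at h3 h4
  rw [← hp] at h5 h6
  rw [← hf] at h7
  simp only [List.length_nil, add_zero] at h4
  rw [hcost]
  omega

theorem AdjLists.Represents.length_nbrs_le [Fintype V] [DecidableRel G.Adj] {A : AdjLists V}
    (hA : A.Represents G) (v : V) : (A.nbrs v).length ≤ G.maxDegree := by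
  classical
  rw [← List.toFinset_card_of_nodup (hA.nbrs_nodup v)]
  refine le_trans (Finset.card_le_card fun w hw => ?_) (G.degree_le_maxDegree v)
  rw [SimpleGraph.mem_neighborFinset]
  exact (hA.mem_nbrs v w).1 (List.mem_toFinset.1 hw)

/-- Every finite graph is represented by adjacency lists. -/
theorem exists_represents [Finite V] (G : SimpleGraph V) : ∃ A : AdjLists V, A.Represents G := by
  classical
  have := Fintype.ofFinite V
  exact ⟨⟨Finset.univ.toList, fun v => (G.neighborFinset v).toList⟩, Finset.nodup_toList _,
    fun v => by simp, fun v => Finset.nodup_toList _, fun v w => by simp⟩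

open Classical in
/-- The number of detours that are needed for the selected path. -/
noncomputable def detours [Fintype V] (G : SimpleGraph V) (S : Prep V) (k : ℕ) : ℕ :=
  (Finset.univ.filter fun v => ¬ IsAnc G S.start v S.goal ∧ IsDeep G S.start k v).card

theorem detours_le [Fintype V] : detours G S k ≤ Fintype.card V := Finset.card_le_univ _

theorem le_length_of_isRestrictedSpanningWalk [Fintype V] (hG : G.IsTree) (hS : IsPrep G S)
    (hk : 1 ≤ k) {W : List (Fin k → V)} (hW : IsRestrictedSpanningWalk G W) :
    Fintype.card V - k + detours G S k + 1 ≤ W.length := by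
  have h1 := hW.isSweep.lower_bound hG hk hS.diam
  have h2 := List.length_pos_of_ne_nil hW.nonempty
  have h3 : k ≤ Fintype.card V := by
    obtain ⟨c, hc⟩ := List.exists_mem_of_ne_nil _ hW.nonempty
    simpa using Fintype.card_le_of_injective c (hW.config c hc).1
  unfold detours
  omega

theorem potential_startState_le [Fintype V] {d : Deploy V}
    (hd : IsDeployState G S k d) (hdk : d.count = k) :
    potential G S k (startState k S d).val.explored (startState k S d).val.head ≤
      Fintype.card V - k + detours G S k := by
  classical
  unfold potential detours
  refine Nat.add_le_add ?_ (Finset.card_le_card fun v hv => ?_)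
  · have h1 : (Finset.univ.filter fun v => d.explored v = true).card = k := by
      rw [← hdk, ← hd.placement.ncard, Set.ncard_eq_toFinset_card']
      congr 1
      ext v
      simp [hd.explored_iff v]
    have h2 := Finset.card_filter_add_card_filter_not (s := Finset.univ)
      fun v => d.explored v = true
    simp only [Bool.not_eq_true, Finset.card_univ] at h2
    change (Finset.univ.filter fun v => d.explored v = false).card ≤ _
    omega
  · simp only [Finset.mem_filter, Finset.mem_univ, true_and] at hv ⊢
    exact hv.1

variable [Fintype V] [DecidableEq V] {A : AdjLists V}

theorem exists_deployment (hG : G.IsTree) (hS : IsPrep G S) (hA : A.Represents G) (hk : 1 ≤ k)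
    (hkn : k ≤ Fintype.card V) : ∃ d t,
      WhileRun (fun d => decide (d.count < k)) (deployStep A S) (deployInit A k S).val d t :=
  WhileRun.exists_of_measure (IsDeployState G S k)
    (fun d => 2 * (k - d.count) + G.dist S.start d.cur)
    (fun _ hd hg => hd.step hG hS hA hkn (of_decide_eq_true hg)) _ (IsDeployState.init hG A hk)

theorem deployment_spec (hG : G.IsTree) (hS : IsPrep G S) (hA : A.Represents G) (hk : 1 ≤ k)
    (hkn : k ≤ Fintype.card V) {m : ℕ} (hm : ∀ v, (A.nbrs v).length ≤ m) {d : Deploy V} {t : ℕ}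
    (h : WhileRun (fun d => decide (d.count < k)) (deployStep A S) (deployInit A k S).val d t) :
    IsDeployState G S k d ∧ d.count = k ∧ t ≤ 2 * (k - 1) * (2 * m + 4) + 1 := by
  obtain ⟨h1, h2, h3⟩ := WhileRun.spec (IsDeployState G S k)
    (fun d => 2 * (k - d.count) + G.dist S.start d.cur) (2 * m + 3)
    (fun _ hd hg => hd.step hG hS hA hkn (of_decide_eq_true hg))
    (fun d => deployStep_cost_le hm d) h (IsDeployState.init hG A hk)
  refine ⟨h1, le_antisymm h1.le (not_lt.1 (of_decide_eq_false h2)), ?_⟩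
  have h4 : 2 * (k - (deployInit A k S).val.count) + G.dist S.start (deployInit A k S).val.cur =
      2 * (k - 1) := by
    change 2 * (k - 1) + G.dist S.start S.start = _
    rw [SimpleGraph.dist_self, add_zero]
  rwa [h4] at h3

theorem exists_transitions (hG : G.IsTree) (hS : IsPrep G S) (hA : A.Represents G) (hk : 1 ≤ k)
    {d : Deploy V} (hd : IsDeployState G S k d) (hdk : d.count = k) : ∃ s t,
      WhileRun (fun s => decide (s.head ≠ S.goal)) (transitionStep A S)
        (startState k S d).val s t :=
  WhileRun.exists_of_measure (IsWalkState G S) (fun s => potential G S k s.explored s.head)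
    (fun _ hs hg =>
      have h := hs.step hG hS hA hk (of_decide_eq_true hg)
      ⟨h.1, h.2.1⟩) _ (IsWalkState.start hG hk hd hdk).1

/-- The transition phase visits all vertices with the least possible number of transitions. -/
theorem transitions_spec (hG : G.IsTree) (hS : IsPrep G S) (hA : A.Represents G) (hk : 1 ≤ k)
    {m : ℕ} (hm : ∀ v, (A.nbrs v).length ≤ m) {d : Deploy V}
    (hd : IsDeployState G S k d) (hdk : d.count = k) {s : State V k} {t : ℕ}
    (h : WhileRun (fun s => decide (s.head ≠ S.goal)) (transitionStep A S)
      (startState k S d).val s t) :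
    IsRestrictedSpanningWalk G s.walk.reverse ∧
      s.walk.length = Fintype.card V - k + detours G S k + 1 ∧
      t ≤ (Fintype.card V - k + detours G S k) *
        (4 * (k * (m + 2)) + 5 * m + 9 * k + 20 + 1) + 1 := by
  have hpot := potential_startState_le hd hdk
  obtain ⟨hstart, hlen⟩ := IsWalkState.start hG hk hd hdk
  -- The number of configurations plus the potential never grows, which bounds the length from
  -- above; the lower bound for arbitrary walks then gives equality.
  obtain ⟨⟨h1, h2⟩, h3, h4⟩ := WhileRun.spec
    (fun s => IsWalkState G S s ∧ s.walk.length + potential G S k s.explored s.head ≤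
      Fintype.card V - k + detours G S k + 1)
    (fun s => potential G S k s.explored s.head) _
    (fun s hs hg => by
      obtain ⟨h1, h2, h3⟩ := hs.1.step hG hS hA hk (of_decide_eq_true hg)
      exact ⟨⟨h1, by have := hs.2; omega⟩, h2⟩)
    (fun s => transitionStep_cost_le hm s) h ⟨hstart, by omega⟩
  have hgoal : s.head = S.goal := not_not.1 (of_decide_eq_false h3)
  have hW := h1.isRestrictedSpanningWalk hG hS hgoal
  have hlow := le_length_of_isRestrictedSpanningWalk hG hS hk hW
  rw [List.length_reverse] at hlow
  exact ⟨hW, by omega, h4.trans (Nat.add_le_add_right (Nat.mul_le_mul_right _ hpot) 1)⟩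

/-- The optimum is attained by running the two loops with the given `S` on arbitrary adjacency
lists. As `S` need not come from `prepare`, every longest path is covered. -/
theorem isLeast_restrictedWalkLengths (hG : G.IsTree) (hS : IsPrep G S) (hk : 1 ≤ k)
    (hkn : k ≤ Fintype.card V) :
    IsLeast (restrictedWalkLengths G k) (Fintype.card V - k + detours G S k) := by
  obtain ⟨A, hA⟩ := exists_represents G
  classical
  obtain ⟨d, _, hd⟩ := exists_deployment hG hS hA hk hkn
  obtain ⟨h1, h2, -⟩ := deployment_spec hG hS hA hk hkn hA.length_nbrs_le hd
  obtain ⟨s, _, hs⟩ := exists_transitions hG hS hA hk h1 h2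
  obtain ⟨h3, h4, -⟩ := transitions_spec hG hS hA hk hA.length_nbrs_le h1 h2 hs
  refine ⟨⟨_, h3, by rw [List.length_reverse, h4]⟩, ?_⟩
  rintro l ⟨W, hW, hl⟩
  have := le_length_of_isRestrictedSpanningWalk hG hS hk hW
  omega

theorem exists_KRHWPForTree (hG : G.IsTree) (hA : A.Represents G) (hk : 1 ≤ k)
    (hkn : k ≤ Fintype.card V) : ∃ W t, KRHWPForTree A k W t := by
  classical
  obtain ⟨root, hroot⟩ : ∃ root, A.verts.head? = some root := by
    have h := hA.length_verts
    cases hv : A.verts with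
    | nil => rw [hv, List.length_nil] at h; omega
    | cons x xs => exact ⟨x, rfl⟩
  have hS := isPrep_prepare hG hA root
  obtain ⟨d, t₁, hd⟩ := exists_deployment hG hS hA hk hkn
  obtain ⟨h1, h2, -⟩ := deployment_spec hG hS hA hk hkn hA.length_nbrs_le hd
  obtain ⟨s, t₂, hs⟩ := exists_transitions hG hS hA hk h1 h2
  exact ⟨_, _, root, hroot, d, t₁, hd, s, t₂, hs, rfl, rfl⟩

theorem KRHWPForTree.spec [DecidableRel G.Adj] (hG : G.IsTree) (hA : A.Represents G) (hk : 1 ≤ k)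
    (hkn : k ≤ Fintype.card V) {W : List (Fin k → V)} {t : ℕ} (h : KRHWPForTree A k W t) :
    IsRestrictedSpanningWalk G W ∧ IsLeast (restrictedWalkLengths G k) (W.length - 1) ∧
      (2 ≤ Fintype.card V → t ≤ 200 * (Fintype.card V * k * G.maxDegree)) := by
  obtain ⟨root, hroot, d, t₁, hd, s, t₂, hs, rfl, rfl⟩ := h
  have hS := isPrep_prepare hG hA root
  have hm := hA.length_nbrs_le
  obtain ⟨h1, h2, ht₁⟩ := deployment_spec hG hS hA hk hkn hm hd
  obtain ⟨h3, h4, ht₂⟩ := transitions_spec hG hS hA hk hm h1 h2 hs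
  refine ⟨h3, ?_, fun hn => ?_⟩
  · rw [List.length_reverse, h4, Nat.add_sub_cancel]
    exact isLeast_restrictedWalkLengths hG hS hk hkn
  · have hprep := prepare_cost_le hm root
    have hinit : (deployInit A k (prepare A root).val).cost =
        A.verts.length + 1 + 0 + (A.verts.length + 1 + 0 + (A.verts.length + 1 + 0 +
          (A.verts.length + 1 + 0 + (k + 1 + 0)))) := rfl
    have hfirst : (startState k (prepare A root).val d).cost = k + 1 + 0 + 0 := rfl
    have hdet := detours_le (G := G) (S := (prepare A root).val) (k := k)
    rw [hA.length_verts] at hprep hinit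
    -- This is where `n ≥ 2` enters: with a positive degree, all lower-order terms are absorbed by
    -- multiples of `n * k * m`.
    have hΔ : 1 ≤ G.maxDegree := by
      have : Nontrivial V := Fintype.one_lt_card_iff_nontrivial.1 hn
      exact (hG.connected.preconnected.degree_pos_of_nontrivial root).trans_le
        (G.degree_le_maxDegree root)
    generalize detours G (prepare A root).val k = D at *
    generalize Fintype.card V = n at *
    generalize G.maxDegree = m at *
    have e1 : k ≤ k * m := Nat.le_mul_of_pos_right _ hΔ
    have e2 : m ≤ k * m := Nat.le_mul_of_pos_left _ hk
    have e3 : n ≤ n * m := Nat.le_mul_of_pos_right _ hΔ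
    have e4 : n * m ≤ n * k * m := Nat.mul_le_mul_right _ (Nat.le_mul_of_pos_right _ hk)
    have e5 : k * m ≤ n * k * m := by
      rw [mul_assoc]
      exact Nat.le_mul_of_pos_left _ (by omega)
    have e6 : 4 * (k * (m + 2)) + 5 * m + 9 * k + 20 + 1 ≤ 47 * (k * m) := by
      rw [Nat.mul_add k m 2]
      omega
    -- At most `2 * n` transitions, each of cost at most `47 * (k * m)` including the test. The
    -- remaining phases fit easily into the rest of the constant 200.
    have e7 : (n - k + D) * (4 * (k * (m + 2)) + 5 * m + 9 * k + 20 + 1) ≤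
        94 * (n * k * m) :=
      calc _ ≤ (2 * n) * (47 * (k * m)) := Nat.mul_le_mul (by omega) e6
        _ = _ := by ring
    have e8 : 2 * (k - 1) * (2 * m + 4) ≤ 12 * (k * m) :=
      calc _ ≤ (2 * k) * (6 * m) := Nat.mul_le_mul (by omega) (by omega)
        _ = _ := by ring
    rw [Nat.mul_add n m 2] at hprep
    omega

end Run

end RHWP

theorem mainTheorem2 :
    ∃ C : ℕ, ∀ (V : Type) [Fintype V] [DecidableEq V] (G : SimpleGraph V) [DecidableRel G.Adj]
      (k : ℕ), G.IsTree → 1 ≤ k → k ≤ Fintype.card V →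
      -- the value of the optimum
      (∀ (a b : V) (P : G.Walk a b), RHWP.IsLongestPath G P →
        IsLeast (RHWP.restrictedWalkLengths G k)
          ((Fintype.card V - k) + ∑ e ∈ G.edgeFinset, RHWP.detour G k P e)) ∧
      -- the algorithm
      ∀ A : RHWP.AdjLists V, A.Represents G →
        (∃ W t, RHWP.KRHWPForTree A k W t) ∧
        ∀ W t, RHWP.KRHWPForTree A k W t →
          RHWP.IsRestrictedSpanningWalk G W ∧
          IsLeast (RHWP.restrictedWalkLengths G k) (W.length - 1) ∧
          (2 ≤ Fintype.card V → t ≤ C * (Fintype.card V * k * G.maxDegree)) := by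
  refine ⟨200, fun V _ _ G _ k hG hk hkn => ⟨fun a b P hP => ?_, fun A hA =>
    ⟨RHWP.exists_KRHWPForTree hG hA hk hkn, fun W t h => h.spec hG hA hk hkn⟩⟩⟩
  obtain ⟨S, hS, rfl, rfl⟩ := RHWP.exists_isPrep hG hP
  rw [RHWP.sum_detour hG hP k]
  exact RHWP.isLeast_restrictedWalkLengths hG hS hk hkn
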